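/- Let $\mathcal N=\mathcal N_0\mathcal N_1\mathcal N_2$ be a square-free positive integer, $k\ge 4$ an integer, and $\chi$ a Dirichlet character modulo $\mathcal N$, written $\chi=\chi_{\mathcal N_0}\chi_{\mathcal N_1}\chi_{\mathcal N_2}$ with $\chi_{\mathcal N_i}$ a character modulo $\mathcal N_i$; assume $\chi_{\mathcal N_1}^2=1$. For a block matrix $\gamma=\begin{pmatrix}A_\gamma&B_\gamma\\C_\gamma&D_\gamma\end{pmatrix}\in Sp_2(\mathbb R)$ (so $4\times4$), a function $f$ on the Siegel upper half space $\mathfrak h_{(2)}$ of degree $2$ and $\tau\in\mathfrak h_{(2)}$, put $(f|\gamma)(\tau)=(\det\gamma)^{k/2}\det(C_\gamma\tau+D_\gamma)^{-k}f\big((A_\gamma\tau+B_\gamma)(C_\gamma\tau+D_\gamma)^{-1}\big)$. Let $\Gamma_0(\mathcal N)=\{\gamma\in Sp_2(\mathbb Z): C_\gamma\equiv0 \bmod \mathcal N\}$ and $\Gamma_\infty^+=\{\gamma\in Sp_2(\mathbb Z): C_\gamma=0,\ \det D_\gamma=1\}$. Let $\rho=(\mathcal N_0,\mathcal N_1,\mathcal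 N_2)$ and $\gamma_\rho=\begin{pmatrix}I&0\\M_\rho&I\end{pmatrix}$, where $M_\rho$ is any integral diagonal $2\times2$ matrix that is congruent to $0$, $\begin{pmatrix}1&0\\0&0\end{pmatrix}$, $I$ modulo each prime dividing $\mathcal N_0$, $\mathcal N_1$, $\mathcal N_2$ respectively. Define $$\mathbb E_\rho(\tau)=\tfrac12\sum_{\gamma}\overline\chi(\det D_\gamma)\,(1|\gamma_\rho\gamma)(\tau),$$ where $\gamma$ runs over elements of $\Gamma_0(\mathcal N)$ such that $\Gamma_\infty^+\gamma_\rho\gamma$ runs once through the $\Gamma_0(\mathcal N)$-orbit of the coset $\Gamma_\infty^+\gamma_\rho$. (If $\chi(-1)=(-1)^k$ this is the sum over the $\Gamma_0(\mathcal N)$-orbit of $\Gamma_\infty\gamma_\rho$, without the factor $\tfrac12$, where $\Gamma_\infty=\{\gamma\in Sp_2(\mathbb Z):C_\gamma=0\}$.) For a prime $p$ put $\delta_1=\mathrm{diag}(p,1,p^{-1},1)$ and $$f|T_1(p^2)=p^{k-3}\sum_{\gamma}\overline\chi(\det D_\gamma)\,f|\delta_1^{-1}\gamma,$$ where $\gamma$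 runs over representatives of the finite coset space $(\delta_1\Gamma_0(\mathcal N)\delta_1^{-1}\cap\Gamma_0(\mathcal N))\backslash\Gamma_0(\mathcal N)$. Then the series $\mathbb E_\rho(\tau)$ converges absolutely for every $\tau\in\mathfrak h_{(2)}$, and for every prime $p\nmid\mathcal N$ $$\mathbb E_\rho|T_1(p^2)=(p+1)\big(\chi_{\mathcal N_0}(p^2)p^{2k-3}+\chi(p)p^{k-3}(p-1)+\chi_{\mathcal N_2}(p^2)\big)\,\mathbb E_\rho .$$ -/

import Mathlib

open Matrix

namespace SiegelDegTwo

/-- `Sp₂(R)`, the group of `4 × 4` symplectic matrices over `R`, in `2 × 2` blocks. -/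
abbrev Sp (R : Type) [CommRing R] : Type := symplecticGroup (Fin 2) R

section Blocks

variable {R : Type} [CommRing R]

/-- The blocks of `γ = (A B; C D)`. -/
def blkA (γ : Sp R) : Matrix (Fin 2) (Fin 2) R := toBlocks₁₁ γ.1
def blkB (γ : Sp R) : Matrix (Fin 2) (Fin 2) R := toBlocks₁₂ γ.1
def blkC (γ : Sp R) : Matrix (Fin 2) (Fin 2) R := toBlocks₂₁ γ.1
def blkD (γ : Sp R) : Matrix (Fin 2) (Fin 2) R := toBlocks₂₂ γ.1

theorem coe_eq_fromBlocks (γ : Sp R) :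
    γ.1 = fromBlocks (blkA γ) (blkB γ) (blkC γ) (blkD γ) :=
  (fromBlocks_toBlocks _).symm

theorem coe_mul_eq (γ δ : Sp R) :
    (γ * δ).1 =
      fromBlocks (blkA γ * blkA δ + blkB γ * blkC δ) (blkA γ * blkB δ + blkB γ * blkD δ)
        (blkC γ * blkA δ + blkD γ * blkC δ) (blkC γ * blkB δ + blkD γ * blkD δ) := by
  rw [Submonoid.coe_mul, coe_eq_fromBlocks γ, coe_eq_fromBlocks δ, fromBlocks_multiply]

theorem coe_inv_eq (γ : Sp R) :
    (γ⁻¹).1 =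
      fromBlocks (blkD γ)ᵀ (-(blkB γ)ᵀ) (-(blkC γ)ᵀ) (blkA γ)ᵀ := by
  rw [SymplecticGroup.coe_inv, coe_eq_fromBlocks γ, fromBlocks_transpose, J, fromBlocks_neg,
    fromBlocks_multiply, fromBlocks_multiply]
  simp

theorem blkC_mul (γ δ : Sp R) : blkC (γ * δ) = blkC γ * blkA δ + blkD γ * blkC δ := by
  rw [blkC, coe_mul_eq, toBlocks_fromBlocks₂₁]

theorem blkD_mul (γ δ : Sp R) : blkD (γ * δ) = blkC γ * blkB δ + blkD γ * blkD δ := by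
  rw [blkD, coe_mul_eq, toBlocks_fromBlocks₂₂]

theorem blkC_inv (γ : Sp R) : blkC γ⁻¹ = -(blkC γ)ᵀ := by
  simp [blkC, coe_inv_eq]

theorem blkA_one : blkA (1 : Sp R) = 1 := by
  ext i j; simp [blkA, toBlocks₁₁, one_apply]

theorem blkC_one : blkC (1 : Sp R) = 0 := by
  ext i j; simp [blkC, toBlocks₂₁]

theorem blkD_one : blkD (1 : Sp R) = 1 := by
  ext i j; simp [blkD, toBlocks₂₂, one_apply]

end Blocks

/-- The inclusion `Sp₂(ℤ) → Sp₂(ℝ)`. -/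
def toReal : Sp ℤ →* Sp ℝ where
  toFun γ := ⟨γ.1.map (Int.castRingHom ℝ),
    SymplecticGroup.map_mem γ.2 (Int.castRingHom ℝ)⟩
  map_one' := Subtype.ext (by simp)
  map_mul' γ δ := Subtype.ext (Matrix.map_mul (f := Int.castRingHom ℝ))

/-- `Γ₀(N)`: the elements of `Sp₂(ℤ)` with lower left block divisible by `N`. -/
def Gamma0 (N : ℕ) : Subgroup (Sp ℤ) where
  carrier := {γ | ∀ i j, (N : ℤ) ∣ blkC γ i j}
  one_mem' i j := by simp [blkC_one]
  mul_mem' {γ δ} hγ hδ i j := by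
    rw [blkC_mul, Matrix.add_apply, Matrix.mul_apply, Matrix.mul_apply]
    exact dvd_add (Finset.dvd_sum fun l _ => (hγ i l).mul_right _)
      (Finset.dvd_sum fun l _ => (hδ l j).mul_left _)
  inv_mem' {γ} hγ i j := by
    rw [blkC_inv]
    simpa using hγ j i

/-- The elements `(A B; 0 D)` of `Sp₂(ℤ)` with `det D = 1`. The coset of `(* *; M N)` modulo this
subgroup is determined by, and determines, the `SL₂(ℤ)`-class of the pair `(M N)`. -/
def GammaInfPlus : Subgroup (Sp ℤ) where
  carrier := {γ | blkC γ = 0 ∧ (blkD γ).det = 1}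
  one_mem' := ⟨blkC_one, by simp [blkD_one]⟩
  mul_mem' {γ δ} hγ hδ := by
    refine ⟨by rw [blkC_mul, hγ.1, hδ.1]; simp, ?_⟩
    rw [blkD_mul, hγ.1, zero_mul, zero_add, det_mul, hγ.2, hδ.2, one_mul]
  inv_mem' {γ} hγ := by
    have hC : blkC γ⁻¹ = 0 := by rw [blkC_inv, hγ.1]; simp
    refine ⟨hC, ?_⟩
    have h : (blkD (γ⁻¹ * γ)).det = 1 := by rw [inv_mul_cancel, blkD_one, det_one]
    rwa [blkD_mul, hC, zero_mul, zero_add, det_mul, hγ.2, mul_one] at h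

/-- The Siegel upper half space of degree `2`. -/
def upperHalfSpace : Set (Matrix (Fin 2) (Fin 2) ℂ) :=
  {τ | τ.IsSymm ∧ (τ.map Complex.im).PosDef}

/-- `Cτ + D`. -/
noncomputable def autFactor (γ : Sp ℝ) (τ : Matrix (Fin 2) (Fin 2) ℂ) :
    Matrix (Fin 2) (Fin 2) ℂ :=
  (blkC γ).map Complex.ofReal * τ + (blkD γ).map Complex.ofReal

/-- `γ ∘ τ = (Aτ + B)(Cτ + D)⁻¹`. -/
noncomputable def act (γ : Sp ℝ) (τ : Matrix (Fin 2) (Fin 2) ℂ) : Matrix (Fin 2) (Fin 2) ℂ :=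
  ((blkA γ).map Complex.ofReal * τ + (blkB γ).map Complex.ofReal) * (autFactor γ τ)⁻¹

/-- The weight `k` slash operator `(f|γ)(τ) = (det γ)^{k/2} det(Cτ + D)^{-k} f(γ ∘ τ)`.
Functions on the upper half space are represented by functions on all complex matrices, of which
only the values on the (stable) upper half space are relevant. -/
noncomputable def slash (k : ℕ) (f : Matrix (Fin 2) (Fin 2) ℂ → ℂ) (γ : Sp ℝ)
    (τ : Matrix (Fin 2) (Fin 2) ℂ) : ℂ :=
  ((γ.1.det ^ ((k : ℝ) / 2) : ℝ) : ℂ) *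
    (autFactor γ τ).det ^ (-(k : ℤ)) * f (act γ τ)

/-- The value `χ(det D)` for `γ = (A B; C D)` in `Sp₂(ℤ)`. -/
noncomputable def charD {N : ℕ} (χ : DirichletCharacter ℂ N) (γ : Sp ℤ) : ℂ :=
  χ (((blkD γ).det : ℤ) : ZMod N)

/-- `γ, γ' ∈ Γ₀(N)` are related if `γ₀γ` and `γ₀γ'` lie in the same coset of `GammaInfPlus`.
The classes are the cosets in the `Γ₀(N)`-orbit of the coset of `γ₀`. -/
def orbitSetoid (N : ℕ) (γ₀ : Sp ℤ) : Setoid (Gamma0 N) :=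
  (QuotientGroup.rightRel GammaInfPlus).comap fun γ => γ₀ * (γ : Sp ℤ)

/-- The summand `conj χ(det D_γ) · (1|γ₀γ)(τ)` of the Eisenstein series. -/
noncomputable def eisensteinTerm {N : ℕ} (k : ℕ) (χ : DirichletCharacter ℂ N) (γ₀ : Sp ℤ)
    (τ : Matrix (Fin 2) (Fin 2) ℂ) (γ : Gamma0 N) : ℂ :=
  starRingEnd ℂ (charD χ γ) * slash k (fun _ => 1) (toReal (γ₀ * (γ : Sp ℤ))) τ

/-- The Siegel Eisenstein series attached to `γ₀`: half of the sum over the cosets modulo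
`GammaInfPlus` (that is, over `SL₂(ℤ)`-classes of coprime symmetric pairs) in the `Γ₀(N)`-orbit of
`γ₀`. -/
noncomputable def eisenstein {N : ℕ} (k : ℕ) (χ : DirichletCharacter ℂ N) (γ₀ : Sp ℤ)
    (τ : Matrix (Fin 2) (Fin 2) ℂ) : ℂ :=
  (1 / 2) * ∑' c : Quotient (orbitSetoid N γ₀), eisensteinTerm k χ γ₀ τ c.out

/-- `γ_ρ = (I 0; M I)` with `M = diag(d 0, d 1)`. -/
def cuspRep (d : Fin 2 → ℤ) : Sp ℤ :=
  ⟨fromBlocks 1 0 (diagonal d) 1, SymplecticGroup.fromBlocks_mem_iff.2 (by simp)⟩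

/-- `M = diag(d 0, d 1)` is congruent to `0`, `diag(1, 0)`, `I` modulo each prime dividing
`N₀`, `N₁`, `N₂` respectively. -/
def IsCuspDiag (N₀ N₁ N₂ : ℕ) (d : Fin 2 → ℤ) : Prop :=
  (∀ q : ℕ, q.Prime → q ∣ N₀ → d 0 ≡ 0 [ZMOD q] ∧ d 1 ≡ 0 [ZMOD q]) ∧
  (∀ q : ℕ, q.Prime → q ∣ N₁ → d 0 ≡ 1 [ZMOD q] ∧ d 1 ≡ 0 [ZMOD q]) ∧
  (∀ q : ℕ, q.Prime → q ∣ N₂ → d 0 ≡ 1 [ZMOD q] ∧ d 1 ≡ 1 [ZMOD q])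

/-- `δ₁ = diag(X, X⁻¹)` with `X = diag(p, 1)`. -/
noncomputable def delta1 (p : ℕ) [NeZero p] : Sp ℝ :=
  ⟨fromBlocks (diagonal ![(p : ℝ), 1]) 0 0 (diagonal ![(p : ℝ)⁻¹, 1]),
    SymplecticGroup.fromBlocks_mem_iff.2 (by
      have hp : (p : ℝ) ≠ 0 := NeZero.ne _
      refine ⟨by simp, by simp, ?_⟩
      ext i j
      fin_cases i <;> fin_cases j <;> simp [hp])⟩

/-- `δ₁ Γ₀(N) δ₁⁻¹ ∩ Γ₀(N)`, as a subgroup of `Γ₀(N)`. -/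
noncomputable def heckeSubgroup (N p : ℕ) [NeZero p] : Subgroup (Gamma0 N) :=
  (((Gamma0 N).map toReal).map (MulAut.conj (delta1 p)).toMonoidHom).comap
    (toReal.comp (Gamma0 N).subtype)

/-- The cosets `(δ₁ Γ₀(N) δ₁⁻¹ ∩ Γ₀(N)) \ Γ₀(N)`. -/
abbrev HeckeCosets (N p : ℕ) [NeZero p] : Type :=
  Quotient (QuotientGroup.rightRel (heckeSubgroup N p))

/-- The Hecke operator
`f|T₁(p²) = p^{k-3} ∑_γ conj χ(det D_γ) f|δ₁⁻¹γ`, with `γ` running over representatives of the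
(finitely many, see `finite_heckeCosets`) cosets `(δ₁ Γ₀(N) δ₁⁻¹ ∩ Γ₀(N)) \ Γ₀(N)`. -/
noncomputable def heckeT1 {N : ℕ} (k : ℕ) (χ : DirichletCharacter ℂ N) (p : ℕ) [NeZero p]
    (f : Matrix (Fin 2) (Fin 2) ℂ → ℂ) (τ : Matrix (Fin 2) (Fin 2) ℂ) : ℂ :=
  (p : ℂ) ^ ((k : ℤ) - 3) * ∑ᶠ c : HeckeCosets N p,
    starRingEnd ℂ (charD χ (c.out : Gamma0 N)) *
      slash k f ((delta1 p)⁻¹ * toReal ((c.out : Gamma0 N) : Sp ℤ)) τ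

theorem coe_delta1 (p : ℕ) [NeZero p] :
    (delta1 p).1 = diagonal (Sum.elim ![(p : ℝ), 1] ![(p : ℝ)⁻¹, 1]) :=
  fromBlocks_diagonal _ _

/-- An element of `Γ₀(N)` congruent to `1` modulo `p² N` lies in `heckeSubgroup N p`. -/
theorem mem_heckeSubgroup_of_congr {N p : ℕ} [NeZero p] (γ : Gamma0 N)
    (h : ∀ i j, ((p ^ 2 * N : ℕ) : ℤ) ∣ (γ.1.1 - 1) i j) : γ ∈ heckeSubgroup N p := by
  have hp : (p : ℝ) ≠ 0 := NeZero.ne _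
  choose E hE using h
  set a : Fin 2 ⊕ Fin 2 → ℕ := Sum.elim ![2, 1] ![0, 1] with ha
  set η : Matrix (Fin 2 ⊕ Fin 2) (Fin 2 ⊕ Fin 2) ℤ :=
    1 + Matrix.of fun i j => (N : ℤ) * (p ^ (2 + a j - a i) * E i j) with hη
  have hγ : γ.1.1 = 1 + Matrix.of fun i j => ((p ^ 2 * N : ℕ) : ℤ) * E i j := by
    ext i j
    rw [Matrix.add_apply, Matrix.of_apply, ← hE i j, Matrix.sub_apply]
    ring
  have key : (delta1 p).1 * η.map (Int.castRingHom ℝ) = (toReal γ.1).1 * (delta1 p).1 := by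
    have h1 : (toReal γ.1).1 = γ.1.1.map (Int.castRingHom ℝ) := rfl
    rw [h1, hγ, coe_delta1]
    ext i j
    rw [diagonal_mul, mul_diagonal]
    rcases i with i | i <;> rcases j with j | j <;> fin_cases i <;> fin_cases j <;>
      simp [hη, ha, one_apply] <;> field_simp
  have hinv : (delta1 p)⁻¹.1 * (delta1 p).1 = 1 :=
    congrArg Subtype.val (inv_mul_cancel (delta1 p))
  have key2 : η.map (Int.castRingHom ℝ) = ((delta1 p)⁻¹ * (toReal γ.1 * delta1 p)).1 := by
    rw [Submonoid.coe_mul, Submonoid.coe_mul, ← key, ← Matrix.mul_assoc, hinv, Matrix.one_mul]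
  have hmem : η ∈ symplecticGroup (Fin 2) ℤ := by
    have h2 := ((delta1 p)⁻¹ * (toReal γ.1 * delta1 p)).2
    rw [← key2, SymplecticGroup.mem_iff, ← map_J (Fin 2) (Int.castRingHom ℝ), ← transpose_map,
      ← Matrix.map_mul, ← Matrix.map_mul] at h2
    exact SymplecticGroup.mem_iff.2
      (Matrix.map_injective (Int.castRingHom ℝ).injective_int h2)
  have hΓ : (⟨η, hmem⟩ : Sp ℤ) ∈ Gamma0 N := by
    intro i j
    simp [blkC, toBlocks₂₁, hη]
  have key3 : toReal ⟨η, hmem⟩ = (delta1 p)⁻¹ * (toReal γ.1 * delta1 p) := Subtype.ext key2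
  refine Subgroup.mem_comap.2 (Subgroup.mem_map.2 ⟨_, Subgroup.mem_map_of_mem toReal hΓ, ?_⟩)
  rw [key3]
  simp [mul_assoc]

theorem finite_heckeCosets (N p : ℕ) [NeZero N] [NeZero p] : Finite (HeckeCosets N p) := by
  have : NeZero (p ^ 2 * N) := ⟨mul_ne_zero (pow_ne_zero _ (NeZero.ne p)) (NeZero.ne N)⟩
  refine Finite.of_injective (β := Matrix (Fin 2 ⊕ Fin 2) (Fin 2 ⊕ Fin 2) (ZMod (p ^ 2 * N)))
    (fun c => c.out.1.1.map (Int.castRingHom _)) fun c c' hcc => ?_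
  rw [← c.out_eq, ← c'.out_eq]
  refine Quotient.sound (QuotientGroup.rightRel_apply.2 (mem_heckeSubgroup_of_congr _ ?_))
  have h1 : (c'.out * c.out⁻¹).1.1 - 1 = (c'.out.1.1 - c.out.1.1) * (c.out⁻¹).1.1 := by
    have h2 : c.out.1.1 * (c.out⁻¹).1.1 = 1 :=
      congrArg (fun x : Gamma0 N => x.1.1) (mul_inv_cancel c.out)
    rw [Matrix.sub_mul, h2]
    rfl
  intro i j
  rw [h1, Matrix.mul_apply]
  refine Finset.dvd_sum fun l _ => Dvd.dvd.mul_right ?_ _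
  have h3 : ((c.out.1.1 i l : ℤ) : ZMod (p ^ 2 * N)) = ((c'.out.1.1 i l : ℤ) : ZMod _) :=
    congrFun (congrFun hcc i) l
  rw [Matrix.sub_apply]
  exact (ZMod.intCast_eq_intCast_iff_dvd_sub _ _ _).1 h3

end SiegelDegTwo

namespace SiegelDegTwo

/-! ### Block relations and standard elements of the symplectic group. -/

section Blocks

variable {R : Type} [CommRing R]

/-! The Hecke operator permutes the terms of the series and rescales them. Put δ = p δ₁⁻¹ = diag(1,
p, p², p). For h, γ in Γ₀(N) the integral similitude γ_ρ h δ γ factors as (A B; 0 U) γ_ρ h' with det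
U > 0 (`exists_eq_upper_mul`); because p is prime to N, the right factor can be taken in the same
orbit (`exists_upper_mul_orbit`). For fixed γ the assignment h ↦ h' is a bijection on the cosets of
the orbit, its inverse coming from the adjoint relation (`upper_inverse`, `exists_heckeRel_equiv`).
Reindexing by h' turns E|T₁ into a sum of the terms of E, each multiplied by the sum over the Hecke
cosets γ of a weight depending only on det U = p^j, where j is 1, 2 or 3.

The weight is (p^j / p²)^{-k}, from the automorphy factor, times χ₀(p)^{3-j} χ₁(p)^{3-j}
χ₂(p)^{j-1}. The characters are found by comparing D-blocks modulo N₀, N₁, N₂ (`exists_det_congr`);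
modulo N₁ the comparison holds only up to the square of a unit, which is where χ₁² = 1 enters.

For fixed h' the values j = 1, 2, 3 occur p + 1, p² - 1 and p⁴ + p³ times. Indeed the Hecke subgroup
is the stabilizer in Γ₀(N) of a set of p³(p - 1) primitive row vectors modulo p², and Γ₀(N) carries
every primitive vector into this set, so that the translates by the Hecke cosets partition the
primitive vectors (`sum_heckeCosets_baseVecs`). The exponent j is read off from a vector (x, y) of
the translate (`det_upper_cases`): it is 3 if x is nonzero modulo p, and otherwise 1 or 2 according
as x · y vanishes modulo p² or not. Counting vectors (`sum_primVecs`) gives the three numbers, all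
divisible by p + 1.

For convergence, the maximal minors of (C D) embed the cosets into the nonzero integral points m of
a quadric in five variables. The determinant of Cτ + D is a linear form in m without zeros on the
real quadric cone minus the origin, hence at least c‖m‖ in absolute value (`exists_le_norm_plForm`),
and the sum of ‖m‖⁻⁴ over the quadric converges by a divisor bound (`summable_quadric`). -/

theorem blkA_mul (γ δ : Sp R) : blkA (γ * δ) = blkA γ * blkA δ + blkB γ * blkC δ := by
  rw [blkA, coe_mul_eq, toBlocks_fromBlocks₁₁]

theorem blkB_mul (γ δ : Sp R) : blkB (γ * δ) = blkA γ * blkB δ + blkB γ * blkD δ := by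
  rw [blkB, coe_mul_eq, toBlocks_fromBlocks₁₂]

theorem blkA_inv (γ : Sp R) : blkA γ⁻¹ = (blkD γ)ᵀ := by simp [blkA, coe_inv_eq]

theorem blkB_inv (γ : Sp R) : blkB γ⁻¹ = -(blkB γ)ᵀ := by simp [blkB, coe_inv_eq]

theorem blkD_inv (γ : Sp R) : blkD γ⁻¹ = (blkA γ)ᵀ := by simp [blkD, coe_inv_eq]

theorem blkB_one : blkB (1 : Sp R) = 0 := by
  ext i j; simp [blkB, toBlocks₁₂]

theorem blkC_mul_transpose_blkD (γ : Sp R) : blkC γ * (blkD γ)ᵀ = blkD γ * (blkC γ)ᵀ := by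
  have h : blkC (γ * γ⁻¹) = 0 := by rw [mul_inv_cancel, blkC_one]
  rw [blkC_mul, blkA_inv, blkC_inv, mul_neg] at h
  exact add_neg_eq_zero.1 h

theorem blkA_mul_transpose_blkB (γ : Sp R) : blkA γ * (blkB γ)ᵀ = blkB γ * (blkA γ)ᵀ := by
  have h : blkB (γ * γ⁻¹) = 0 := by rw [mul_inv_cancel, blkB_one]
  rw [blkB_mul, blkB_inv, blkD_inv, mul_neg] at h
  exact (neg_add_eq_zero.1 h)

theorem blkD_mul_transpose_blkA_sub (γ : Sp R) :
    blkD γ * (blkA γ)ᵀ - blkC γ * (blkB γ)ᵀ = 1 := by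
  have h : blkD (γ * γ⁻¹) = 1 := by rw [mul_inv_cancel, blkD_one]
  rw [blkD_mul, blkB_inv, blkD_inv, mul_neg] at h
  rw [← h]; abel

theorem transpose_blkA_mul_blkC (γ : Sp R) : (blkA γ)ᵀ * blkC γ = (blkC γ)ᵀ * blkA γ :=
  (SymplecticGroup.fromBlocks_mem_iff.1 (coe_eq_fromBlocks γ ▸ γ.2)).1

/-- The symplectic matrix `(1 S; 0 1)`. -/
def upperUnip (S : Matrix (Fin 2) (Fin 2) R) (hS : S.IsSymm) : Sp R :=
  ⟨fromBlocks 1 S 0 1, SymplecticGroup.fromBlocks_mem_iff.2 (by simp [hS.eq])⟩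

/-- The symplectic matrix `(1 0; S 1)`. -/
def lowerUnip (S : Matrix (Fin 2) (Fin 2) R) (hS : S.IsSymm) : Sp R :=
  ⟨fromBlocks 1 0 S 1, SymplecticGroup.fromBlocks_mem_iff.2 (by simp [hS.eq])⟩

/-- The symplectic matrix `(U 0; 0 V)` where `Uᵀ V = 1`. -/
def levi (U V : Matrix (Fin 2) (Fin 2) R) (h : Uᵀ * V = 1) : Sp R :=
  ⟨fromBlocks U 0 0 V, SymplecticGroup.fromBlocks_mem_iff.2 (by simp [h])⟩

/-- The product of two matrices of determinant one, embedded in `Sp₂`. -/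
def diagSL (a b c d : Fin 2 → R) (h : ∀ i, a i * d i - b i * c i = 1) : Sp R :=
  ⟨fromBlocks (diagonal a) (diagonal b) (diagonal c) (diagonal d),
    SymplecticGroup.fromBlocks_mem_iff.2 (by
      refine ⟨by simp [mul_comm], by simp [mul_comm], ?_⟩
      simp only [diagonal_transpose, diagonal_mul_diagonal, diagonal_sub, ← diagonal_one]
      congr 1; ext i; rw [← h i]; ring)⟩

@[simp] theorem blkA_upperUnip (S : Matrix (Fin 2) (Fin 2) R) (hS : S.IsSymm) :
    blkA (upperUnip S hS) = 1 := toBlocks_fromBlocks₁₁ _ _ _ _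

@[simp] theorem blkB_upperUnip (S : Matrix (Fin 2) (Fin 2) R) (hS : S.IsSymm) :
    blkB (upperUnip S hS) = S := toBlocks_fromBlocks₁₂ _ _ _ _

@[simp] theorem blkC_upperUnip (S : Matrix (Fin 2) (Fin 2) R) (hS : S.IsSymm) :
    blkC (upperUnip S hS) = 0 := toBlocks_fromBlocks₂₁ _ _ _ _

@[simp] theorem blkD_upperUnip (S : Matrix (Fin 2) (Fin 2) R) (hS : S.IsSymm) :
    blkD (upperUnip S hS) = 1 := toBlocks_fromBlocks₂₂ _ _ _ _

@[simp] theorem blkC_lowerUnip (S : Matrix (Fin 2) (Fin 2) R) (hS : S.IsSymm) :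
    blkC (lowerUnip S hS) = S := toBlocks_fromBlocks₂₁ _ _ _ _

@[simp] theorem blkA_levi (U V : Matrix (Fin 2) (Fin 2) R) (h : Uᵀ * V = 1) :
    blkA (levi U V h) = U := toBlocks_fromBlocks₁₁ _ _ _ _

@[simp] theorem blkB_levi (U V : Matrix (Fin 2) (Fin 2) R) (h : Uᵀ * V = 1) :
    blkB (levi U V h) = 0 := toBlocks_fromBlocks₁₂ _ _ _ _

@[simp] theorem blkC_levi (U V : Matrix (Fin 2) (Fin 2) R) (h : Uᵀ * V = 1) :
    blkC (levi U V h) = 0 := toBlocks_fromBlocks₂₁ _ _ _ _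

@[simp] theorem blkD_levi (U V : Matrix (Fin 2) (Fin 2) R) (h : Uᵀ * V = 1) :
    blkD (levi U V h) = V := toBlocks_fromBlocks₂₂ _ _ _ _

@[simp] theorem blkA_diagSL (a b c d : Fin 2 → R) (h : ∀ i, a i * d i - b i * c i = 1) :
    blkA (diagSL a b c d h) = diagonal a := toBlocks_fromBlocks₁₁ _ _ _ _

@[simp] theorem blkB_diagSL (a b c d : Fin 2 → R) (h : ∀ i, a i * d i - b i * c i = 1) :
    blkB (diagSL a b c d h) = diagonal b := toBlocks_fromBlocks₁₂ _ _ _ _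

@[simp] theorem blkC_diagSL (a b c d : Fin 2 → R) (h : ∀ i, a i * d i - b i * c i = 1) :
    blkC (diagSL a b c d h) = diagonal c := toBlocks_fromBlocks₂₁ _ _ _ _

@[simp] theorem blkD_diagSL (a b c d : Fin 2 → R) (h : ∀ i, a i * d i - b i * c i = 1) :
    blkD (diagSL a b c d h) = diagonal d := toBlocks_fromBlocks₂₂ _ _ _ _

end Blocks

/-! ### Reduction of integral symplectic similitudes to block triangular form. -/

theorem exists_bezout_row (u v : ℤ) : ∃ a b c d : ℤ, a * d - b * c = 1 ∧ u * a + v * c = 0 := by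
  by_cases h : u = 0 ∧ v = 0
  · exact ⟨1, 0, 0, 1, by simp, by simp [h]⟩
  · have hg : (Int.gcd u v : ℤ) ≠ 0 := by
      simpa [Int.gcd_eq_zero_iff] using h
    obtain ⟨u', hu⟩ := Int.gcd_dvd_left u v
    obtain ⟨v', hv⟩ := Int.gcd_dvd_right u v
    have hb := Int.gcd_eq_gcd_ab u v
    refine ⟨v', Int.gcdA u v, -u', Int.gcdB u v, ?_, ?_⟩
    · apply mul_left_cancel₀ hg
      set g : ℤ := (Int.gcd u v : ℤ)
      linear_combination -Int.gcdA u v * hu - Int.gcdB u v * hv - hb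
    · set g : ℤ := (Int.gcd u v : ℤ)
      linear_combination v' * hu - u' * hv

theorem toBlocks₂₁_mul_coe {R : Type} [CommRing R] (X : Matrix (Fin 2 ⊕ Fin 2) (Fin 2 ⊕ Fin 2) R)
    (k : Sp R) : toBlocks₂₁ (X * k.1) = toBlocks₂₁ X * blkA k + toBlocks₂₂ X * blkC k := by
  conv_lhs => rw [← fromBlocks_toBlocks X, coe_eq_fromBlocks k, fromBlocks_multiply]
  simp

theorem toBlocks₂₂_mul_coe {R : Type} [CommRing R] (X : Matrix (Fin 2 ⊕ Fin 2) (Fin 2 ⊕ Fin 2) R)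
    (k : Sp R) : toBlocks₂₂ (X * k.1) = toBlocks₂₁ X * blkB k + toBlocks₂₂ X * blkD k := by
  conv_lhs => rw [← fromBlocks_toBlocks X, coe_eq_fromBlocks k, fromBlocks_multiply]
  simp

theorem mul_J_mul_transpose_coe {R : Type} [CommRing R]
    (X : Matrix (Fin 2 ⊕ Fin 2) (Fin 2 ⊕ Fin 2) R) (k : Sp R) :
    (X * k.1) * J (Fin 2) R * (X * k.1)ᵀ = X * J (Fin 2) R * Xᵀ := by
  have := SymplecticGroup.mem_iff.1 k.2
  rw [transpose_mul]
  calc _ = X * (k.1 * J (Fin 2) R * k.1ᵀ) * Xᵀ := by simp only [Matrix.mul_assoc]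
    _ = _ := by rw [this]

/-- The blocks of a symplectic similitude. -/
theorem similitude_blocks {R : Type} [CommRing R] {A B C D : Matrix (Fin 2) (Fin 2) R} {c : R}
    (h : fromBlocks A B C D * J (Fin 2) R * (fromBlocks A B C D)ᵀ = c • J (Fin 2) R) :
    A * Bᵀ = B * Aᵀ ∧ C * Dᵀ = D * Cᵀ ∧ A * Dᵀ - B * Cᵀ = c • 1 := by
  simp only [J, fromBlocks_transpose, fromBlocks_multiply, fromBlocks_smul, fromBlocks_inj] at h
  obtain ⟨h1, h2, h3, h4⟩ := h
  simp only [mul_zero, mul_one, zero_add, mul_neg, add_zero, neg_mul, smul_zero, smul_neg]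
    at h1 h2 h3 h4
  refine ⟨?_, ?_, ?_⟩
  · exact (sub_eq_zero.1 (by simpa [sub_eq_add_neg, add_comm] using h1)).symm
  · exact (sub_eq_zero.1 (by simpa [sub_eq_add_neg, add_comm] using h4)).symm
  · have := congrArg Neg.neg h2
    rw [neg_neg] at this
    rw [← this]; abel

/-- Two embedded copies of SL₂ act on the coordinate pairs (C₁ⱼ, D₁ⱼ) separately and clear the
C-half of the last row; a Levi element then mixes the two D-entries and clears the first. -/
theorem exists_coe_mul_row_eq_zero (X : Matrix (Fin 2 ⊕ Fin 2) (Fin 2 ⊕ Fin 2) ℤ) :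
    ∃ k : Sp ℤ, toBlocks₂₁ (X * k.1) 1 = 0 ∧ toBlocks₂₂ (X * k.1) 1 0 = 0 := by
  set C := toBlocks₂₁ X with hC
  set D := toBlocks₂₂ X with hD
  obtain ⟨a0, b0, c0, d0, h0, h0'⟩ := exists_bezout_row (C 1 0) (D 1 0)
  obtain ⟨a1, b1, c1, d1, h1, h1'⟩ := exists_bezout_row (C 1 1) (D 1 1)
  let k : Sp ℤ := diagSL ![a0, a1] ![b0, b1] ![c0, c1] ![d0, d1]
    (by intro i; fin_cases i <;> simpa)
  obtain ⟨a, b, c', d, h2, h2'⟩ := exists_bezout_row (C 1 0 * b0 + D 1 0 * d0)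
    (C 1 1 * b1 + D 1 1 * d1)
  let l : Sp ℤ := levi !![d, -c'; -b, a] !![a, b; c', d]
    (by ext i j; fin_cases i <;> fin_cases j <;> simp [Matrix.mul_apply] <;> linarith)
  refine ⟨k * l, ?_, ?_⟩
  · rw [toBlocks₂₁_mul_coe, ← hC, ← hD, blkA_mul, blkC_mul]
    funext j
    simp only [k, l, blkA_diagSL, blkB_diagSL, blkC_diagSL, blkD_diagSL, blkA_levi, blkC_levi,
      mul_zero, add_zero, ← Matrix.mul_assoc, ← Matrix.add_mul]
    rw [Matrix.mul_apply, Fin.sum_univ_two]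
    simp only [Matrix.add_apply, mul_diagonal]
    simp [h0', h1']
  · rw [toBlocks₂₂_mul_coe, ← hC, ← hD, blkB_mul, blkD_mul]
    simp only [k, l, blkA_diagSL, blkB_diagSL, blkC_diagSL, blkD_diagSL, blkB_levi, blkD_levi,
      mul_zero, zero_add, ← Matrix.mul_assoc, ← Matrix.add_mul]
    rw [Matrix.mul_apply, Fin.sum_univ_two]
    simp only [Matrix.add_apply, mul_diagonal]
    simpa using h2'

/-- Once the last row is (0, 0, 0, g), isotropy of the two lower rows gives C₀₁ g = 0, and g ≠ 0
because X is nonsingular. One more SL₂, in the first coordinate pair, removes C₀₀. -/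
theorem exists_coe_mul_lower_left_eq_zero (X : Matrix (Fin 2 ⊕ Fin 2) (Fin 2 ⊕ Fin 2) ℤ) {c : ℤ}
    (hc : c ≠ 0) (hX : X * J (Fin 2) ℤ * Xᵀ = c • J (Fin 2) ℤ) :
    ∃ k : Sp ℤ, toBlocks₂₁ (X * k.1) = 0 := by
  obtain ⟨k, e2, e2'⟩ := exists_coe_mul_row_eq_zero X
  have hJ := (mul_J_mul_transpose_coe X k).trans hX
  set Y := X * k.1 with hY
  set C := toBlocks₂₁ Y with hC
  set D := toBlocks₂₂ Y with hD
  have iso := (similitude_blocks ((fromBlocks_toBlocks Y).symm ▸ hJ)).2.1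
  rw [← hC, ← hD] at iso
  have h10 : C 1 0 = 0 := congrFun e2 0
  have h11 : C 1 1 = 0 := congrFun e2 1
  have hg : D 1 1 ≠ 0 := by
    intro h
    have h0 : ∀ j, Y (.inr 1) j = 0 := by
      rintro (j | j) <;> fin_cases j
      · exact h10
      · exact h11
      · exact e2'
      · exact h
    have h1 := congrArg det hJ
    rw [det_mul, det_mul, det_eq_zero_of_row_eq_zero (.inr 1) h0, det_smul] at h1
    have h2 := (isUnit_det_J (Fin 2) ℤ).ne_zero
    simp [hc, h2] at h1
  have e3 : C 0 1 = 0 := by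
    have := congrFun (congrFun iso 0) 1
    simp only [Matrix.mul_apply, Fin.sum_univ_two, transpose_apply, e2', h10, h11] at this
    simpa [hg] using this
  obtain ⟨a3, b3, c3, d3, h3, h3'⟩ := exists_bezout_row (C 0 0) (D 0 0)
  refine ⟨k * diagSL ![a3, 1] ![b3, 0] ![c3, 0] ![d3, 1]
    (by intro i; fin_cases i <;> simp [h3]), ?_⟩
  rw [Submonoid.coe_mul, ← Matrix.mul_assoc, ← hY, toBlocks₂₁_mul_coe, ← hC, ← hD]
  ext i j
  rw [Matrix.add_apply, blkA_diagSL, blkC_diagSL, mul_diagonal, mul_diagonal]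
  fin_cases i <;> fin_cases j <;> simp [h10, h11, e2', e3, h3']

theorem exists_coe_mul_upper (X : Matrix (Fin 2 ⊕ Fin 2) (Fin 2 ⊕ Fin 2) ℤ) {c : ℤ} (hc : c ≠ 0)
    (hX : X * J (Fin 2) ℤ * Xᵀ = c • J (Fin 2) ℤ) :
    ∃ k : Sp ℤ, toBlocks₂₁ (X * k.1) = 0 ∧ 0 < (toBlocks₂₂ (X * k.1)).det := by
  obtain ⟨k, e4⟩ := exists_coe_mul_lower_left_eq_zero X hc hX
  have hJ := (mul_J_mul_transpose_coe X k).trans hX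
  have e5 : (toBlocks₂₂ (X * k.1)).det ≠ 0 := by
    have := (similitude_blocks ((fromBlocks_toBlocks (X * k.1)).symm ▸ hJ)).2.2
    rw [e4] at this
    have := congrArg det this
    rw [transpose_zero, mul_zero, sub_zero, det_mul, det_transpose, det_smul, det_one] at this
    intro h
    rw [h] at this
    exact pow_ne_zero 2 hc (by simpa using this.symm)
  rcases lt_or_gt_of_ne e5 with h | h
  -- A sign change in one coordinate reverses the sign of the lower right determinant.
  · refine ⟨k * levi (diagonal ![-1, 1]) (diagonal ![-1, 1])
      (by ext i j; fin_cases i <;> fin_cases j <;> simp), ?_, ?_⟩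
    · rw [Submonoid.coe_mul, ← Matrix.mul_assoc, toBlocks₂₁_mul_coe, e4]
      simp
    · rw [Submonoid.coe_mul, ← Matrix.mul_assoc, toBlocks₂₂_mul_coe, e4]
      simpa using h
  · exact ⟨k, e4, h⟩

/-- Every integral symplectic similitude is the product of an upper triangular one and an element
of `Sp₂(ℤ)`. -/
theorem exists_eq_upper_mul (X : Matrix (Fin 2 ⊕ Fin 2) (Fin 2 ⊕ Fin 2) ℤ) {c : ℤ} (hc : c ≠ 0)
    (hX : X * J (Fin 2) ℤ * Xᵀ = c • J (Fin 2) ℤ) :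
    ∃ (y : Sp ℤ) (A B U : Matrix (Fin 2) (Fin 2) ℤ), X = fromBlocks A B 0 U * y.1 ∧ 0 < U.det := by
  obtain ⟨k, h1, h2⟩ := exists_coe_mul_upper X hc hX
  refine ⟨k⁻¹, toBlocks₁₁ (X * k.1), toBlocks₁₂ (X * k.1), toBlocks₂₂ (X * k.1), ?_, h2⟩
  rw [← h1, fromBlocks_toBlocks, Matrix.mul_assoc, ← Submonoid.coe_mul, mul_inv_cancel]
  simp

theorem det_blkD_eq_one_or_of_blkC_eq_zero {g : Sp ℤ} (hC : blkC g = 0) :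
    (blkD g).det = 1 ∨ (blkD g).det = -1 := by
  have h := blkD_mul_transpose_blkA_sub g
  rw [hC, zero_mul, sub_zero] at h
  have h1 := congrArg det h
  rw [det_mul, det_one] at h1
  exact Int.isUnit_iff.1 (IsUnit.of_mul_eq_one _ h1)

theorem eq_zero_of_mul_eq_zero_of_det_ne_zero {U C : Matrix (Fin 2) (Fin 2) ℤ} (hU : U.det ≠ 0)
    (h : U * C = 0) : C = 0 := by
  have h1 : U.adjugate * (U * C) = 0 := by rw [h, mul_zero]
  rw [← Matrix.mul_assoc, adjugate_mul, smul_mul, Matrix.one_mul] at h1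
  exact (smul_eq_zero.1 h1).resolve_left hU

/-- The coset in the factorization `X = (A B; 0 U) y` is unique. -/
theorem mul_inv_mem_GammaInfPlus_of_upper {A B U A' B' U' : Matrix (Fin 2) (Fin 2) ℤ}
    {y y' : Sp ℤ} (h : fromBlocks A B 0 U * y.1 = fromBlocks A' B' 0 U' * y'.1)
    (hU : 0 < U.det) (hU' : 0 < U'.det) : y' * y⁻¹ ∈ GammaInfPlus := by
  have h1 : fromBlocks A B 0 U = fromBlocks A' B' 0 U' * (y' * y⁻¹).1 := by
    rw [Submonoid.coe_mul, ← Matrix.mul_assoc, ← h, Matrix.mul_assoc, ← Submonoid.coe_mul,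
      mul_inv_cancel]
    simp
  have h2 := congrArg toBlocks₂₁ h1
  have h3 := congrArg toBlocks₂₂ h1
  rw [toBlocks₂₁_mul_coe] at h2
  rw [toBlocks₂₂_mul_coe] at h3
  simp only [toBlocks_fromBlocks₂₁, toBlocks_fromBlocks₂₂, zero_mul, zero_add] at h2 h3
  have h4 := eq_zero_of_mul_eq_zero_of_det_ne_zero hU'.ne' h2.symm
  refine ⟨h4, (det_blkD_eq_one_or_of_blkC_eq_zero h4).resolve_right fun h5 => ?_⟩
  have h6 := congrArg det h3
  rw [det_mul, h5] at h6
  linarith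

/-! ### The orbit of the cusp, described by congruences modulo N. -/

theorem int_dvd_of_squarefree {n : ℕ} (hn : Squarefree n) {m : ℤ}
    (h : ∀ q : ℕ, q.Prime → q ∣ n → (q : ℤ) ∣ m) : (n : ℤ) ∣ m := by
  rw [← Nat.prod_primeFactors_of_squarefree hn, Int.natCast_dvd]
  refine Finset.prod_primes_dvd _ (fun a ha => (Nat.prime_of_mem_primeFactors ha).prime) ?_
  intro a ha
  exact Int.natCast_dvd.1 (h a (Nat.prime_of_mem_primeFactors ha) (Nat.dvd_of_mem_primeFactors ha))

theorem IsCuspDiag.cast_eq {N₀ N₁ N₂ : ℕ} {d : Fin 2 → ℤ} (hd : IsCuspDiag N₀ N₁ N₂ d)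
    (hN : Squarefree (N₀ * N₁ * N₂)) :
    ((d 0 : ZMod N₀) = 0 ∧ (d 1 : ZMod N₀) = 0) ∧ ((d 0 : ZMod N₁) = 1 ∧ (d 1 : ZMod N₁) = 0) ∧
      ((d 0 : ZMod N₂) = 1 ∧ (d 1 : ZMod N₂) = 1) := by
  have key {n : ℕ} (hn : Squarefree n) {a b : ℤ}
      (h : ∀ q : ℕ, q.Prime → q ∣ n → a ≡ b [ZMOD q]) : (a : ZMod n) = b := by
    rw [ZMod.intCast_eq_intCast_iff_dvd_sub]
    exact int_dvd_of_squarefree hn fun q hq hqn => (h q hq hqn).dvd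
  have h0 : Squarefree N₀ := hN.of_mul_left.of_mul_left
  have h1 : Squarefree N₁ := hN.of_mul_left.of_mul_right
  have h2 : Squarefree N₂ := hN.of_mul_right
  refine ⟨⟨?_, ?_⟩, ⟨?_, ?_⟩, ?_, ?_⟩
  · simpa using key h0 fun q hq hqn => (hd.1 q hq hqn).1
  · simpa using key h0 fun q hq hqn => (hd.1 q hq hqn).2
  · simpa using key h1 fun q hq hqn => (hd.2.1 q hq hqn).1
  · simpa using key h1 fun q hq hqn => (hd.2.1 q hq hqn).2
  · simpa using key h2 fun q hq hqn => (hd.2.2 q hq hqn).1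
  · simpa using key h2 fun q hq hqn => (hd.2.2 q hq hqn).2

/-- The second row of `V` is a multiple of a row of a matrix of determinant one. -/
theorem exists_det_one_row (V : Matrix (Fin 2) (Fin 2) ℤ) : ∃ (U : Matrix (Fin 2) (Fin 2) ℤ)
    (g : ℤ), U.det = 1 ∧ g ∣ V.det ∧ ∀ j, V 1 j = g * U 1 j := by
  obtain ⟨a, b, c, d, h1, h2⟩ := exists_bezout_row (V 1 0) (V 1 1)
  refine ⟨!![d, -b; -c, a], V 1 0 * b + V 1 1 * d, ?_, ?_, ?_⟩
  · rw [det_fin_two_of]; linarith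
  · refine ⟨V 0 0 * a + V 0 1 * c, ?_⟩
    rw [det_fin_two]
    linear_combination -(V 0 0 * V 1 1 - V 0 1 * V 1 0) * h1 - (V 0 0 * b + V 0 1 * d) * h2
  · intro j
    fin_cases j
    · simp; linear_combination -V 1 0 * h1 + d * h2
    · simp; linear_combination -V 1 1 * h1 - b * h2

theorem exists_crt {m n : ℕ} (h : m.Coprime n) (x : ZMod m) (y : ZMod n) :
    ∃ s : ℤ, (s : ZMod m) = x ∧ (s : ZMod n) = y := by
  obtain ⟨u, v, huv⟩ := Nat.isCoprime_iff_coprime.2 h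
  obtain ⟨x, rfl⟩ := ZMod.intCast_surjective x
  obtain ⟨y, rfl⟩ := ZMod.intCast_surjective y
  refine ⟨x * (v * n) + y * (u * m), ?_, ?_⟩
  · have : (v * n : ZMod m) = 1 := by
      have := congrArg (Int.cast : ℤ → ZMod m) huv
      simpa using this
    push_cast
    rw [this]; simp
  · have : (u * m : ZMod n) = 1 := by
      have := congrArg (Int.cast : ℤ → ZMod n) huv
      simpa using this
    push_cast
    rw [this]; simp

theorem isUnit_cast_of_isCoprime {n N : ℕ} (hn : n ∣ N) {a : ℤ} (h : IsCoprime a (N : ℤ)) :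
    IsUnit (a : ZMod n) := by
  obtain ⟨u, v, huv⟩ := h.of_isCoprime_of_dvd_right (Int.natCast_dvd_natCast.2 hn)
  refine IsUnit.of_mul_eq_one (u : ZMod n) ?_
  have := congrArg (Int.cast : ℤ → ZMod n) huv
  push_cast at this
  rw [ZMod.natCast_self] at this
  linear_combination this

theorem natCast_dvd_of_cast_eq_zero {N₀ N₁ N₂ : ℕ} (hN : Squarefree (N₀ * N₁ * N₂)) {a : ℤ}
    (h0 : (a : ZMod N₀) = 0) (h1 : (a : ZMod N₁) = 0) (h2 : (a : ZMod N₂) = 0) :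
    ((N₀ * N₁ * N₂ : ℕ) : ℤ) ∣ a := by
  rw [ZMod.intCast_zmod_eq_zero_iff_dvd] at h0 h1 h2
  have c1 := Nat.isCoprime_iff_coprime.2 (Nat.coprime_of_squarefree_mul hN)
  have c2 := Nat.isCoprime_iff_coprime.2 (Nat.coprime_of_squarefree_mul hN.of_mul_left)
  push_cast at c1 ⊢
  exact c1.mul_dvd (c2.mul_dvd h0 h1) h2

/-- The conclusion says that γ_ρ⁻¹ (I S; 0 I) y lies in Γ₀(N) when y has left blocks A, C. Modulo N₀
both sides vanish. Modulo N₂ the matrix C is invertible and S = I - A C⁻¹ works; it is symmetric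
because AᵀC is. Modulo N₁ only the first row c of C survives; symmetry of AᵀC makes the first row of
A proportional to c, so a choice of S₀₀ suffices. -/
theorem exists_isSymm_congr {N₀ N₁ N₂ : ℕ} {d : Fin 2 → ℤ} (hd : IsCuspDiag N₀ N₁ N₂ d)
    (hN : Squarefree (N₀ * N₁ * N₂)) (A C V E : Matrix (Fin 2) (Fin 2) ℤ)
    (hAC : Aᵀ * C = Cᵀ * A) (hV : IsCoprime V.det ((N₀ * N₁ * N₂ : ℕ) : ℤ))
    (hE : IsCoprime E.det ((N₀ * N₁ * N₂ : ℕ) : ℤ)) (hC1 : ∀ j, (C 1 j : ZMod N₁) = 0)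
    (h : ∀ i j, ((N₀ * N₁ * N₂ : ℕ) : ℤ) ∣ (V * C - diagonal d * E) i j) :
    ∃ S : Matrix (Fin 2) (Fin 2) ℤ, S.IsSymm ∧
      ∀ i j, ((N₀ * N₁ * N₂ : ℕ) : ℤ) ∣ (C - diagonal d * (A + S * C)) i j := by
  obtain ⟨⟨hd00, hd01⟩, ⟨hd10, hd11⟩, hd20, hd21⟩ := hd.cast_eq hN
  have n0 : N₀ ∣ N₀ * N₁ * N₂ := Dvd.intro _ (mul_assoc _ _ _).symm
  have n1 : N₁ ∣ N₀ * N₁ * N₂ := Dvd.intro_left (N₀ * N₂) (by ring)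
  have n2 : N₂ ∣ N₀ * N₁ * N₂ := Dvd.intro_left _ rfl
  have hc {n : ℕ} (hn : n ∣ N₀ * N₁ * N₂) (i j : Fin 2) :
      (V i 0 * C 0 j + V i 1 * C 1 j : ZMod n) = d i * E i j := by
    have h1 := (ZMod.intCast_zmod_eq_zero_iff_dvd _ n).2
      ((Int.natCast_dvd_natCast.2 hn).trans (h i j))
    rw [Matrix.sub_apply, diagonal_mul, Matrix.mul_apply, Fin.sum_univ_two] at h1
    push_cast at h1
    exact sub_eq_zero.1 h1
  have hsym : A 0 0 * C 0 1 + A 1 0 * C 1 1 = C 0 0 * A 0 1 + C 1 0 * A 1 1 := by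
    have := congrFun (congrFun hAC 0) 1
    simpa only [Matrix.mul_apply, Fin.sum_univ_two, transpose_apply] using this
  have hsymc (n : ℕ) : (A 0 0 * C 0 1 + A 1 0 * C 1 1 : ZMod n) =
      C 0 0 * A 0 1 + C 1 0 * A 1 1 := by exact_mod_cast congrArg (Int.cast : ℤ → ZMod n) hsym
  -- modulo `N₀` the block `C` vanishes
  have hC0 : ∀ i j, (C i j : ZMod N₀) = 0 := by
    have hu := isUnit_cast_of_isCoprime n0 hV
    rw [det_fin_two] at hu
    push_cast at hu
    intro i j
    have e0 := hc n0 0 j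
    have e1 := hc n0 1 j
    rw [hd00] at e0
    rw [hd01] at e1
    fin_cases i
    · refine (hu.mul_right_eq_zero).1 ?_
      simp only [Fin.zero_eta]
      linear_combination (V 1 1 : ZMod N₀) * e0 - (V 0 1 : ZMod N₀) * e1
    · refine (hu.mul_right_eq_zero).1 ?_
      simp only [Fin.mk_one]
      linear_combination (V 0 0 : ZMod N₀) * e1 - (V 1 0 : ZMod N₀) * e0
  -- modulo `N₁` the first row of `C` is unimodular
  obtain ⟨e1, e2, he⟩ : ∃ e1 e2 : ZMod N₁, (C 0 0 : ZMod N₁) * e1 + C 0 1 * e2 = 1 := by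
    have hu := isUnit_cast_of_isCoprime n1 hE
    rw [det_fin_two] at hu
    push_cast at hu
    obtain ⟨w, hw⟩ := hu.exists_right_inv
    have f0 := hc n1 0 0
    have f1 := hc n1 0 1
    rw [hC1, hd10] at f0 f1
    refine ⟨V 0 0 * E 1 1 * w, -(V 0 0 * E 1 0 * w), ?_⟩
    linear_combination hw + (E 1 1 * w : ZMod N₁) * f0 - (E 1 0 * w : ZMod N₁) * f1
  -- modulo `N₂` the block `C` is invertible
  obtain ⟨w, hw⟩ : ∃ w : ZMod N₂, ((C 0 0 * C 1 1 - C 0 1 * C 1 0 : ℤ) : ZMod N₂) * w = 1 := by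
    have hu := isUnit_cast_of_isCoprime n2 hE
    rw [det_fin_two] at hu
    push_cast at hu
    have f00 := hc n2 0 0
    have f01 := hc n2 0 1
    have f10 := hc n2 1 0
    have f11 := hc n2 1 1
    rw [hd20, one_mul] at f00 f01
    rw [hd21, one_mul] at f10 f11
    rw [← f00, ← f01, ← f10, ← f11] at hu
    refine IsUnit.exists_right_inv (isUnit_of_mul_isUnit_right
      (x := (V 0 0 * V 1 1 - V 0 1 * V 1 0 : ZMod N₂)) ?_)
    convert hu using 1
    push_cast; ring
  push_cast at hw
  have cop : N₁.Coprime N₂ := Nat.coprime_of_squarefree_mul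
    ((mul_assoc N₀ N₁ N₂) ▸ hN).of_mul_right
  -- Only S₀₀ is constrained modulo both N₁ and N₂; the other entries matter modulo N₂ alone. Here w
  -- inverts det C modulo N₂, and (e1, e2) pairs to 1 with c modulo N₁.
  obtain ⟨s00, h001, h002⟩ := exists_crt cop (1 - (A 0 0 * e1 + A 0 1 * e2))
    (1 - w * (A 0 0 * C 1 1 - A 0 1 * C 1 0) : ZMod N₂)
  obtain ⟨s01, h012⟩ := ZMod.intCast_surjective
    (-(w * (A 0 1 * C 0 0 - A 0 0 * C 0 1)) : ZMod N₂)
  obtain ⟨s11, h112⟩ := ZMod.intCast_surjective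
    (1 - w * (A 1 1 * C 0 0 - A 1 0 * C 0 1) : ZMod N₂)
  refine ⟨!![s00, s01; s01, s11], by ext i j; fin_cases i <;> fin_cases j <;> rfl, ?_⟩
  intro i j
  have hs0 := hsymc N₁
  have hs2 := hsymc N₂
  rw [hC1, hC1] at hs0
  apply natCast_dvd_of_cast_eq_zero hN
  · rw [Matrix.sub_apply, diagonal_mul]
    push_cast
    rw [hC0]
    fin_cases i
    · simp [hd00]
    · simp [hd01]
  · rw [Matrix.sub_apply, diagonal_mul, Matrix.add_apply, Matrix.mul_apply, Fin.sum_univ_two]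
    push_cast
    rw [hC1]
    fin_cases i
    · simp only [Fin.zero_eta, of_apply, cons_val_zero, cons_val_one, cons_val', hd10, h001]
      fin_cases j
      · simp only [Fin.zero_eta]
        linear_combination (A 0 0 : ZMod N₁) * he - e2 * hs0
      · simp only [Fin.mk_one]
        linear_combination (A 0 1 : ZMod N₁) * he + e1 * hs0
    · simp [hd11, hC1]
  · rw [Matrix.sub_apply, diagonal_mul, Matrix.add_apply, Matrix.mul_apply, Fin.sum_univ_two]
    push_cast
    fin_cases i <;> fin_cases j <;>
      simp only [Fin.zero_eta, Fin.mk_one, of_apply, cons_val_zero, cons_val_one, cons_val',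
        hd20, hd21, h002, h012, h112, cons_val_fin_one]
    · linear_combination (A 0 0 : ZMod N₂) * hw
    · linear_combination (A 0 1 : ZMod N₂) * hw
    · linear_combination (A 1 0 : ZMod N₂) * hw - w * C 0 0 * hs2
    · linear_combination (A 1 1 : ZMod N₂) * hw - w * C 0 1 * hs2

theorem blkC_cuspRep_inv_mul (d : Fin 2 → ℤ) (y : Sp ℤ) :
    blkC ((cuspRep d)⁻¹ * y) = blkC y - diagonal d * blkA y := by
  rw [blkC_mul, blkC_inv, blkD_inv]
  simp only [cuspRep, blkC, blkA, toBlocks_fromBlocks₂₁, toBlocks_fromBlocks₁₁, transpose_one,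
    Matrix.one_mul, diagonal_transpose, Matrix.neg_mul, sub_eq_neg_add]

/-- A criterion for an element of `Sp₂(ℤ)` to lie in the `Γ₀(N)`-orbit of the cusp. -/
theorem exists_eq_mul_cuspRep_mul {N₀ N₁ N₂ : ℕ} {d : Fin 2 → ℤ} (hd : IsCuspDiag N₀ N₁ N₂ d)
    (hN : Squarefree (N₀ * N₁ * N₂)) (y : Sp ℤ) (V E : Matrix (Fin 2) (Fin 2) ℤ)
    (hV : IsCoprime V.det ((N₀ * N₁ * N₂ : ℕ) : ℤ))
    (hE : IsCoprime E.det ((N₀ * N₁ * N₂ : ℕ) : ℤ))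
    (h : ∀ i j, ((N₀ * N₁ * N₂ : ℕ) : ℤ) ∣ (V * blkC y - diagonal d * E) i j) :
    ∃ g ∈ GammaInfPlus, ∃ γ ∈ Gamma0 (N₀ * N₁ * N₂), y = g * (cuspRep d * γ) := by
  -- Modulo N₁ the second row of V C vanishes. Completing the primitive part of the second row of V
  -- to a determinant-one matrix U makes the second row of U C vanish there, since the content g is
  -- a unit.
  obtain ⟨U, g, hU, hg, hUV⟩ := exists_det_one_row V
  have hUU : (U.adjugateᵀ)ᵀ * U = 1 := by
    rw [transpose_transpose, adjugate_mul, hU, one_smul]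
  set y1 := levi _ U hUU * y with hy1
  have hC : blkC y1 = U * blkC y := by rw [hy1, blkC_mul]; simp
  have hVU : V * U.adjugate * blkC y1 = V * blkC y := by
    rw [hC, ← Matrix.mul_assoc, Matrix.mul_assoc V, adjugate_mul, hU, one_smul, Matrix.mul_one]
  obtain ⟨S, hS, hS'⟩ := exists_isSymm_congr hd hN (blkA y1) (blkC y1) (V * U.adjugate) E
    (transpose_blkA_mul_blkC y1) (by rwa [det_mul, det_adjugate, hU, one_pow, mul_one]) hE
    (by
      intro j
      have hn : N₁ ∣ N₀ * N₁ * N₂ := Dvd.intro_left (N₀ * N₂) (by ring)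
      have h1 := (ZMod.intCast_zmod_eq_zero_iff_dvd _ N₁).2
        ((Int.natCast_dvd_natCast.2 hn).trans (h 1 j))
      refine (isUnit_cast_of_isCoprime hn (hV.of_isCoprime_of_dvd_left hg)).mul_right_eq_zero.1 ?_
      rw [Matrix.sub_apply, diagonal_mul, Matrix.mul_apply, Fin.sum_univ_two, hUV, hUV] at h1
      push_cast at h1
      rw [(hd.cast_eq hN).2.1.2, zero_mul, sub_zero] at h1
      rw [hC, Matrix.mul_apply, Fin.sum_univ_two]
      push_cast
      rw [← h1]; ring)
    (by rwa [hVU])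
  refine ⟨(upperUnip S hS * levi _ U hUU)⁻¹, inv_mem ⟨?_, ?_⟩,
    (cuspRep d)⁻¹ * (upperUnip S hS * y1), ?_, ?_⟩
  · rw [blkC_mul]; simp
  · rw [blkD_mul]; simp [hU]
  · intro i j
    rw [blkC_cuspRep_inv_mul, blkC_mul _ y1, blkA_mul _ y1]
    simpa using hS' i j
  · rw [hy1]; group

/-! ### Similitudes prime to the level and the orbit of the cusp. -/

section Similitude

variable {R : Type} [CommRing R]

theorem diagBlocks_similitude {a b : Matrix (Fin 2) (Fin 2) R} {c : R} (hab : a * bᵀ = c • 1) :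
    fromBlocks a 0 0 b * J (Fin 2) R * (fromBlocks a 0 0 b)ᵀ = c • J (Fin 2) R := by
  have hba : b * aᵀ = c • 1 := by
    have := congrArg transpose hab
    simpa using this
  simp [J, fromBlocks_transpose, fromBlocks_multiply, fromBlocks_smul, hab, hba]

theorem mul_similitude_mul {x γ : Sp R} {X : Matrix (Fin 2 ⊕ Fin 2) (Fin 2 ⊕ Fin 2) R} {c : R}
    (hX : X * J (Fin 2) R * Xᵀ = c • J (Fin 2) R) :
    (x.1 * X * γ.1) * J (Fin 2) R * (x.1 * X * γ.1)ᵀ = c • J (Fin 2) R := by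
  rw [mul_J_mul_transpose_coe, transpose_mul]
  calc _ = x.1 * (X * J (Fin 2) R * Xᵀ) * x.1ᵀ := by simp only [Matrix.mul_assoc]
    _ = _ := by
      rw [hX, Matrix.mul_smul, Matrix.smul_mul, SymplecticGroup.mem_iff.1 x.2]

end Similitude

theorem upper_similitude {a b A B U : Matrix (Fin 2) (Fin 2) ℤ} {c : ℤ} {x γ y : Sp ℤ}
    (hab : a * bᵀ = c • 1)
    (h : x.1 * fromBlocks a 0 0 b * γ.1 = fromBlocks A B 0 U * y.1) :
    A * Uᵀ = c • 1 ∧ A * Bᵀ = B * Aᵀ := by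
  have h1 := mul_similitude_mul (x := x) (γ := γ) (diagBlocks_similitude hab)
  rw [h, mul_J_mul_transpose_coe] at h1
  have h2 := similitude_blocks h1
  exact ⟨by simpa using h2.2.2, h2.1⟩

theorem det_blkA_mul_det_blkD_cast {N : ℕ} {h : Sp ℤ} (hh : h ∈ Gamma0 N) :
    ((blkD h).det : ZMod N) * ((blkA h).det : ZMod N) = 1 := by
  have h1 := blkD_mul_transpose_blkA_sub h
  have h2 := congrArg
    (fun X : Matrix (Fin 2) (Fin 2) ℤ => (X.map (Int.castRingHom (ZMod N))).det) h1
  have h3 : (blkC h).map (Int.castRingHom (ZMod N)) = 0 := by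
    ext i j
    exact (ZMod.intCast_zmod_eq_zero_iff_dvd _ _).2 (hh i j)
  rw [Matrix.map_sub _ (map_sub _), Matrix.map_mul, Matrix.map_mul, h3, zero_mul, sub_zero,
    det_mul, ← RingHom.mapMatrix_apply, ← RingHom.map_det, ← RingHom.mapMatrix_apply,
    ← RingHom.map_det, det_transpose, ← RingHom.mapMatrix_apply, map_one,
    det_one] at h2
  exact h2

theorem isCoprime_of_cast_mul_eq_one {N : ℕ} {a : ℤ} {b : ZMod N} (h : (a : ZMod N) * b = 1) :
    IsCoprime a (N : ℤ) :=
  (ZMod.coe_int_isUnit_iff_isCoprime a N).1 (IsUnit.of_mul_eq_one _ h) |>.symm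

theorem isCoprime_det_blkA {N : ℕ} {h : Sp ℤ} (hh : h ∈ Gamma0 N) :
    IsCoprime (blkA h).det (N : ℤ) :=
  isCoprime_of_cast_mul_eq_one ((mul_comm _ _).trans (det_blkA_mul_det_blkD_cast hh))

theorem isCoprime_det_blkD {N : ℕ} {h : Sp ℤ} (hh : h ∈ Gamma0 N) :
    IsCoprime (blkD h).det (N : ℤ) :=
  isCoprime_of_cast_mul_eq_one (det_blkA_mul_det_blkD_cast hh)

theorem dvd_mul_apply_left {n : ℤ} {X Y : Matrix (Fin 2) (Fin 2) ℤ} (h : ∀ i j, n ∣ X i j)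
    (i j : Fin 2) : n ∣ (X * Y) i j := by
  rw [Matrix.mul_apply]
  exact Finset.dvd_sum fun l _ => (h i l).mul_right _

theorem dvd_mul_apply_right {n : ℤ} {X Y : Matrix (Fin 2) (Fin 2) ℤ} (h : ∀ i j, n ∣ Y i j)
    (i j : Fin 2) : n ∣ (X * Y) i j := by
  rw [Matrix.mul_apply]
  exact Finset.dvd_sum fun l _ => (h l j).mul_left _

theorem blkC_cuspRep_mul (d : Fin 2 → ℤ) (h : Sp ℤ) :
    blkC (cuspRep d * h) = diagonal d * blkA h + blkC h := by
  rw [blkC_mul]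
  simp only [cuspRep, blkC, blkD, toBlocks_fromBlocks₂₁, toBlocks_fromBlocks₂₂, Matrix.one_mul]

theorem toBlocks₂₁_mul_diagBlocks_mul (x γ : Sp ℤ) (a b : Matrix (Fin 2) (Fin 2) ℤ) :
    toBlocks₂₁ (x.1 * fromBlocks a 0 0 b * γ.1) =
      blkC x * a * blkA γ + blkD x * b * blkC γ := by
  rw [toBlocks₂₁_mul_coe, coe_eq_fromBlocks x, fromBlocks_multiply]
  simp

theorem toBlocks₂₂_mul_diagBlocks_mul (x γ : Sp ℤ) (a b : Matrix (Fin 2) (Fin 2) ℤ) :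
    toBlocks₂₂ (x.1 * fromBlocks a 0 0 b * γ.1) =
      blkC x * a * blkB γ + blkD x * b * blkD γ := by
  rw [toBlocks₂₂_mul_coe, coe_eq_fromBlocks x, fromBlocks_multiply]
  simp

theorem det_ne_zero_of_mul_transpose_eq {a b : Matrix (Fin 2) (Fin 2) ℤ} {c : ℤ}
    (hab : a * bᵀ = c • 1) : a.det * b.det = c ^ 2 := by
  have := congrArg det hab
  rw [det_mul, det_transpose, det_smul, det_one] at this
  simpa using this

/-- Multiplication by a similitude of level prime to `N` preserves the orbit of the cusp, up to
an upper triangular factor. -/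
theorem exists_upper_mul_orbit {N₀ N₁ N₂ : ℕ} {d : Fin 2 → ℤ} (hd : IsCuspDiag N₀ N₁ N₂ d)
    (hN : Squarefree (N₀ * N₁ * N₂)) {a b : Matrix (Fin 2) (Fin 2) ℤ} {c : ℤ} (hc : c ≠ 0)
    (hcN : IsCoprime c ((N₀ * N₁ * N₂ : ℕ) : ℤ)) (hab : a * bᵀ = c • 1) {h γ : Sp ℤ}
    (hh : h ∈ Gamma0 (N₀ * N₁ * N₂)) (hγ : γ ∈ Gamma0 (N₀ * N₁ * N₂)) :
    ∃ h' ∈ Gamma0 (N₀ * N₁ * N₂), ∃ A B U : Matrix (Fin 2) (Fin 2) ℤ,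
      (cuspRep d * h).1 * fromBlocks a 0 0 b * γ.1 = fromBlocks A B 0 U * (cuspRep d * h').1 ∧
        0 < U.det := by
  obtain ⟨y, A, B, U, hX, hU⟩ := exists_eq_upper_mul _ hc
    (mul_similitude_mul (x := cuspRep d * h) (γ := γ) (diagBlocks_similitude hab))
  have hAU := det_ne_zero_of_mul_transpose_eq (upper_similitude hab hX).1
  have hab' := det_ne_zero_of_mul_transpose_eq hab
  have hUN : IsCoprime U.det ((N₀ * N₁ * N₂ : ℕ) : ℤ) :=
    (hcN.pow_left (m := 2)).of_isCoprime_of_dvd_left ⟨A.det, by rw [← hAU, mul_comm]⟩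
  have haN : IsCoprime a.det ((N₀ * N₁ * N₂ : ℕ) : ℤ) :=
    (hcN.pow_left (m := 2)).of_isCoprime_of_dvd_left ⟨b.det, hab'.symm⟩
  -- Since C_h and C_γ vanish modulo N, the lower left block of the relation reads U C_y ≡ M · A_h a
  -- A_γ, which is the orbit criterion with V = U. All determinants are prime to N because c is.
  obtain ⟨g, hg, h', hh', rfl⟩ := exists_eq_mul_cuspRep_mul hd hN y U (blkA h * a * blkA γ) hUN
    (by
      rw [det_mul, det_mul]
      exact ((isCoprime_det_blkA hh).mul_left haN).mul_left (isCoprime_det_blkA hγ))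
    (by
      have h1 := congrArg toBlocks₂₁ hX
      rw [toBlocks₂₁_mul_diagBlocks_mul, toBlocks₂₁_mul_coe, toBlocks_fromBlocks₂₁,
        toBlocks_fromBlocks₂₂, zero_mul, zero_add, blkC_cuspRep_mul] at h1
      rw [← h1]
      have h2 : (diagonal d * blkA h + blkC h) * a * blkA γ +
          blkD (cuspRep d * h) * b * blkC γ - diagonal d * (blkA h * a * blkA γ) =
          blkC h * (a * blkA γ) + blkD (cuspRep d * h) * b * blkC γ := by
        simp only [Matrix.add_mul, Matrix.mul_assoc]; abel
      rw [h2]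
      intro i j
      exact dvd_add (dvd_mul_apply_left hh i j) (dvd_mul_apply_right hγ i j))
  refine ⟨h', hh', A * blkA g, A * blkB g + B * blkD g, U * blkD g, ?_, ?_⟩
  · rw [hX, Submonoid.coe_mul, ← Matrix.mul_assoc]
    congr 1
    rw [coe_eq_fromBlocks g, hg.1, fromBlocks_multiply]
    simp
  · rw [det_mul, hg.2, mul_one]; exact hU

/-- The inverse of an upper triangular relation. -/
theorem upper_inverse {a b A B U : Matrix (Fin 2) (Fin 2) ℤ} {c : ℤ} (hc : c ≠ 0)
    (hab : a * bᵀ = c • 1) {x γ y : Sp ℤ}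
    (h : x.1 * fromBlocks a 0 0 b * γ.1 = fromBlocks A B 0 U * y.1) :
    y.1 * (γ⁻¹).1 * fromBlocks bᵀ 0 0 aᵀ = fromBlocks Uᵀ (-Bᵀ) 0 Aᵀ * x.1 := by
  obtain ⟨h1, h2⟩ := upper_similitude hab h
  have h3 : A.det ≠ 0 := left_ne_zero_of_mul
    (det_ne_zero_of_mul_transpose_eq h1 ▸ pow_ne_zero 2 hc)
  -- As A is nonsingular, the one-sided similitude relations for (A B; 0 U) can be turned around;
  -- this makes (Uᵀ -Bᵀ; 0 Aᵀ) its inverse up to the scalar c.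
  have h1' : Uᵀ * A = c • 1 := by
    have h4 : A * (Uᵀ * A - c • 1) = 0 := by
      rw [Matrix.mul_sub, ← Matrix.mul_assoc, h1]
      simp only [Matrix.mul_smul, Matrix.smul_mul, Matrix.mul_one, Matrix.one_mul, sub_self]
    exact sub_eq_zero.1 (eq_zero_of_mul_eq_zero_of_det_ne_zero h3 h4)
  have h1'' : Aᵀ * U = c • 1 := by
    have := congrArg transpose h1'
    simpa using this
  have h2' : Uᵀ * B = Bᵀ * U := by
    have h5 : A * (Uᵀ * B - Bᵀ * U) = 0 := by
      rw [Matrix.mul_sub, ← Matrix.mul_assoc, ← Matrix.mul_assoc, h1, h2, Matrix.mul_assoc, h1'']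
      simp only [Matrix.mul_smul, Matrix.smul_mul, Matrix.mul_one, Matrix.one_mul, sub_self]
    exact sub_eq_zero.1 (eq_zero_of_mul_eq_zero_of_det_ne_zero h3 h5)
  have hT : fromBlocks Uᵀ (-Bᵀ) 0 Aᵀ * fromBlocks A B 0 U =
      c • (1 : Matrix (Fin 2 ⊕ Fin 2) (Fin 2 ⊕ Fin 2) ℤ) := by
    rw [fromBlocks_multiply, ← fromBlocks_one, fromBlocks_smul]
    simp [h1', h1'', h2']
  have hba : b * aᵀ = c • 1 := by
    have := congrArg transpose hab
    simpa using this
  have hδ : fromBlocks a 0 0 b * fromBlocks bᵀ 0 0 aᵀ =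
      c • (1 : Matrix (Fin 2 ⊕ Fin 2) (Fin 2 ⊕ Fin 2) ℤ) := by
    rw [fromBlocks_multiply, ← fromBlocks_one, fromBlocks_smul]
    simp [hab, hba]
  have hγ : γ.1 * (γ⁻¹).1 = 1 := by rw [← Submonoid.coe_mul, mul_inv_cancel]; rfl
  have h6 : fromBlocks Uᵀ (-Bᵀ) 0 Aᵀ * (x.1 * fromBlocks a 0 0 b * γ.1) *
      (γ⁻¹).1 * fromBlocks bᵀ 0 0 aᵀ =
      fromBlocks Uᵀ (-Bᵀ) 0 Aᵀ * (fromBlocks A B 0 U * y.1) * (γ⁻¹).1 * fromBlocks bᵀ 0 0 aᵀ := by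
    rw [h]
  have h7 : fromBlocks Uᵀ (-Bᵀ) 0 Aᵀ * (x.1 * fromBlocks a 0 0 b * γ.1) *
      (γ⁻¹).1 * fromBlocks bᵀ 0 0 aᵀ = c • (fromBlocks Uᵀ (-Bᵀ) 0 Aᵀ * x.1) := by
    calc _ = fromBlocks Uᵀ (-Bᵀ) 0 Aᵀ * (x.1 * (fromBlocks a 0 0 b * (γ.1 * (γ⁻¹).1) *
          fromBlocks bᵀ 0 0 aᵀ)) := by simp only [Matrix.mul_assoc]
      _ = _ := by rw [hγ, Matrix.mul_one, hδ, Matrix.mul_smul, Matrix.mul_smul, Matrix.mul_one]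
  have h8 : fromBlocks Uᵀ (-Bᵀ) 0 Aᵀ * (fromBlocks A B 0 U * y.1) * (γ⁻¹).1 *
      fromBlocks bᵀ 0 0 aᵀ = c • (y.1 * (γ⁻¹).1 * fromBlocks bᵀ 0 0 aᵀ) := by
    calc _ = (fromBlocks Uᵀ (-Bᵀ) 0 Aᵀ * fromBlocks A B 0 U) * (y.1 * (γ⁻¹).1 *
          fromBlocks bᵀ 0 0 aᵀ) := by simp only [Matrix.mul_assoc]
      _ = _ := by rw [hT, Matrix.smul_mul, Matrix.one_mul]
  rw [h7, h8] at h6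
  exact (smul_right_injective _ hc h6).symm

/-! ### Determinants of D-blocks and the resulting character values. -/

theorem map_cast_eq_zero {n N : ℕ} (hn : n ∣ N) {C : Matrix (Fin 2) (Fin 2) ℤ}
    (h : ∀ i j, (N : ℤ) ∣ C i j) (i j : Fin 2) : (C i j : ZMod n) = 0 :=
  (ZMod.intCast_zmod_eq_zero_iff_dvd _ _).2 ((Int.natCast_dvd_natCast.2 hn).trans (h i j))

theorem cast_det (n : ℕ) (X : Matrix (Fin 2) (Fin 2) ℤ) :
    (X.det : ZMod n) = X 0 0 * X 1 1 - X 0 1 * X 1 0 := by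
  rw [det_fin_two]; push_cast; rfl

theorem cast_det_mul_add (n : ℕ) (X Y Z : Matrix (Fin 2) (Fin 2) ℤ)
    (hX : ∀ i j, (X i j : ZMod n) = 0) : ((X + Y * Z).det : ZMod n) = Y.det * Z.det := by
  have h : ((X + Y * Z).det : ZMod n) = ((Y * Z).det : ZMod n) := by
    rw [cast_det, cast_det]
    simp only [Matrix.add_apply, Int.cast_add, hX, zero_add]
  rw [h, det_mul]; push_cast; rfl

/-- The effect of an upper triangular relation on the determinants of the `D`-blocks. -/
theorem exists_det_congr {N₀ N₁ N₂ : ℕ} {d : Fin 2 → ℤ} (hd : IsCuspDiag N₀ N₁ N₂ d)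
    (hN : Squarefree (N₀ * N₁ * N₂)) {a b A B U : Matrix (Fin 2) (Fin 2) ℤ} {c : ℤ}
    (hcN : IsCoprime c ((N₀ * N₁ * N₂ : ℕ) : ℤ)) (hab : a * bᵀ = c • 1) {h γ h' : Sp ℤ}
    (hh : h ∈ Gamma0 (N₀ * N₁ * N₂)) (hγ : γ ∈ Gamma0 (N₀ * N₁ * N₂))
    (hh' : h' ∈ Gamma0 (N₀ * N₁ * N₂))
    (hrel : (cuspRep d * h).1 * fromBlocks a 0 0 b * γ.1 =
      fromBlocks A B 0 U * (cuspRep d * h').1) :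
    ∃ w : ℤ, (w : ZMod (N₀ * N₁ * N₂)) * (blkD h').det =
        b.det * (blkD h).det * (blkD γ).det ∧
      (w : ZMod N₀) = U.det ∧ (w : ZMod N₂) * U.det = (c : ZMod N₂) ^ 2 ∧
      ∃ t : ℤ, IsUnit (t : ZMod N₁) ∧ (w : ZMod N₁) * t ^ 2 = c * U.det := by
  -- Moving h' to the left, with W = h diag(a, b) γ h'⁻¹, the relation becomes γ_ρ W = (A B; 0 U)
  -- γ_ρ where C_W ≡ 0 modulo N. The witness w is det D_W and t is U₀₀.
  have hk : γ * h'⁻¹ ∈ Gamma0 (N₀ * N₁ * N₂) := mul_mem hγ (inv_mem hh')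
  obtain ⟨k, hkd⟩ : ∃ k, k = γ * h'⁻¹ := ⟨_, rfl⟩
  rw [← hkd] at hk
  obtain ⟨W, hW⟩ : ∃ W, W = h.1 * fromBlocks a 0 0 b * k.1 := ⟨_, rfl⟩
  have hrel' : (cuspRep d).1 * W = fromBlocks A B 0 U * (cuspRep d).1 := by
    have e1 : h'.1 * (h'⁻¹).1 = 1 := by rw [← Submonoid.coe_mul, mul_inv_cancel]; rfl
    have e2 := congrArg (· * (h'⁻¹).1) hrel
    simp only [Submonoid.coe_mul, Matrix.mul_assoc, e1, Matrix.mul_one] at e2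
    rw [hW, hkd, Submonoid.coe_mul, ← e2]
    simp only [Matrix.mul_assoc]
  have hsim := similitude_blocks ((fromBlocks_toBlocks W).symm ▸
    (hW ▸ mul_similitude_mul (x := h) (γ := k) (diagBlocks_similitude hab)))
  have hCW : toBlocks₂₁ W = _ := (congrArg toBlocks₂₁ hW).trans
    (toBlocks₂₁_mul_diagBlocks_mul h k a b)
  have hDW : toBlocks₂₂ W = _ := (congrArg toBlocks₂₂ hW).trans
    (toBlocks₂₂_mul_diagBlocks_mul h k a b)
  rw [← fromBlocks_toBlocks W] at hrel'
  generalize toBlocks₁₁ W = AW at *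
  generalize toBlocks₁₂ W = BW at *
  generalize toBlocks₂₁ W = CW at *
  generalize toBlocks₂₂ W = DW at *
  simp only [cuspRep, fromBlocks_multiply, fromBlocks_inj, Matrix.one_mul, Matrix.mul_one,
    Matrix.zero_mul, Matrix.mul_zero, zero_add] at hrel'
  obtain ⟨-, -, r1, r2⟩ := hrel'
  have hCWd : ∀ i j, ((N₀ * N₁ * N₂ : ℕ) : ℤ) ∣ CW i j := by
    intro i j
    rw [hCW, Matrix.mul_assoc]
    exact dvd_add (dvd_mul_apply_left hh i j) (dvd_mul_apply_right hk i j)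
  obtain ⟨⟨hd00, hd01⟩, ⟨hd10, hd11⟩, hd20, hd21⟩ := hd.cast_eq hN
  have n0 : N₀ ∣ N₀ * N₁ * N₂ := Dvd.intro _ (mul_assoc _ _ _).symm
  have n1 : N₁ ∣ N₀ * N₁ * N₂ := Dvd.intro_left (N₀ * N₂) (by ring)
  have n2 : N₂ ∣ N₀ * N₁ * N₂ := Dvd.intro_left _ rfl
  have r1' {n : ℕ} (hn : n ∣ N₀ * N₁ * N₂) (i j : Fin 2) :
      (d i * AW i j : ZMod n) = U i j * d j := by
    have e := congrArg (Int.cast : ℤ → ZMod n) (congrFun (congrFun r1 i) j)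
    rw [Matrix.add_apply, diagonal_mul, mul_diagonal] at e
    push_cast at e
    rwa [map_cast_eq_zero hn hCWd, add_zero] at e
  have r2' (n : ℕ) (i j : Fin 2) : (d i * BW i j + DW i j : ZMod n) = U i j := by
    have e := congrArg (Int.cast : ℤ → ZMod n) (congrFun (congrFun r2 i) j)
    rw [Matrix.add_apply, diagonal_mul] at e
    push_cast at e
    exact e
  have r3 {n : ℕ} (hn : n ∣ N₀ * N₁ * N₂) (i j : Fin 2) :
      (AW i 0 * DW j 0 + AW i 1 * DW j 1 : ZMod n) =
        c * (1 : Matrix (Fin 2) (Fin 2) (ZMod n)) i j := by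
    have e := congrArg (Int.cast : ℤ → ZMod n) (congrFun (congrFun hsim.2.2 i) j)
    simp only [Matrix.sub_apply, Matrix.mul_apply, Fin.sum_univ_two, transpose_apply,
      Matrix.smul_apply, smul_eq_mul] at e
    push_cast at e
    simp only [map_cast_eq_zero hn hCWd, mul_zero, add_zero, sub_zero] at e
    rw [e]
    congr 1
    rw [one_apply, one_apply]
    split_ifs <;> simp
  refine ⟨DW.det, ?_, ?_, ?_, U 0 0, ?_, ?_⟩
  · have e1 : (DW.det : ZMod (N₀ * N₁ * N₂)) = (blkD h * b).det * (blkD k).det := by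
      rw [hDW]
      refine cast_det_mul_add _ _ _ _ (map_cast_eq_zero dvd_rfl ?_)
      rw [Matrix.mul_assoc]
      exact dvd_mul_apply_left hh
    have e2 : ((blkD γ).det : ZMod (N₀ * N₁ * N₂)) = (blkD k).det * (blkD h').det := by
      have : γ = k * h' := by rw [hkd]; group
      rw [this, blkD_mul]
      exact cast_det_mul_add _ _ _ _ (map_cast_eq_zero dvd_rfl (dvd_mul_apply_left hk))
    rw [e1, e2, det_mul]
    push_cast; ring
  -- Modulo N₀ the matrix M is 0, so D_W ≡ U.
  · rw [cast_det, cast_det]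
    have e (i j) := r2' N₀ i j
    have e0 := e 0 0
    have e1 := e 0 1
    have e2 := e 1 0
    have e3 := e 1 1
    rw [hd00, zero_mul, zero_add] at e0 e1
    rw [hd01, zero_mul, zero_add] at e2 e3
    rw [e0, e1, e2, e3]
  -- Modulo N₂ the matrix M is I, so A_W ≡ U, and A_W D_Wᵀ ≡ c.
  · have e0 := r1' n2 0 0
    have e1 := r1' n2 0 1
    have e2 := r1' n2 1 0
    have e3 := r1' n2 1 1
    rw [hd20] at e0 e1 e2
    rw [hd21] at e1 e2 e3
    have f0 := r3 n2 0 0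
    have f1 := r3 n2 0 1
    have f2 := r3 n2 1 0
    have f3 := r3 n2 1 1
    simp only [one_mul, mul_one, one_apply_eq, ne_eq, zero_ne_one, not_false_eq_true, one_apply_ne,
      one_ne_zero, mul_zero] at e0 e1 e2 e3 f0 f1 f2 f3
    rw [cast_det, cast_det, ← e0, ← e1, ← e2, ← e3]
    linear_combination (AW 1 0 * DW 1 0 + AW 1 1 * DW 1 1 : ZMod N₂) * f0 + (c : ZMod N₂) * f3 -
      (AW 1 0 * DW 0 0 + AW 1 1 * DW 0 1 : ZMod N₂) * f1
  · have e0 := r1' n1 0 0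
    have e1 := r1' n1 0 1
    have f0 := r3 n1 0 0
    rw [hd10] at e0 e1
    rw [hd11] at e1
    simp only [one_mul, mul_one, mul_zero, one_apply_eq] at e0 e1 f0
    rw [e1, e0, zero_mul, add_zero] at f0
    have hu := isUnit_cast_of_isCoprime n1 hcN
    rw [← f0] at hu
    exact isUnit_of_mul_isUnit_left hu
  -- Modulo N₁ the relations give U₁₀ ≡ 0, second row of D_W ≡ (0, U₁₁), and U₀₀ (D_W)₀₀ ≡ c. Hence
  -- w U₀₀² ≡ c U₀₀ U₁₁ = c det U.
  · have e0 := r1' n1 0 0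
    have e1 := r1' n1 0 1
    have e2 := r1' n1 1 0
    have f0 := r3 n1 0 0
    have g2 := r2' N₁ 1 0
    have g3 := r2' N₁ 1 1
    rw [hd10] at e0 e1 e2
    rw [hd11] at e1 e2 g2 g3
    simp only [one_mul, mul_one, mul_zero, zero_mul, zero_add, one_apply_eq] at e0 e1 e2 f0 g2 g3
    rw [e1, e0, zero_mul, add_zero] at f0
    rw [← e2] at g2
    rw [cast_det, cast_det, g2, g3, ← e2]
    linear_combination (U 0 0 * U 1 1 : ZMod N₁) * f0

theorem conj_mul_self_of_isCoprime {N : ℕ} (χ : DirichletCharacter ℂ N) {a : ℤ}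
    (ha : IsCoprime a (N : ℤ)) : starRingEnd ℂ (χ (a : ZMod N)) * χ (a : ZMod N) = 1 := by
  have h := DirichletCharacter.unit_norm_eq_one χ (isUnit_cast_of_isCoprime dvd_rfl ha).unit
  rw [IsUnit.unit_spec] at h
  rw [Complex.conj_mul', h]; norm_num

/-- The multiplier of the Hecke relation at the prime `p` when the upper triangular factor has
determinant `p ^ j`. -/
theorem conj_charD_mul_conj_charD {N₀ N₁ N₂ : ℕ} {d : Fin 2 → ℤ} (hd : IsCuspDiag N₀ N₁ N₂ d)
    (hN : Squarefree (N₀ * N₁ * N₂)) {χ : DirichletCharacter ℂ (N₀ * N₁ * N₂)}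
    {χ₀ : DirichletCharacter ℂ N₀} {χ₁ : DirichletCharacter ℂ N₁} {χ₂ : DirichletCharacter ℂ N₂}
    (hχ : ∀ a : ℤ, χ (a : ZMod (N₀ * N₁ * N₂)) =
      χ₀ (a : ZMod N₀) * χ₁ (a : ZMod N₁) * χ₂ (a : ZMod N₂))
    (hχ₁ : χ₁ ^ 2 = 1) {a b A B U : Matrix (Fin 2) (Fin 2) ℤ} {p : ℕ}
    (hpN : p.Coprime (N₀ * N₁ * N₂)) (hab : a * bᵀ = ((p : ℤ) ^ 2) • 1)
    (hb : b.det = (p : ℤ) ^ 3) {h γ h' : Sp ℤ} (hh : h ∈ Gamma0 (N₀ * N₁ * N₂))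
    (hγ : γ ∈ Gamma0 (N₀ * N₁ * N₂)) (hh' : h' ∈ Gamma0 (N₀ * N₁ * N₂))
    (hrel : (cuspRep d * h).1 * fromBlocks a 0 0 b * γ.1 =
      fromBlocks A B 0 U * (cuspRep d * h').1) {j : ℕ} (hj : j ∈ Finset.Icc 1 3)
    (hU : U.det = (p : ℤ) ^ j) :
    starRingEnd ℂ (charD χ h) * starRingEnd ℂ (charD χ γ) = starRingEnd ℂ (charD χ h') *
      (χ₀ (p : ZMod N₀) ^ (3 - j) * χ₁ (p : ZMod N₁) ^ (3 - j) * χ₂ (p : ZMod N₂) ^ (j - 1)) := by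
  have hpN' : IsCoprime (p : ℤ) ((N₀ * N₁ * N₂ : ℕ) : ℤ) := Nat.isCoprime_iff_coprime.2 hpN
  obtain ⟨w, hw, hw0, hw2, t, ht, hw1⟩ :=
    exists_det_congr hd hN (hpN'.pow_left (m := 2)) hab hh hγ hh' hrel
  rw [hU] at hw0 hw1 hw2
  rw [hb] at hw
  have n1 : N₁ ∣ N₀ * N₁ * N₂ := Dvd.intro_left (N₀ * N₂) (by ring)
  have n2 : N₂ ∣ N₀ * N₁ * N₂ := Dvd.intro_left _ rfl
  have sq1 {x : ZMod N₁} (hx : IsUnit x) : χ₁ x ^ 2 = 1 := by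
    have := congrArg (fun ψ : DirichletCharacter ℂ N₁ => ψ x) hχ₁
    simpa [MulChar.pow_apply' _ two_ne_zero, MulChar.one_apply hx] using this
  have hp1 : χ₁ (p : ZMod N₁) ^ 2 = 1 := sq1 (by
    have := isUnit_cast_of_isCoprime n1 hpN'
    simpa using this)
  have e := congrArg χ hw
  have e0 := congrArg χ₀ hw0
  have e1 := congrArg χ₁ hw1
  have e2 := congrArg χ₂ hw2
  rw [Int.cast_pow, Int.cast_natCast] at e
  push_cast at e0 e1 e2
  simp only [map_mul, map_pow] at e e0 e1 e2
  rw [sq1 ht, mul_one, hp1, one_mul] at e1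
  have hP : χ (p : ZMod (N₀ * N₁ * N₂)) = χ₀ (p : ZMod N₀) * χ₁ (p : ZMod N₁) *
      χ₂ (p : ZMod N₂) := by simpa using hχ p
  have hwχ := hχ w
  have u1 := conj_mul_self_of_isCoprime χ (isCoprime_det_blkD hh)
  have u2 := conj_mul_self_of_isCoprime χ (isCoprime_det_blkD hγ)
  have u3 := conj_mul_self_of_isCoprime χ (isCoprime_det_blkD hh')
  have u4 := conj_mul_self_of_isCoprime χ hpN'
  have hP0 : χ₀ (p : ZMod N₀) * χ₁ (p : ZMod N₁) * χ₂ (p : ZMod N₂) ≠ 0 := by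
    rw [← hP]; exact right_ne_zero_of_mul_eq_one (by simpa using u4)
  have hp2 : χ₂ (p : ZMod N₂) ≠ 0 := right_ne_zero_of_mul hP0
  unfold charD
  rw [hP] at e
  rw [e0, e1] at hwχ
  generalize χ ((blkD h).det : ZMod (N₀ * N₁ * N₂)) = H at *
  generalize χ ((blkD γ).det : ZMod (N₀ * N₁ * N₂)) = G at *
  generalize χ ((blkD h').det : ZMod (N₀ * N₁ * N₂)) = H' at *
  generalize χ (w : ZMod (N₀ * N₁ * N₂)) = W at *
  generalize χ₂ (w : ZMod N₂) = W2 at *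
  generalize χ₀ (p : ZMod N₀) = P0 at *
  generalize χ₁ (p : ZMod N₁) = P1 at *
  generalize χ₂ (p : ZMod N₂) = P2 at *
  -- Modulo N₂ one has w p^j ≡ p⁴. The multiplier ω is χ(p)³ / χ(w), where the 3 comes from det b =
  -- p³; the bounds on j keep both natural subtractions honest.
  have hW2 : W2 * P2 ^ (j - 1) = P2 ^ 3 := by
    rw [Finset.mem_Icc] at hj
    apply mul_right_cancel₀ hp2
    rw [mul_assoc, ← pow_succ, Nat.sub_add_cancel hj.1, e2]; ring
  set ω := P0 ^ (3 - j) * P1 ^ (3 - j) * P2 ^ (j - 1) with hω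
  have key : W * ω = (P0 * P1 * P2) ^ 3 := by
    rw [Finset.mem_Icc] at hj
    have h3 : j + (3 - j) = 3 := by omega
    rw [hwχ, hω]
    calc _ = (P0 ^ j * P0 ^ (3 - j)) * (P1 ^ j * P1 ^ (3 - j)) * (W2 * P2 ^ (j - 1)) := by ring
      _ = _ := by rw [← pow_add, ← pow_add, h3, hW2]; ring
  have hW0 : W ≠ 0 := left_ne_zero_of_mul (key ▸ pow_ne_zero 3 hP0)
  have key2 : H' = H * G * ω := by
    apply mul_left_cancel₀ hW0
    rw [e, ← key]; ring
  calc _ = (starRingEnd ℂ H' * H') * (starRingEnd ℂ H * starRingEnd ℂ G) := by rw [u3, one_mul]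
    _ = starRingEnd ℂ H' * ω * (starRingEnd ℂ H * H) * (starRingEnd ℂ G * G) := by
      conv_lhs => enter [1, 2]; rw [key2]
      ring
    _ = _ := by rw [u1, u2]; ring

/-! ### The three possible determinants of the triangular factor. -/

section Types

variable {p : ℕ} [hp : Fact p.Prime]

/-- The determinants multiply to p². If det Y were 1, X would be p times an integral matrix; if it
were p², det X would be 1. -/
theorem det_eq_prime_of_mul_transpose {X Y : Matrix (Fin 2) (Fin 2) ℤ}
    (h : X * Yᵀ = (p : ℤ) • 1) (hY : 0 < Y.det) {i j : Fin 2} (hX : ¬ (p : ℤ) ∣ X i j)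
    (hd : (p : ℤ) ∣ X.det) : Y.det = p ∧ X.det = p := by
  have hdet := det_ne_zero_of_mul_transpose_eq h
  have hp0 : (0 : ℤ) < p := by exact_mod_cast hp.out.pos
  obtain ⟨n, hn⟩ := Int.eq_ofNat_of_zero_le hY.le
  have hdvd : n ∣ p ^ 2 := by
    have : (n : ℤ) ∣ ((p ^ 2 : ℕ) : ℤ) := ⟨X.det, by rw [← hn]; push_cast; rw [← hdet, mul_comm]⟩
    exact_mod_cast this
  obtain ⟨l, hl, rfl⟩ := (Nat.dvd_prime_pow hp.out).1 hdvd
  have hl' : l = 1 := by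
    interval_cases l
    · exfalso
      apply hX
      have h1 : X * Yᵀ * Yᵀ.adjugate = (p : ℤ) • Yᵀ.adjugate := by
        rw [h, Matrix.smul_mul, Matrix.one_mul]
      rw [Matrix.mul_assoc, mul_adjugate, det_transpose, hn] at h1
      simp only [pow_zero, Nat.cast_one, one_smul, Matrix.mul_one] at h1
      rw [h1]
      exact ⟨_, by rw [Matrix.smul_apply, smul_eq_mul]⟩
    · rfl
    · exfalso
      rw [hn] at hdet
      push_cast at hdet
      have : X.det = 1 := by
        apply mul_right_cancel₀ (pow_ne_zero 2 hp0.ne')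
        rw [hdet, one_mul]
      rw [this] at hd
      exact hp.out.one_lt.ne' (by exact_mod_cast Int.eq_one_of_dvd_one hp0.le hd)
  subst hl'
  rw [pow_one] at hn
  refine ⟨hn, ?_⟩
  rw [hn] at hdet
  apply mul_right_cancel₀ hp0.ne'
  rw [hdet, sq]

theorem exists_eq_smul_of_cast_eq_zero {X : Matrix (Fin 2) (Fin 2) ℤ}
    (h : ∀ i j, (X i j : ZMod p) = 0) : ∃ Y, X = (p : ℤ) • Y := by
  choose Y hY using fun i j => (ZMod.intCast_zmod_eq_zero_iff_dvd _ _).1 (h i j)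
  exact ⟨Matrix.of Y, by ext i j; simpa using hY i j⟩

theorem smul_matrix_cancel {X Y : Matrix (Fin 2) (Fin 2) ℤ} (h : (p : ℤ) • X = (p : ℤ) • Y) :
    X = Y :=
  smul_right_injective _ (by exact_mod_cast hp.out.ne_zero) h

/-- `p δ₁⁻¹ = diag(1, p, p², p)`. -/
def heckeMat (p : ℕ) : Matrix (Fin 2 ⊕ Fin 2) (Fin 2 ⊕ Fin 2) ℤ :=
  fromBlocks (diagonal ![1, (p : ℤ)]) 0 0 (diagonal ![(p : ℤ) ^ 2, (p : ℤ)])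

theorem heckeMat_eq_diagonal (p : ℕ) :
    heckeMat p = diagonal (Sum.elim ![1, (p : ℤ)] ![(p : ℤ) ^ 2, (p : ℤ)]) :=
  fromBlocks_diagonal _ _

theorem heckeMat_blocks (p : ℕ) :
    diagonal ![1, (p : ℤ)] * (diagonal ![(p : ℤ) ^ 2, (p : ℤ)])ᵀ = ((p : ℤ) ^ 2) • 1 := by
  ext i j
  fin_cases i <;> fin_cases j <;> simp [sq]

/-- Modulo p the middle factor is a matrix unit, so only the first column of x times the first row
of z survives: the product has rank at most one. -/
theorem mul_heckeMat_mul_apply (p : ℕ) (x z : Sp ℤ) (i j : Fin 2 ⊕ Fin 2) :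
    (x.1 * heckeMat p * z.1) i j = x.1 i (.inl 0) * z.1 (.inl 0) j +
      p * (x.1 i (.inl 1) * z.1 (.inl 1) j + p * (x.1 i (.inr 0) * z.1 (.inr 0) j) +
        x.1 i (.inr 1) * z.1 (.inr 1) j) := by
  rw [heckeMat_eq_diagonal, Matrix.mul_apply]
  simp only [mul_diagonal, Fintype.sum_sum_type, Fin.sum_univ_two, Sum.elim_inl, Sum.elim_inr,
    cons_val_zero, cons_val_one]
  ring

theorem coe_inv_mul_coe {R : Type} [CommRing R] (x : Sp R) : (x⁻¹).1 * x.1 = 1 := by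
  rw [← Submonoid.coe_mul, inv_mul_cancel]; rfl

theorem coe_mul_coe_inv {R : Type} [CommRing R] (x : Sp R) : x.1 * (x⁻¹).1 = 1 := by
  rw [← Submonoid.coe_mul, mul_inv_cancel]; rfl

theorem exists_col_cast_ne_zero (x : Sp ℤ) (j : Fin 2 ⊕ Fin 2) :
    ∃ i, (x.1 i j : ZMod p) ≠ 0 := by
  by_contra! h
  have h1 := congrArg (Int.cast : ℤ → ZMod p) (congrFun (congrFun (coe_inv_mul_coe x) j) j)
  rw [Matrix.mul_apply, one_apply_eq] at h1
  push_cast at h1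
  simp [h] at h1

theorem exists_row_cast_ne_zero (x : Sp ℤ) (i : Fin 2 ⊕ Fin 2) :
    ∃ j, (x.1 i j : ZMod p) ≠ 0 := by
  by_contra! h
  have h1 := congrArg (Int.cast : ℤ → ZMod p) (congrFun (congrFun (coe_mul_coe_inv x) i) i)
  rw [Matrix.mul_apply, one_apply_eq] at h1
  push_cast at h1
  simp [h] at h1

theorem prime_dvd_det_of_rank_one {X : Matrix (Fin 2) (Fin 2) ℤ} {u v : Fin 2 → ZMod p}
    (h : ∀ i j, (X i j : ZMod p) = u i * v j) : (p : ℤ) ∣ X.det := by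
  rw [← ZMod.intCast_zmod_eq_zero_iff_dvd, cast_det, h, h, h, h]
  ring

/-- The determinant of the upper triangular factor is read off from the vector `f z`. -/
theorem det_upper_cases {x z : Sp ℤ} {A B U : Matrix (Fin 2) (Fin 2) ℤ}
    (hT : x.1 * heckeMat p * z.1 = fromBlocks A B 0 U) (hU : 0 < U.det)
    {f v : Fin 2 ⊕ Fin 2 → ℤ} (hf : ¬ (p : ℤ) ∣ f (.inl 0)) (hf1 : (p : ℤ) ∣ f (.inl 1))
    (hf2 : (p : ℤ) ^ 2 ∣ f (.inr 0)) (hf3 : (p : ℤ) ∣ f (.inr 1)) (hv : v = f ᵥ* z.1) :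
    (¬ ((p : ℤ) ∣ v (.inl 0) ∧ (p : ℤ) ∣ v (.inl 1)) ∧ U.det = p ^ 3) ∨
    (((p : ℤ) ∣ v (.inl 0) ∧ (p : ℤ) ∣ v (.inl 1)) ∧
      (p : ℤ) ^ 2 ∣ v (.inl 0) * v (.inr 0) + v (.inl 1) * v (.inr 1) ∧ U.det = p ^ 1) ∨
    (((p : ℤ) ∣ v (.inl 0) ∧ (p : ℤ) ∣ v (.inl 1)) ∧
      ¬ (p : ℤ) ^ 2 ∣ v (.inl 0) * v (.inr 0) + v (.inl 1) * v (.inr 1) ∧ U.det = p ^ 2) := by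
  have hp0 : (p : ℤ) ≠ 0 := by exact_mod_cast hp.out.ne_zero
  have hpp : Prime (p : ℤ) := Nat.prime_iff_prime_int.1 hp.out
  obtain ⟨hAU, hAB⟩ := upper_similitude (y := 1) (heckeMat_blocks p)
    (show x.1 * heckeMat p * z.1 = fromBlocks A B 0 U * (1 : Sp ℤ).1 by
      rw [hT]; exact (Matrix.mul_one _).symm)
  -- `T ≡ a b` modulo `p`
  have hTc (i j) : ((fromBlocks A B 0 U i j : ℤ) : ZMod p) = x.1 i (.inl 0) * z.1 (.inl 0) j := by
    rw [← hT, mul_heckeMat_mul_apply]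
    push_cast
    simp
  have hA (i j) : (A i j : ZMod p) = _ := hTc (.inl i) (.inl j)
  have hB (i j) : (B i j : ZMod p) = _ := hTc (.inl i) (.inr j)
  have h0 (i j) : ((0 : ℤ) : ZMod p) = _ := hTc (.inr i) (.inl j)
  have hUc (i j) : (U i j : ZMod p) = _ := hTc (.inr i) (.inr j)
  have hvc (j) : (v j : ZMod p) = f (.inl 0) * z.1 (.inl 0) j := by
    obtain ⟨f1, e1⟩ := hf1
    obtain ⟨f2, e2⟩ := hf2
    obtain ⟨f3, e3⟩ := hf3
    rw [hv, vecMul, dotProduct, Fintype.sum_sum_type, Fin.sum_univ_two, Fin.sum_univ_two, e1, e2,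
      e3]
    push_cast
    simp
  -- The divisibilities of f make f δ⁻¹ integral, and q = f δ⁻¹ x⁻¹ satisfies q T = f z = v.
  obtain ⟨q, hq⟩ : ∃ q : Fin 2 ⊕ Fin 2 → ℤ, v = q ᵥ* fromBlocks A B 0 U := by
    obtain ⟨f1, e1⟩ := hf1
    obtain ⟨f2, e2⟩ := hf2
    obtain ⟨f3, e3⟩ := hf3
    refine ⟨Sum.elim ![f (.inl 0), f1] ![f2, f3] ᵥ* (x⁻¹).1, ?_⟩
    rw [← hT, vecMul_vecMul, ← Matrix.mul_assoc, ← Matrix.mul_assoc, coe_inv_mul_coe,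
      Matrix.one_mul, ← vecMul_vecMul, hv, heckeMat_eq_diagonal]
    congr 1
    funext j
    rw [vecMul_diagonal]
    rcases j with j | j <;> fin_cases j <;> simp [e1, e2, e3, mul_comm]
  have hvx (j) : v (.inl j) = q (.inl 0) * A 0 j + q (.inl 1) * A 1 j := by
    rw [hq, vecMul, dotProduct, Fintype.sum_sum_type, Fin.sum_univ_two, Fin.sum_univ_two]
    simp
  have hvy (j) : v (.inr j) = q (.inl 0) * B 0 j + q (.inl 1) * B 1 j +
      (q (.inr 0) * U 0 j + q (.inr 1) * U 1 j) := by
    rw [hq, vecMul, dotProduct, Fintype.sum_sum_type, Fin.sum_univ_two, Fin.sum_univ_two]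
    simp
  have hfc : (f (.inl 0) : ZMod p) ≠ 0 := fun h =>
    hf ((ZMod.intCast_zmod_eq_zero_iff_dvd _ _).1 h)
  have hvd (j) : (p : ℤ) ∣ v j ↔ (z.1 (.inl 0) j : ZMod p) = 0 := by
    rw [← ZMod.intCast_zmod_eq_zero_iff_dvd, hvc, mul_eq_zero, or_iff_right hfc]
  obtain ⟨ia, hia⟩ := exists_col_cast_ne_zero (p := p) x (.inl 0)
  obtain ⟨jb, hjb⟩ := exists_row_cast_ne_zero (p := p) z (.inl 0)
  -- Let a = (a_u, a_l) be the first column of x and b = (b_x, b_y) the first row of z, modulo p;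
  -- then v ≡ f₀ b with f₀ a unit. If b_x ≠ 0, the zero block of T forces a_l = 0, so U = p U₁ and A
  -- U₁ᵀ = p with A nonzero of rank one modulo p.
  by_cases hbx : ∃ j, (z.1 (.inl 0) (.inl j) : ZMod p) ≠ 0
  · obtain ⟨j, hj⟩ := hbx
    left
    refine ⟨fun h => ?_, ?_⟩
    · fin_cases j
      · exact hj ((hvd _).1 h.1)
      · exact hj ((hvd _).1 h.2)
    · have hal (i) : (x.1 (.inr i) (.inl 0) : ZMod p) = 0 := by
        have := h0 i j
        rw [Int.cast_zero] at this
        exact (mul_eq_zero.1 this.symm).resolve_right hj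
      obtain ⟨U1, rfl⟩ := exists_eq_smul_of_cast_eq_zero (X := U) (p := p) fun i j => by
        rw [hUc, hal, zero_mul]
      have e1 : A * U1ᵀ = (p : ℤ) • 1 := by
        apply smul_matrix_cancel (p := p)
        rw [transpose_smul, Matrix.mul_smul] at hAU
        rw [hAU, smul_smul, sq]
      rw [det_smul, Fintype.card_fin] at hU ⊢
      obtain ⟨i, rfl⟩ : ∃ i, ia = .inl i := by
        rcases ia with i | i
        · exact ⟨i, rfl⟩
        · exact absurd (hal i) hia
      have e2 := det_eq_prime_of_mul_transpose e1 (pos_of_mul_pos_right hU (sq_nonneg _))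
        (i := i) (j := j) (by
          rw [← ZMod.intCast_zmod_eq_zero_iff_dvd, hA]
          exact mul_ne_zero hia hj) (prime_dvd_det_of_rank_one hA)
      rw [e2.1]; ring
  · push Not at hbx
    right
    have hdx : (p : ℤ) ∣ v (.inl 0) ∧ (p : ℤ) ∣ v (.inl 1) :=
      ⟨(hvd _).2 (hbx 0), (hvd _).2 (hbx 1)⟩
    obtain ⟨jy, rfl⟩ : ∃ i, jb = .inr i := by
      rcases jb with i | i
      · exact absurd (hbx i) hjb
      · exact ⟨i, rfl⟩
    obtain ⟨A1, rfl⟩ := exists_eq_smul_of_cast_eq_zero (X := A) (p := p) fun i j => by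
      rw [hA, hbx, mul_zero]
    have e1 : A1 * Uᵀ = (p : ℤ) • 1 := by
      apply smul_matrix_cancel (p := p)
      rw [Matrix.smul_mul] at hAU
      rw [hAU, smul_smul, sq]
    -- `v_x · v_y = p m`
    obtain ⟨m, hm⟩ : ∃ m, m = (q (.inl 0) * A1 0 0 + q (.inl 1) * A1 1 0) * v (.inr 0) +
      (q (.inl 0) * A1 0 1 + q (.inl 1) * A1 1 1) * v (.inr 1) := ⟨_, rfl⟩
    have hvm : v (.inl 0) * v (.inr 0) + v (.inl 1) * v (.inr 1) = p * m := by
      rw [hvx, hvx, hm]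
      simp only [Matrix.smul_apply, smul_eq_mul]
      ring
    have hdm : (p : ℤ) ^ 2 ∣ v (.inl 0) * v (.inr 0) + v (.inl 1) * v (.inr 1) ↔
        (m : ZMod p) = 0 := by
      rw [hvm, sq, mul_dvd_mul_iff_left hp0, ZMod.intCast_zmod_eq_zero_iff_dvd]
    have hmc : (m : ZMod p) = f (.inl 0) * (q (.inl 0) * (A1 0 0 * z.1 (.inl 0) (.inr 0) +
        A1 0 1 * z.1 (.inl 0) (.inr 1)) + q (.inl 1) * (A1 1 0 * z.1 (.inl 0) (.inr 0) +
        A1 1 1 * z.1 (.inl 0) (.inr 1))) := by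
      rw [hm]
      push_cast
      rw [hvc, hvc]
      ring
    -- Now b_x = 0 and A = p A₁. If a_l ≠ 0, then U ≡ a_l b_y has rank one, and A₁ Uᵀ = p forces A₁
    -- b_y ≡ 0, whence m ≡ 0. If a_l = 0, then U = p U₁ with A₁ unimodular.
    by_cases hal : ∃ i, (x.1 (.inr i) (.inl 0) : ZMod p) ≠ 0
    · obtain ⟨i, hi⟩ := hal
      left
      refine ⟨hdx, ?_, ?_⟩
      · have e2 (k) : (A1 k 0 * z.1 (.inl 0) (.inr 0) + A1 k 1 * z.1 (.inl 0) (.inr 1) : ZMod p)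
            = 0 := by
          have e3 := congrArg (Int.cast : ℤ → ZMod p) (congrFun (congrFun e1 k) i)
          rw [Matrix.mul_apply, Fin.sum_univ_two, Matrix.smul_apply, smul_eq_mul] at e3
          simp only [transpose_apply] at e3
          push_cast at e3
          rw [hUc, hUc, ZMod.natCast_self, zero_mul] at e3
          refine (mul_eq_zero.1 ?_).resolve_left hi
          rw [← e3]; ring
        rw [hdm, hmc, e2, e2]
        ring
      · have e3 : U * A1ᵀ = (p : ℤ) • 1 := by
          have := congrArg transpose e1
          simpa using this
        have e4 := det_ne_zero_of_mul_transpose_eq e3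
        have e5 : 0 < A1.det := by
          refine pos_of_mul_pos_right ?_ hU.le
          rw [e4]
          positivity
        rw [pow_one]
        exact (det_eq_prime_of_mul_transpose e3 e5 (i := i) (j := jy) (by
          rw [← ZMod.intCast_zmod_eq_zero_iff_dvd, hUc]
          exact mul_ne_zero hi hjb) (prime_dvd_det_of_rank_one hUc)).2
    · push Not at hal
      right
      obtain ⟨ix, rfl⟩ : ∃ i, ia = .inl i := by
        rcases ia with i | i
        · exact ⟨i, rfl⟩
        · exact absurd (hal i) hia
      obtain ⟨U1, rfl⟩ := exists_eq_smul_of_cast_eq_zero (X := U) (p := p) fun i j => by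
        rw [hUc, hal, zero_mul]
      have e2 : A1 * U1ᵀ = 1 := by
        apply smul_matrix_cancel (p := p)
        rw [transpose_smul, Matrix.mul_smul] at e1
        exact e1
      refine ⟨hdx, ?_, ?_⟩
      · have e3 : U1ᵀ * A1 = 1 := mul_eq_one_comm.1 e2
        have hAB' : A1 * Bᵀ = B * A1ᵀ := by
          apply smul_matrix_cancel (p := p)
          rw [transpose_smul, Matrix.mul_smul, Matrix.smul_mul] at hAB
          exact hAB
        -- `e = A₁ b_y` is nonzero and `e a` is symmetric
        obtain ⟨e, he⟩ : ∃ e : Fin 2 → ZMod p, ∀ k, e k =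
          (A1 k 0 * z.1 (.inl 0) (.inr 0) + A1 k 1 * z.1 (.inl 0) (.inr 1)) := ⟨_, fun _ => rfl⟩
        have hsym (i k : Fin 2) : e i * x.1 (.inl k) (.inl 0) = e k * x.1 (.inl i) (.inl 0) := by
          have e4 := congrArg (Int.cast : ℤ → ZMod p) (congrFun (congrFun hAB' i) k)
          rw [Matrix.mul_apply, Fin.sum_univ_two, Matrix.mul_apply, Fin.sum_univ_two] at e4
          simp only [transpose_apply] at e4
          push_cast at e4
          rw [hB, hB, hB, hB] at e4
          rw [he, he]
          linear_combination e4
        obtain ⟨k, hk⟩ : ∃ k, e k ≠ 0 := by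
          by_contra! hcon
          apply hjb
          have e5 := congrArg (Int.cast : ℤ → ZMod p) (congrFun (congrFun e3 jy) 0)
          have e6 := congrArg (Int.cast : ℤ → ZMod p) (congrFun (congrFun e3 jy) 1)
          rw [Matrix.mul_apply, Fin.sum_univ_two] at e5 e6
          push_cast at e5 e6
          have c0 := (he 0).symm.trans (hcon 0)
          have c1 := (he 1).symm.trans (hcon 1)
          have c2 : ((1 : Matrix (Fin 2) (Fin 2) ℤ) jy 0 : ZMod p) * z.1 (.inl 0) (.inr 0) +
              ((1 : Matrix (Fin 2) (Fin 2) ℤ) jy 1 : ZMod p) * z.1 (.inl 0) (.inr 1) = 0 := by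
            rw [← e5, ← e6]
            linear_combination ((U1ᵀ jy 0 : ℤ) : ZMod p) * c0 + ((U1ᵀ jy 1 : ℤ) : ZMod p) * c1
          obtain rfl | rfl : jy = 0 ∨ jy = 1 := by fin_cases jy <;> simp
          · simpa using c2
          · simpa using c2
        -- The coordinate jy of v = q T, compared with v ≡ f₀ b, gives q · a_u ≡ f₀. Symmetry of e
        -- a_uᵀ then turns q · e ≡ 0 into e_k f₀ ≡ 0, a contradiction.
        have hs : (q (.inl 0) * x.1 (.inl 0) (.inl 0) + q (.inl 1) * x.1 (.inl 1) (.inl 0) :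
            ZMod p) = f (.inl 0) := by
          have e4 := hvc (.inr jy)
          rw [hvy] at e4
          push_cast at e4
          rw [hB, hB, hUc, hUc, hal, hal] at e4
          apply mul_right_cancel₀ hjb
          rw [← e4]; ring
        rw [hdm, hmc, ← he, ← he]
        refine mul_ne_zero hfc fun hcon => ?_
        have e6 : e k * (q (.inl 0) * x.1 (.inl 0) (.inl 0) +
            q (.inl 1) * x.1 (.inl 1) (.inl 0) : ZMod p) = 0 := by
          linear_combination (x.1 (.inl k) (.inl 0) : ZMod p) * hcon -
            (q (.inl 0) : ZMod p) * hsym 0 k - (q (.inl 1) : ZMod p) * hsym 1 k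
        rw [hs] at e6
        exact mul_ne_zero hk hfc e6
      · have e4 := congrArg det e2
        rw [det_mul, det_transpose, det_one] at e4
        rw [det_smul, Fintype.card_fin] at hU ⊢
        have e5 : 0 < U1.det := pos_of_mul_pos_right hU (sq_nonneg _)
        rw [Int.eq_one_of_mul_eq_one_left e5.le e4, mul_one]

end Types

/-! ### The Hecke subgroup in terms of the first row. -/

section HeckeSubgroup

variable {p : ℕ} [hp : Fact p.Prime]

/-- If the first row of `γ` is a multiple of the first unit vector modulo `p`, then the third column
is a multiple of the third unit vector. -/
theorem dvd_col_of_dvd_row {γ : Sp ℤ} (h1 : (p : ℤ) ∣ γ.1 (.inl 0) (.inl 1))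
    (h2 : (p : ℤ) ∣ γ.1 (.inl 0) (.inr 0)) (h3 : (p : ℤ) ∣ γ.1 (.inl 0) (.inr 1)) :
    ¬ (p : ℤ) ∣ γ.1 (.inl 0) (.inl 0) ∧ (p : ℤ) ∣ γ.1 (.inl 1) (.inr 0) ∧
      (p : ℤ) ∣ γ.1 (.inr 1) (.inr 0) := by
  simp only [← ZMod.intCast_zmod_eq_zero_iff_dvd] at *
  have e1 := congrArg (Int.cast : ℤ → ZMod p)
    (congrFun (congrFun (blkA_mul_transpose_blkB γ) 0) 1)
  have e2 := congrArg (Int.cast : ℤ → ZMod p)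
    (congrFun (congrFun (blkD_mul_transpose_blkA_sub γ) 1) 0)
  have e3 := congrArg (Int.cast : ℤ → ZMod p)
    (congrFun (congrFun (blkD_mul_transpose_blkA_sub γ) 0) 0)
  simp only [Matrix.sub_apply, Matrix.mul_apply, Fin.sum_univ_two, transpose_apply, blkA, blkB,
    blkC, blkD, toBlocks₁₁, toBlocks₁₂, toBlocks₂₁, toBlocks₂₂, of_apply, one_apply_eq] at e1 e2 e3
  push_cast at e1 e2 e3
  rw [h1, h2, h3] at e1 e2 e3
  simp only [mul_zero, zero_mul, add_zero, sub_zero, ne_eq, one_ne_zero, not_false_eq_true,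
    one_apply_ne, Int.cast_zero, mul_eq_zero] at e1 e2 e3
  have h0 : (γ.1 (.inl 0) (.inl 0) : ZMod p) ≠ 0 := right_ne_zero_of_mul_eq_one e3
  exact ⟨h0, e1.resolve_left h0, e2.resolve_right h0⟩

/-- With w the diagonal of p δ₁, the conjugate δ₁⁻¹ γ δ₁ has entries γᵢⱼ wⱼ / wᵢ. The conditions on
the first row, and those they imply on the third column, make these integral; coprimality of p and N
keeps the lower left block divisible by N. -/
theorem mem_heckeSubgroup_of_dvd {N : ℕ} (hpN : p.Coprime N) (γ : Gamma0 N)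
    (h1 : (p : ℤ) ∣ γ.1.1 (.inl 0) (.inl 1)) (h2 : (p : ℤ) ^ 2 ∣ γ.1.1 (.inl 0) (.inr 0))
    (h3 : (p : ℤ) ∣ γ.1.1 (.inl 0) (.inr 1)) : γ ∈ heckeSubgroup N p := by
  have hp0 : (p : ℝ) ≠ 0 := NeZero.ne _
  have hp0' : (p : ℤ) ≠ 0 := NeZero.ne _
  obtain ⟨-, h4, h5⟩ := dvd_col_of_dvd_row h1 ((dvd_pow_self _ two_ne_zero).trans h2) h3
  set w : Fin 2 ⊕ Fin 2 → ℤ := Sum.elim ![(p : ℤ) ^ 2, p] ![1, p] with hw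
  have hdvd (i j) : w i ∣ γ.1.1 i j * w j := by
    rcases i with i | i <;> rcases j with j | j <;> fin_cases i <;> fin_cases j <;>
      simp only [hw, Sum.elim_inl, Sum.elim_inr, Fin.zero_eta, Fin.mk_one, cons_val_zero,
        cons_val_one, isUnit_one, IsUnit.dvd, dvd_mul_left, mul_one]
    · rw [sq]; exact mul_dvd_mul_right h1 _
    · exact Dvd.dvd.mul_left (dvd_pow_self _ two_ne_zero) _
    · exact h2
    · rw [sq]; exact mul_dvd_mul_right h3 _
    · exact h4
    · exact Dvd.dvd.mul_left (dvd_pow_self _ two_ne_zero) _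
    · exact h5
  choose E hE using hdvd
  set η : Matrix (Fin 2 ⊕ Fin 2) (Fin 2 ⊕ Fin 2) ℤ := Matrix.of E with hη
  have hd (i) : (Sum.elim ![(p : ℝ), 1] ![(p : ℝ)⁻¹, 1] : Fin 2 ⊕ Fin 2 → ℝ) i =
      (p : ℝ)⁻¹ * w i := by
    rcases i with i | i <;> fin_cases i <;> simp [hw, sq, hp0]
  have key : (delta1 p).1 * η.map (Int.castRingHom ℝ) = (toReal γ.1).1 * (delta1 p).1 := by
    have e1 : (toReal γ.1).1 = γ.1.1.map (Int.castRingHom ℝ) := rfl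
    rw [e1, coe_delta1]
    ext i j
    rw [diagonal_mul, mul_diagonal, hd, hd]
    have e2 := congrArg (Int.cast : ℤ → ℝ) (hE i j)
    push_cast at e2
    simp only [hη, map_apply, of_apply, Int.coe_castRingHom]
    linear_combination -(p : ℝ)⁻¹ * e2
  have key2 : η.map (Int.castRingHom ℝ) = ((delta1 p)⁻¹ * (toReal γ.1 * delta1 p)).1 := by
    rw [Submonoid.coe_mul, Submonoid.coe_mul, ← key, ← Matrix.mul_assoc, coe_inv_mul_coe,
      Matrix.one_mul]
  have hmem : η ∈ symplecticGroup (Fin 2) ℤ := by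
    have e2 := ((delta1 p)⁻¹ * (toReal γ.1 * delta1 p)).2
    rw [← key2, SymplecticGroup.mem_iff, ← map_J (Fin 2) (Int.castRingHom ℝ), ← transpose_map,
      ← Matrix.map_mul, ← Matrix.map_mul] at e2
    exact SymplecticGroup.mem_iff.2
      (Matrix.map_injective (Int.castRingHom ℝ).injective_int e2)
  have hΓ : (⟨η, hmem⟩ : Sp ℤ) ∈ Gamma0 N := by
    intro i j
    have e1 : (N : ℤ) ∣ w (.inr i) * η (.inr i) (.inl j) := by
      rw [hη, of_apply, ← hE]
      exact Dvd.dvd.mul_right (γ.2 i j) _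
    have e2 : IsCoprime (N : ℤ) (w (.inr i)) := by
      fin_cases i
      · exact isCoprime_one_right
      · exact (Nat.isCoprime_iff_coprime.2 hpN).symm
    exact e2.dvd_of_dvd_mul_left e1
  have key3 : toReal ⟨η, hmem⟩ = (delta1 p)⁻¹ * (toReal γ.1 * delta1 p) := Subtype.ext key2
  refine Subgroup.mem_comap.2 (Subgroup.mem_map.2 ⟨_, Subgroup.mem_map_of_mem toReal hΓ, ?_⟩)
  rw [key3]
  simp [mul_assoc]

theorem dvd_of_mem_heckeSubgroup {N : ℕ} {γ : Gamma0 N} (h : γ ∈ heckeSubgroup N p) :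
    (p : ℤ) ∣ γ.1.1 (.inl 0) (.inl 1) ∧ (p : ℤ) ^ 2 ∣ γ.1.1 (.inl 0) (.inr 0) ∧
      (p : ℤ) ∣ γ.1.1 (.inl 0) (.inr 1) := by
  have hp0 : (p : ℝ) ≠ 0 := NeZero.ne _
  obtain ⟨_, ⟨η, -, rfl⟩, hη⟩ := h
  have hη' : delta1 p * toReal η = toReal γ.1 * delta1 p := by
    have : delta1 p * toReal η * (delta1 p)⁻¹ = toReal γ.1 := hη
    rw [← this]; group
  have e := congrArg Subtype.val hη'
  rw [Submonoid.coe_mul, Submonoid.coe_mul, coe_delta1] at e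
  have e1 (j) : (p : ℝ) * η.1 (.inl 0) j =
      γ.1.1 (.inl 0) j * (Sum.elim ![(p : ℝ), 1] ![(p : ℝ)⁻¹, 1] : Fin 2 ⊕ Fin 2 → ℝ) j := by
    have e2 := congrFun (congrFun e (.inl 0)) j
    rw [diagonal_mul, mul_diagonal] at e2
    exact e2
  refine ⟨⟨η.1 (.inl 0) (.inl 1), ?_⟩, ⟨η.1 (.inl 0) (.inr 0), ?_⟩, ⟨η.1 (.inl 0) (.inr 1), ?_⟩⟩
  · have := e1 (.inl 1)
    simp only [Sum.elim_inl, cons_val_one, mul_one, cons_val_zero] at this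
    exact_mod_cast this.symm
  · have := e1 (.inr 0)
    simp only [Sum.elim_inr, cons_val_zero] at this
    field_simp at this
    exact_mod_cast this.symm
  · have := e1 (.inr 1)
    simp only [Sum.elim_inr, cons_val_one, mul_one, cons_val_zero] at this
    exact_mod_cast this.symm

end HeckeSubgroup

/-! ### Counting vectors modulo p². -/

section ModSq

variable {p : ℕ}

theorem prime_dvd_intCast_iff (n : ℤ) : (p : ZMod (p ^ 2)) ∣ (n : ZMod (p ^ 2)) ↔ (p : ℤ) ∣ n := by
  constructor
  · rintro ⟨c, hc⟩
    obtain ⟨c, rfl⟩ := ZMod.intCast_surjective c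
    have h1 : ((n - p * c : ℤ) : ZMod (p ^ 2)) = 0 := by push_cast; rw [hc, sub_self]
    rw [ZMod.intCast_zmod_eq_zero_iff_dvd] at h1
    have h2 : (p : ℤ) ∣ n - p * c := Dvd.dvd.trans ⟨p, by push_cast; ring⟩ h1
    simpa using dvd_add h2 (dvd_mul_right (p : ℤ) c)
  · rintro ⟨c, rfl⟩
    exact ⟨c, by push_cast; rfl⟩

theorem isUnit_iff_not_prime_dvd [hp : Fact p.Prime] (a : ZMod (p ^ 2)) :
    IsUnit a ↔ ¬ (p : ZMod (p ^ 2)) ∣ a := by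
  obtain ⟨n, rfl⟩ := ZMod.intCast_surjective a
  rw [prime_dvd_intCast_iff, ZMod.coe_int_isUnit_iff_isCoprime]
  push_cast
  rw [IsCoprime.pow_left_iff two_pos, Prime.coprime_iff_not_dvd (Nat.prime_iff_prime_int.1 hp.out)]

theorem mul_eq_zero_of_prime_dvd {a b : ZMod (p ^ 2)} (ha : (p : ZMod (p ^ 2)) ∣ a)
    (hb : (p : ZMod (p ^ 2)) ∣ b) : a * b = 0 := by
  obtain ⟨a, rfl⟩ := ha
  obtain ⟨b, rfl⟩ := hb
  have : (p : ZMod (p ^ 2)) ^ 2 = 0 := by exact_mod_cast ZMod.natCast_self (p ^ 2)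
  linear_combination a * b * this

theorem intCast_sq_eq_zero_iff (n : ℤ) : (n : ZMod (p ^ 2)) = 0 ↔ (p : ℤ) ^ 2 ∣ n := by
  rw [ZMod.intCast_zmod_eq_zero_iff_dvd]; push_cast; rfl

theorem prime_dvd_of_dvd_mul_left [hp : Fact p.Prime] {a b : ZMod (p ^ 2)}
    (ha : ¬ (p : ZMod (p ^ 2)) ∣ a)
    (h : (p : ZMod (p ^ 2)) ∣ a * b) : (p : ZMod (p ^ 2)) ∣ b :=
  ((isUnit_iff_not_prime_dvd a).2 ha).dvd_mul_left.1 h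

open Classical in
theorem card_prime_dvd [hp : Fact p.Prime] :
    (Finset.univ.filter fun a : ZMod (p ^ 2) => (p : ZMod (p ^ 2)) ∣ a).card = p := by
  have h1 := Finset.card_filter_add_card_filter_not (s := (Finset.univ : Finset (ZMod (p ^ 2))))
    (fun a => (p : ZMod (p ^ 2)) ∣ a)
  have h2 : (Finset.univ.filter fun a : ZMod (p ^ 2) => ¬ (p : ZMod (p ^ 2)) ∣ a).card =
      p * (p - 1) := by
    have h3 : (p ^ 2).totient = p * (p - 1) := by
      rw [Nat.totient_prime_pow hp.out two_pos]; simp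
    rw [← h3, ← ZMod.card_units_eq_totient]
    rw [← Finset.card_univ, ← Finset.card_map ⟨Units.val, Units.val_injective⟩]
    congr 1
    ext a
    simp only [Finset.mem_filter, Finset.mem_univ, true_and, ← isUnit_iff_not_prime_dvd,
      Finset.mem_map, Function.Embedding.coeFn_mk]
    exact Iff.rfl
  rw [h2, Finset.card_univ, ZMod.card] at h1
  obtain ⟨m, hm⟩ : ∃ m, p = m + 1 := ⟨p - 1, (Nat.sub_add_cancel hp.out.one_le).symm⟩
  have h4 : p - 1 = m := by omega
  rw [h4] at h1
  nlinarith

variable (p) in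
open Classical in
/-- The multiples of `p` modulo `p²`. -/
noncomputable def multSet [Fact p.Prime] : Finset (ZMod (p ^ 2)) :=
  Finset.univ.filter fun a => (p : ZMod (p ^ 2)) ∣ a

variable (p) in
open Classical in
/-- The pairs of residues modulo `p²` that are primitive. -/
noncomputable def primPairs [Fact p.Prime] : Finset (ZMod (p ^ 2) × ZMod (p ^ 2)) :=
  Finset.univ.filter fun a => ¬ ((p : ZMod (p ^ 2)) ∣ a.1 ∧ (p : ZMod (p ^ 2)) ∣ a.2)

variable (p) in
open Classical in
/-- The primitive vectors modulo `p²`. -/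
noncomputable def primVecs [Fact p.Prime] :
    Finset ((ZMod (p ^ 2) × ZMod (p ^ 2)) × ZMod (p ^ 2) × ZMod (p ^ 2)) :=
  Finset.univ.filter fun v => v.1 ∈ primPairs p ∨ v.2 ∈ primPairs p

variable (p) in
/-- The vectors modulo `p²` attached to the trivial coset of the Hecke subgroup. -/
noncomputable def baseVecs [Fact p.Prime] :
    Finset ((ZMod (p ^ 2) × ZMod (p ^ 2)) × ZMod (p ^ 2) × ZMod (p ^ 2)) :=
  ((multSet p)ᶜ ×ˢ multSet p) ×ˢ ({0} ×ˢ multSet p)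

theorem mem_multSet [Fact p.Prime] {a : ZMod (p ^ 2)} :
    a ∈ multSet p ↔ (p : ZMod (p ^ 2)) ∣ a := by simp [multSet]

theorem mem_primPairs [Fact p.Prime] {a : ZMod (p ^ 2) × ZMod (p ^ 2)} :
    a ∈ primPairs p ↔ ¬ ((p : ZMod (p ^ 2)) ∣ a.1 ∧ (p : ZMod (p ^ 2)) ∣ a.2) := by
  simp [primPairs]

theorem mem_baseVecs [Fact p.Prime]
    {f : (ZMod (p ^ 2) × ZMod (p ^ 2)) × ZMod (p ^ 2) × ZMod (p ^ 2)} :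
    f ∈ baseVecs p ↔ ¬ (p : ZMod (p ^ 2)) ∣ f.1.1 ∧ (p : ZMod (p ^ 2)) ∣ f.1.2 ∧ f.2.1 = 0 ∧
      (p : ZMod (p ^ 2)) ∣ f.2.2 := by
  simp only [baseVecs, Finset.mem_product, Finset.mem_compl, Finset.mem_singleton, mem_multSet,
    and_assoc]

theorem card_multSet [Fact p.Prime] : (multSet p).card = p := card_prime_dvd

theorem card_primPairs [Fact p.Prime] : ((primPairs p).card : ℂ) = (p : ℂ) ^ 4 - p ^ 2 := by
  have h : primPairs p = (multSet p ×ˢ multSet p)ᶜ := by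
    ext a; simp [mem_primPairs, mem_multSet]
  have h2 := Finset.card_compl_add_card (multSet p ×ˢ multSet p)
  rw [← h, Finset.card_product, card_multSet, Fintype.card_prod, ZMod.card] at h2
  have h3 := congrArg (Nat.cast : ℕ → ℂ) h2
  push_cast at h3
  linear_combination h3

theorem card_baseVecs [hp : Fact p.Prime] : ((baseVecs p).card : ℂ) = (p : ℂ) ^ 3 * (p - 1) := by
  have h2 := Finset.card_compl_add_card (multSet p)
  rw [card_multSet, ZMod.card] at h2
  have h3 := congrArg (Nat.cast : ℕ → ℂ) h2
  simp only [baseVecs, Finset.card_product, card_multSet, Finset.card_singleton]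
  push_cast at h3 ⊢
  linear_combination (p : ℂ) ^ 2 * h3

open Classical in
-- A unit coordinate of y lets the equation be solved for the matching coordinate of x, which is
-- then automatically a multiple of p; the other coordinate of x is a free multiple of p.
theorem card_orthogonal [Fact p.Prime] {y : ZMod (p ^ 2) × ZMod (p ^ 2)} (hy : y ∈ primPairs p) :
    ((multSet p ×ˢ multSet p).filter fun x => x.1 * y.1 + x.2 * y.2 = 0).card = p := by
  rw [mem_primPairs, not_and_or, ← isUnit_iff_not_prime_dvd, ← isUnit_iff_not_prime_dvd] at hy
  rcases hy with hy | hy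
  · obtain ⟨u, hu⟩ := hy.exists_right_inv
    conv_rhs => rw [← card_multSet (p := p)]
    refine Finset.card_nbij' (fun x => x.2) (fun b => (-b * y.2 * u, b)) ?_ ?_ ?_ ?_
    · intro x hx
      simp only [Finset.coe_filter, Finset.mem_product, Set.mem_ofPred_eq] at hx
      exact hx.1.2
    · intro b hb
      simp only [Finset.mem_coe, mem_multSet, Finset.coe_filter, Finset.mem_product,
        Set.mem_ofPred_eq] at hb ⊢
      refine ⟨⟨(hb.neg_right.mul_right _).mul_right _, hb⟩, ?_⟩
      linear_combination -b * y.2 * hu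
    · intro x hx
      simp only [Finset.coe_filter, Finset.mem_product, Set.mem_ofPred_eq] at hx
      ext
      · simp only
        linear_combination -u * hx.2 + x.1 * hu
      · rfl
    · intro b _; rfl
  · obtain ⟨u, hu⟩ := hy.exists_right_inv
    conv_rhs => rw [← card_multSet (p := p)]
    refine Finset.card_nbij' (fun x => x.1) (fun b => (b, -b * y.1 * u)) ?_ ?_ ?_ ?_
    · intro x hx
      simp only [Finset.coe_filter, Finset.mem_product, Set.mem_ofPred_eq] at hx
      exact hx.1.1
    · intro b hb
      simp only [Finset.mem_coe, mem_multSet, Finset.coe_filter, Finset.mem_product,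
        Set.mem_ofPred_eq] at hb ⊢
      refine ⟨⟨hb, (hb.neg_right.mul_right _).mul_right _⟩, ?_⟩
      linear_combination -b * y.1 * hu
    · intro x hx
      simp only [Finset.coe_filter, Finset.mem_product, Set.mem_ofPred_eq] at hx
      ext
      · rfl
      · simp only
        linear_combination -u * hx.2 + x.2 * hu
    · intro b _; rfl

open Classical in
/-- A sum over the primitive vectors modulo `p²`, according to their position relative to the
standard Lagrangian. -/
theorem sum_primVecs [Fact p.Prime] (g₁ g₂ g₃ : ℂ) :
    ∑ v ∈ primVecs p, (if v.1 ∈ primPairs p then g₃ else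
      if v.1.1 * v.2.1 + v.1.2 * v.2.2 = 0 then g₁ else g₂) =
    (p : ℂ) ^ 3 * (p - 1) * ((p + 1) * g₁ + (p ^ 2 - 1) * g₂ + (p ^ 4 + p ^ 3) * g₃) := by
  -- Either x is primitive and y is arbitrary, or x is a multiple of p and y is primitive; in the
  -- second case p of the p² choices of x are orthogonal to y.
  have hsplit : primVecs p = (primPairs p ×ˢ Finset.univ) ∪
      ((multSet p ×ˢ multSet p) ×ˢ primPairs p) := by
    ext v
    simp only [primVecs, Finset.mem_filter, Finset.mem_univ, true_and, Finset.mem_union,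
      Finset.mem_product, mem_primPairs, mem_multSet, and_true]
    tauto
  have hdisj : Disjoint (primPairs p ×ˢ (Finset.univ : Finset (ZMod (p ^ 2) × ZMod (p ^ 2))))
      ((multSet p ×ˢ multSet p) ×ˢ primPairs p) := by
    rw [Finset.disjoint_left]
    intro v hv hv'
    simp only [Finset.mem_product, mem_primPairs, mem_multSet] at hv hv'
    exact hv.1 hv'.1
  rw [hsplit, Finset.sum_union hdisj]
  have s1 : ∑ v ∈ primPairs p ×ˢ (Finset.univ : Finset (ZMod (p ^ 2) × ZMod (p ^ 2))),
      (if v.1 ∈ primPairs p then g₃ else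
        if v.1.1 * v.2.1 + v.1.2 * v.2.2 = 0 then g₁ else g₂) =
      ((p : ℂ) ^ 4 - p ^ 2) * p ^ 4 * g₃ := by
    rw [Finset.sum_congr rfl (g := fun _ => g₃)
      (fun v hv => if_pos (Finset.mem_product.1 hv).1), Finset.sum_const, Finset.card_product,
      nsmul_eq_mul, Nat.cast_mul, card_primPairs, Finset.card_univ, Fintype.card_prod, ZMod.card]
    push_cast; ring
  have s2 : ∑ v ∈ (multSet p ×ˢ multSet p) ×ˢ primPairs p, (if v.1 ∈ primPairs p then g₃ else
        if v.1.1 * v.2.1 + v.1.2 * v.2.2 = 0 then g₁ else g₂) =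
      ((p : ℂ) ^ 4 - p ^ 2) * (p * g₁ + (p ^ 2 - p) * g₂) := by
    rw [Finset.sum_product_right,
      Finset.sum_congr rfl (g := fun _ => (p * g₁ + (p ^ 2 - p) * g₂)), Finset.sum_const,
      nsmul_eq_mul, card_primPairs]
    intro y hy
    have c1 := card_orthogonal hy
    have c2 := Finset.card_filter_add_card_filter_not (s := multSet p ×ˢ multSet p)
      (fun x => x.1 * y.1 + x.2 * y.2 = 0)
    rw [c1, Finset.card_product, card_multSet] at c2
    have c3 := congrArg (Nat.cast : ℕ → ℂ) c2
    push_cast at c3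
    rw [Finset.sum_congr rfl (g := fun x : ZMod (p ^ 2) × ZMod (p ^ 2) =>
        if x.1 * y.1 + x.2 * y.2 = 0 then g₁ else g₂)
      (fun x hx => if_neg (by
        simp only [Finset.mem_product, mem_multSet] at hx
        simp [mem_primPairs, hx])),
      Finset.sum_ite, Finset.sum_const, Finset.sum_const, c1, nsmul_eq_mul, nsmul_eq_mul]
    linear_combination g₂ * c3
  rw [s1, s2]
  ring

end ModSq

/-! ### Hecke cosets as translates of a set of primitive vectors. -/

section VecAction

variable {p : ℕ}

/-- Four residues modulo `p²`, as a row vector `(x₁ x₂ y₁ y₂)`. -/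
def vecOf (v : (ZMod (p ^ 2) × ZMod (p ^ 2)) × ZMod (p ^ 2) × ZMod (p ^ 2)) :
    Fin 2 ⊕ Fin 2 → ZMod (p ^ 2) :=
  Sum.elim ![v.1.1, v.1.2] ![v.2.1, v.2.2]

/-- The right action of `Sp₂(ℤ)` on row vectors modulo `p²`. -/
def actVec (v : (ZMod (p ^ 2) × ZMod (p ^ 2)) × ZMod (p ^ 2) × ZMod (p ^ 2)) (γ : Sp ℤ) :
    (ZMod (p ^ 2) × ZMod (p ^ 2)) × ZMod (p ^ 2) × ZMod (p ^ 2) :=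
  let w := vecOf v ᵥ* γ.1.map (Int.castRingHom (ZMod (p ^ 2)))
  ((w (.inl 0), w (.inl 1)), w (.inr 0), w (.inr 1))

theorem vecOf_actVec (v : (ZMod (p ^ 2) × ZMod (p ^ 2)) × ZMod (p ^ 2) × ZMod (p ^ 2))
    (γ : Sp ℤ) : vecOf (actVec v γ) = vecOf v ᵥ* γ.1.map (Int.castRingHom (ZMod (p ^ 2))) := by
  funext j
  rcases j with j | j <;> fin_cases j <;> rfl

theorem vecOf_injective : Function.Injective (vecOf (p := p)) := by
  intro v v' h
  ext
  · exact congrFun h (.inl 0)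
  · exact congrFun h (.inl 1)
  · exact congrFun h (.inr 0)
  · exact congrFun h (.inr 1)

theorem actVec_mul (v : (ZMod (p ^ 2) × ZMod (p ^ 2)) × ZMod (p ^ 2) × ZMod (p ^ 2))
    (γ δ : Sp ℤ) : actVec v (γ * δ) = actVec (actVec v γ) δ := by
  apply vecOf_injective
  rw [vecOf_actVec, vecOf_actVec, vecOf_actVec, vecMul_vecMul, Submonoid.coe_mul, Matrix.map_mul]

theorem actVec_one (v : (ZMod (p ^ 2) × ZMod (p ^ 2)) × ZMod (p ^ 2) × ZMod (p ^ 2)) :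
    actVec v 1 = v := by
  apply vecOf_injective
  rw [vecOf_actVec]
  simp

theorem vecOf_actVec_apply (v : (ZMod (p ^ 2) × ZMod (p ^ 2)) × ZMod (p ^ 2) × ZMod (p ^ 2))
    (γ : Sp ℤ) (j : Fin 2 ⊕ Fin 2) : vecOf (actVec v γ) j =
      v.1.1 * γ.1 (.inl 0) j + v.1.2 * γ.1 (.inl 1) j +
        (v.2.1 * γ.1 (.inr 0) j + v.2.2 * γ.1 (.inr 1) j) := by
  rw [vecOf_actVec, vecMul, dotProduct, Fintype.sum_sum_type, Fin.sum_univ_two, Fin.sum_univ_two]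
  rfl

theorem mem_primVecs [Fact p.Prime]
    {v : (ZMod (p ^ 2) × ZMod (p ^ 2)) × ZMod (p ^ 2) × ZMod (p ^ 2)} :
    v ∈ primVecs p ↔ ¬ ∀ j, (p : ZMod (p ^ 2)) ∣ vecOf v j := by
  simp only [primVecs, Finset.mem_filter, Finset.mem_univ, true_and, mem_primPairs, Sum.forall,
    Fin.forall_fin_two]
  simp only [vecOf, Sum.elim_inl, Sum.elim_inr, cons_val_zero, cons_val_one]
  tauto

theorem actVec_mem_primVecs [Fact p.Prime]
    {v : (ZMod (p ^ 2) × ZMod (p ^ 2)) × ZMod (p ^ 2) × ZMod (p ^ 2)} (hv : v ∈ primVecs p)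
    (γ : Sp ℤ) : actVec v γ ∈ primVecs p := by
  rw [mem_primVecs] at hv ⊢
  intro h
  apply hv
  have h1 : v = actVec (actVec v γ) γ⁻¹ := by rw [← actVec_mul, mul_inv_cancel, actVec_one]
  intro j
  rw [h1, vecOf_actVec, vecMul, dotProduct]
  exact Finset.dvd_sum fun l _ => (h l).mul_right _

theorem baseVecs_subset_primVecs [Fact p.Prime] : baseVecs p ⊆ primVecs p := by
  intro f hf
  rw [mem_baseVecs] at hf
  rw [mem_primVecs]
  exact fun h => hf.1 (h (.inl 0))

theorem upperUnip_mem_Gamma0 {N : ℕ} (S : Matrix (Fin 2) (Fin 2) ℤ) (hS : S.IsSymm) :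
    upperUnip S hS ∈ Gamma0 N := fun i j => by simp

theorem levi_mem_Gamma0 {N : ℕ} (U V : Matrix (Fin 2) (Fin 2) ℤ) (h : Uᵀ * V = 1) :
    levi U V h ∈ Gamma0 N := fun i j => by simp

variable [hp : Fact p.Prime] {N : ℕ}

/-- The only condition modulo p² is the vanishing of the third coordinate. It persists because
multiples of p among the coordinates of f meet entries of the third column of η that are also
divisible by p. -/
theorem actVec_mem_baseVecs {η : Gamma0 N} (hη : η ∈ heckeSubgroup N p)
    {f : (ZMod (p ^ 2) × ZMod (p ^ 2)) × ZMod (p ^ 2) × ZMod (p ^ 2)} (hf : f ∈ baseVecs p) :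
    actVec f η.1 ∈ baseVecs p := by
  obtain ⟨h1, h2, h3⟩ := dvd_of_mem_heckeSubgroup hη
  obtain ⟨h0, h4, h5⟩ := dvd_col_of_dvd_row h1 ((dvd_pow_self _ two_ne_zero).trans h2) h3
  rw [← intCast_sq_eq_zero_iff] at h2
  rw [← prime_dvd_intCast_iff] at h0 h1 h3 h4 h5
  rw [mem_baseVecs] at hf ⊢
  obtain ⟨f0, f1, f2, f3⟩ := hf
  have e (j) := vecOf_actVec_apply f η.1 j
  simp only [f2, zero_mul, zero_add] at e
  refine ⟨fun h => ?_, ?_, ?_, ?_⟩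
  · have e0 := e (.inl 0)
    have h' : (p : ZMod (p ^ 2)) ∣ vecOf (actVec f η.1) (.inl 0) := h
    rw [e0, add_assoc] at h'
    exact h0 (prime_dvd_of_dvd_mul_left f0
      ((dvd_add_left (dvd_add (f1.mul_right _) (f3.mul_right _))).1 h'))
  · have e0 := e (.inl 1)
    change _ ∣ vecOf (actVec f η.1) (.inl 1)
    rw [e0]
    exact dvd_add (dvd_add (h1.mul_left _) (f1.mul_right _)) (f3.mul_right _)
  · have e0 := e (.inr 0)
    change vecOf (actVec f η.1) (.inr 0) = 0
    rw [e0, h2, mul_eq_zero_of_prime_dvd f1 h4, mul_eq_zero_of_prime_dvd f3 h5]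
    ring
  · have e0 := e (.inr 1)
    change _ ∣ vecOf (actVec f η.1) (.inr 1)
    rw [e0]
    exact dvd_add (dvd_add (h3.mul_left _) (f1.mul_right _)) (f3.mul_right _)

/-- A single base vector staying in the set already forces η into the Hecke subgroup. This is what
makes translates by distinct cosets disjoint. -/
theorem mem_heckeSubgroup_of_actVec (hpN : p.Coprime N) {η : Gamma0 N}
    {f : (ZMod (p ^ 2) × ZMod (p ^ 2)) × ZMod (p ^ 2) × ZMod (p ^ 2)} (hf : f ∈ baseVecs p)
    (hfη : actVec f η.1 ∈ baseVecs p) : η ∈ heckeSubgroup N p := by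
  rw [mem_baseVecs] at hf hfη
  obtain ⟨f0, f1, f2, f3⟩ := hf
  obtain ⟨-, g1, g2, g3⟩ := hfη
  have e (j) := vecOf_actVec_apply f η.1 j
  simp only [f2, zero_mul, zero_add] at e
  have key {j} (h : (p : ZMod (p ^ 2)) ∣ vecOf (actVec f η.1) j) :
      (p : ℤ) ∣ η.1.1 (.inl 0) j := by
    rw [e, add_assoc] at h
    exact (prime_dvd_intCast_iff _).1 (prime_dvd_of_dvd_mul_left f0
      ((dvd_add_left (dvd_add (f1.mul_right _) (f3.mul_right _))).1 h))
  have h1 := key (j := .inl 1) g1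
  have h3 := key (j := .inr 1) g3
  have hzero : vecOf (actVec f η.1) (.inr 0) = 0 := g2
  have h2 := key (j := .inr 0) (by rw [hzero]; exact dvd_zero _)
  obtain ⟨-, h4, h5⟩ := dvd_col_of_dvd_row h1 h2 h3
  rw [← prime_dvd_intCast_iff] at h4 h5
  refine mem_heckeSubgroup_of_dvd hpN η h1 ?_ h3
  rw [e, mul_eq_zero_of_prime_dvd f1 h4, mul_eq_zero_of_prime_dvd f3 h5, add_zero, add_zero] at hzero
  rw [← intCast_sq_eq_zero_iff]
  exact (((isUnit_iff_not_prime_dvd _).2 f0).mul_right_eq_zero).1 hzero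

/-- Every primitive vector is moved by `Γ₀(N)` to the set of the trivial Hecke coset. -/
theorem exists_actVec_mem_baseVecs (hpN : p.Coprime N)
    {v : (ZMod (p ^ 2) × ZMod (p ^ 2)) × ZMod (p ^ 2) × ZMod (p ^ 2)} (hv : v ∈ primVecs p) :
    ∃ γ ∈ Gamma0 N, actVec v γ ∈ baseVecs p := by
  -- first coordinate a unit
  have s1 : ∀ v : (ZMod (p ^ 2) × ZMod (p ^ 2)) × ZMod (p ^ 2) × ZMod (p ^ 2),
      ¬ (p : ZMod (p ^ 2)) ∣ v.1.1 → ∃ γ ∈ Gamma0 N, actVec v γ ∈ baseVecs p := by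
    intro v hv
    obtain ⟨u, hu⟩ := ((isUnit_iff_not_prime_dvd _).2 hv).exists_right_inv
    -- The unit first coordinate is a pivot: a unipotent Levi element clears the second coordinate,
    -- then an upper unipotent element clears the last two.
    obtain ⟨t, ht⟩ := ZMod.intCast_surjective (-v.1.2 * u)
    have hl : !![1, t; 0, 1]ᵀ * !![1, 0; -t, 1] = 1 := by
      ext i j; fin_cases i <;> fin_cases j <;> simp [Matrix.mul_apply]
    set w := actVec v (levi _ _ hl) with hw
    have e (j) := vecOf_actVec_apply v (levi _ _ hl) j
    have w0 : w.1.1 = v.1.1 := (e (.inl 0)).trans (by simp [levi])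
    have w1 : w.1.2 = 0 := (e (.inl 1)).trans (by
      simp [levi, ht]
      linear_combination -v.1.2 * hu)
    obtain ⟨b0, hb0⟩ := ZMod.intCast_surjective (-w.2.1 * u)
    obtain ⟨b1, hb1⟩ := ZMod.intCast_surjective (-w.2.2 * u)
    have hS : (!![b0, b1; b1, 0]).IsSymm := by
      ext i j; fin_cases i <;> fin_cases j <;> rfl
    refine ⟨levi _ _ hl * upperUnip _ hS,
      mul_mem (levi_mem_Gamma0 _ _ _) (upperUnip_mem_Gamma0 _ _), ?_⟩
    rw [actVec_mul, ← hw]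
    have e' (j) := vecOf_actVec_apply w (upperUnip _ hS) j
    have z0 : (actVec w (upperUnip _ hS)).1.1 = v.1.1 :=
      (e' (.inl 0)).trans (by simp [upperUnip, w0])
    have z1 : (actVec w (upperUnip _ hS)).1.2 = 0 :=
      (e' (.inl 1)).trans (by simp [upperUnip, w1])
    have z2 : (actVec w (upperUnip _ hS)).2.1 = 0 :=
      (e' (.inr 0)).trans (by
        simp [upperUnip, w0, w1, hb0]
        linear_combination -w.2.1 * hu)
    have z3 : (actVec w (upperUnip _ hS)).2.2 = 0 :=
      (e' (.inr 1)).trans (by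
        simp [upperUnip, w0, w1, hb1]
        linear_combination -w.2.2 * hu)
    rw [mem_baseVecs, z0, z1, z2, z3]
    exact ⟨hv, dvd_zero _, rfl, dvd_zero _⟩
  -- the first half primitive
  have s2 : ∀ v : (ZMod (p ^ 2) × ZMod (p ^ 2)) × ZMod (p ^ 2) × ZMod (p ^ 2),
      v.1 ∈ primPairs p → ∃ γ ∈ Gamma0 N, actVec v γ ∈ baseVecs p := by
    intro v hv
    by_cases h0 : (p : ZMod (p ^ 2)) ∣ v.1.1
    · have h1 : ¬ (p : ZMod (p ^ 2)) ∣ v.1.2 := fun h => mem_primPairs.1 hv ⟨h0, h⟩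
      have hl : !![(1 : ℤ), 0; 1, 1]ᵀ * !![1, -1; 0, 1] = 1 := by
        ext i j; fin_cases i <;> fin_cases j <;> simp [Matrix.mul_apply]
      have e : (actVec v (levi _ _ hl)).1.1 = v.1.1 + v.1.2 :=
        (vecOf_actVec_apply v (levi _ _ hl) (.inl 0)).trans (by simp [levi])
      obtain ⟨γ, hγ, h⟩ := s1 (actVec v (levi _ _ hl)) (by
        rw [e, dvd_add_right h0]; exact h1)
      exact ⟨levi _ _ hl * γ, mul_mem (levi_mem_Gamma0 _ _ _) hγ, by rwa [actVec_mul]⟩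
    · exact s1 v h0
  by_cases h0 : v.1 ∈ primPairs p
  · exact s2 v h0
  · have hv2 : v.2 ∈ primPairs p := by
      simp only [primVecs, Finset.mem_filter, Finset.mem_univ, true_and] at hv
      exact hv.resolve_left h0
    rw [mem_primPairs, not_not] at h0
    -- The lower unipotent element with block N·I lies in Γ₀(N) and replaces x by x + N y. As x is
    -- divisible by p and N is a unit modulo p, the new first half is primitive.
    have hS : (diagonal fun _ : Fin 2 => (N : ℤ)).IsSymm := by simp [IsSymm]
    have hmem : lowerUnip _ hS ∈ Gamma0 N := by
      intro i j
      rw [blkC_lowerUnip, diagonal_apply]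
      split_ifs <;> simp
    have e0 : (actVec v (lowerUnip _ hS)).1.1 = v.1.1 + N * v.2.1 :=
      (vecOf_actVec_apply v _ (.inl 0)).trans (by simp [lowerUnip, mul_comm])
    have e1 : (actVec v (lowerUnip _ hS)).1.2 = v.1.2 + N * v.2.2 :=
      (vecOf_actVec_apply v _ (.inl 1)).trans (by simp [lowerUnip, mul_comm])
    have hNp : ¬ (p : ZMod (p ^ 2)) ∣ (N : ZMod (p ^ 2)) := by
      intro h
      have h1 := (prime_dvd_intCast_iff (p := p) (N : ℤ)).1 (by exact_mod_cast h)
      exact (hp.out.coprime_iff_not_dvd.1 hpN) (by exact_mod_cast h1)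
    obtain ⟨γ, hγ, h⟩ := s2 (actVec v (lowerUnip _ hS)) (by
      rw [mem_primPairs] at hv2 ⊢
      rw [e0, e1, dvd_add_right h0.1, dvd_add_right h0.2]
      exact fun h => hv2 ⟨prime_dvd_of_dvd_mul_left hNp h.1, prime_dvd_of_dvd_mul_left hNp h.2⟩)
    exact ⟨lowerUnip _ hS * γ, mul_mem hmem hγ, by rwa [actVec_mul]⟩

open Classical in
/-- Summation over the Hecke cosets, via primitive vectors modulo `p²`. -/
theorem sum_heckeCosets_baseVecs [Fintype (HeckeCosets N p)] (hpN : p.Coprime N) (x : Sp ℤ)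
    (G : (ZMod (p ^ 2) × ZMod (p ^ 2)) × ZMod (p ^ 2) × ZMod (p ^ 2) → ℂ) :
    ∑ c : HeckeCosets N p, ∑ f ∈ baseVecs p, G (actVec f (c.out.1 * x⁻¹)) =
      ∑ v ∈ primVecs p, G v := by
  rw [← Finset.sum_product']
  refine Finset.sum_nbij (fun cf => actVec cf.2 (cf.1.out.1 * x⁻¹)) ?_ ?_ ?_ (fun _ _ => rfl)
  · rintro ⟨c, f⟩ hf
    exact actVec_mem_primVecs (baseVecs_subset_primVecs (Finset.mem_product.1 hf).2) _
  · rintro ⟨c, f⟩ hf ⟨c', f'⟩ hf' h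
    have hf := (Finset.mem_product.1 hf).2
    have hf' := (Finset.mem_product.1 hf').2
    simp only at hf hf' h
    have h1 : actVec f (c.out * c'.out⁻¹ : Gamma0 N).1 = f' := by
      have h2 := congrArg (fun v => actVec v (x * (c'.out.1)⁻¹)) h
      simp only [← actVec_mul] at h2
      rw [show c'.out.1 * x⁻¹ * (x * (c'.out.1)⁻¹) = 1 by group, actVec_one] at h2
      rw [← h2]
      congr 1
      rw [Subgroup.coe_mul, Subgroup.coe_inv]
      group
    have h3 := mem_heckeSubgroup_of_actVec hpN hf (h1 ▸ hf')
    have h4 : c' = c := by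
      rw [← c.out_eq, ← c'.out_eq]
      exact Quotient.sound (QuotientGroup.rightRel_apply.2 h3)
    subst h4
    rw [mul_inv_cancel] at h1
    have h5 : f = f' := (actVec_one f).symm.trans h1
    rw [h5]
  · intro v hv
    -- Surjectivity: v x is moved into the base set by some γ, and the coset of γ⁻¹ is the one whose
    -- translate contains v.
    obtain ⟨γ, hγ, h⟩ := exists_actVec_mem_baseVecs hpN (actVec_mem_primVecs hv x)
    set γ₀ : Gamma0 N := ⟨γ, hγ⟩⁻¹ with hγ₀
    let c : HeckeCosets N p := Quotient.mk _ γ₀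
    have hc : γ₀ * c.out⁻¹ ∈ heckeSubgroup N p :=
      QuotientGroup.rightRel_apply.1 (Quotient.mk_out γ₀)
    refine ⟨(c, actVec (actVec (actVec v x) γ) (γ₀ * c.out⁻¹ : Gamma0 N).1), ?_, ?_⟩
    · exact Finset.mem_product.2 ⟨Finset.mem_univ _, actVec_mem_baseVecs hc h⟩
    · simp only [← actVec_mul]
      have : x * γ * (γ₀ * c.out⁻¹ : Gamma0 N).1 * (c.out.1 * x⁻¹) = 1 := by
        rw [hγ₀, Subgroup.coe_mul, Subgroup.coe_inv, Subgroup.coe_inv]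
        group
      rw [this, actVec_one]

end VecAction

/-! ### A bound for the number of divisors. -/

section DivisorBound

/-- The ratio (e + 1)⁴ / 2^e is largest at e = 5, where it equals 40.5. -/
theorem succ_pow_four_le_two_pow (e : ℕ) : (e + 1) ^ 4 ≤ 41 * 2 ^ e := by
  rcases lt_or_ge e 5 with h | h
  · interval_cases e <;> norm_num
  · induction e, h using Nat.le_induction with
    | base => norm_num
    | succ n hn ih =>
      obtain ⟨m, rfl⟩ := Nat.exists_eq_add_of_le hn
      calc (5 + m + 1 + 1) ^ 4 ≤ 2 * (5 + m + 1) ^ 4 := by ring_nf; nlinarith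
        _ ≤ 2 * (41 * 2 ^ (5 + m)) := Nat.mul_le_mul_left 2 ih
        _ = _ := by ring

/-- Both sides are compared prime by prime. For q ≥ 16 one has (e + 1)⁴ ≤ 16^e ≤ q^e, so the
constant 41 is spent only on primes below 16, of which there are at most sixteen. -/
theorem card_divisors_pow_four_le {n : ℕ} (hn : n ≠ 0) : n.divisors.card ^ 4 ≤ 41 ^ 16 * n := by
  rw [Nat.card_divisors hn, ← Finset.prod_pow]
  have h1 : ∀ q ∈ n.primeFactors, (n.factorization q + 1) ^ 4 ≤
      (if q < 16 then 41 else 1) * q ^ n.factorization q := by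
    intro q hq
    have hq2 := (Nat.prime_of_mem_primeFactors hq).two_le
    split_ifs with h
    · exact (succ_pow_four_le_two_pow _).trans
        (Nat.mul_le_mul_left _ (Nat.pow_le_pow_left hq2 _))
    · calc (n.factorization q + 1) ^ 4 ≤ (2 ^ n.factorization q) ^ 4 :=
            Nat.pow_le_pow_left (Nat.lt_two_pow_self) 4
        _ = 16 ^ n.factorization q := by rw [← pow_mul, mul_comm, pow_mul]; norm_num
        _ ≤ q ^ n.factorization q := Nat.pow_le_pow_left (not_lt.1 h) _
        _ = _ := (one_mul _).symm
  refine (Finset.prod_le_prod' h1).trans ?_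
  rw [Finset.prod_mul_distrib]
  have h2 : ∏ q ∈ n.primeFactors, q ^ n.factorization q = n := Nat.prod_factorization_pow_eq_self hn
  rw [h2]
  refine Nat.mul_le_mul_right _ ?_
  rw [Finset.prod_ite, Finset.prod_const, Finset.prod_const_one, mul_one]
  refine Nat.pow_le_pow_right (by norm_num) ?_
  calc _ ≤ (Finset.range 16).card := Finset.card_le_card fun q hq => by
        simpa using (Finset.mem_filter.1 hq).2
    _ = 16 := Finset.card_range 16

theorem card_divisors_le_rpow {n : ℕ} {r : ℝ} (hr : 0 ≤ r) (hnr : (n : ℝ) ≤ 2 * r ^ 2) :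
    (n.divisors.card : ℝ) ≤ 41 ^ 4 * 2 * r ^ (1 / 2 : ℝ) := by
  rcases eq_or_ne n 0 with rfl | hn
  · simp; positivity
  have h := card_divisors_pow_four_le hn
  have h1 : ((n.divisors.card : ℝ)) ^ 4 ≤ (41 ^ 4 * 2 * r ^ (1 / 2 : ℝ)) ^ 4 := by
    have h2 : (r ^ (1 / 2 : ℝ)) ^ 4 = r ^ 2 := by
      rw [← Real.rpow_natCast, ← Real.rpow_mul hr]; norm_num
    rw [mul_pow, h2]
    have h3 : ((n.divisors.card ^ 4 : ℕ) : ℝ) ≤ ((41 ^ 16 * n : ℕ) : ℝ) := by exact_mod_cast h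
    push_cast at h3
    nlinarith [sq_nonneg r]
  exact le_of_pow_le_pow_left₀ (by norm_num) (by positivity) h1

end DivisorBound

/-! ### Convergence of the sum of ‖n‖⁻⁴ over the integral quadric. -/

section LatticeSums

theorem summable_norm_rpow_fin_three {r : ℝ} (hr : r < -3) :
    Summable fun t : Fin 3 → ℤ => ‖t‖ ^ r := by
  let L : Submodule ℤ (Fin 3 → ℝ) := Submodule.span ℤ (Set.range (Pi.basisFun ℝ (Fin 3)))
  have hfin : Module.finrank ℤ L = 3 := by
    rw [ZLattice.rank ℝ L]; simp
  have h1 := ZLattice.summable_norm_rpow L r (by rw [hfin]; exact_mod_cast hr)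
  have hmem (t : Fin 3 → ℤ) : (fun i => (t i : ℝ)) ∈ L := by
    rw [Module.Basis.mem_span_iff_repr_mem]
    intro i
    simp
  let φ : (Fin 3 → ℤ) → L := fun t => ⟨fun i => (t i : ℝ), hmem t⟩
  have hφ : Function.Injective φ := by
    intro t t' h
    funext i
    have : (t i : ℝ) = t' i := congrFun (congrArg Subtype.val h) i
    exact_mod_cast this
  refine (h1.comp_injective hφ).congr fun t => ?_
  simp only [Function.comp_apply, φ]
  congr 1

theorem summable_sigma_finset {T : Type} (S : T → Finset ℤ) {F : T → ℝ} (hF : ∀ t, 0 ≤ F t)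
    (h : Summable fun t => ((S t).card : ℝ) * F t) :
    Summable fun x : (Σ t, S t) => F x.1 := by
  rw [summable_sigma_of_nonneg fun x => hF x.1]
  refine ⟨fun t => .of_finite, h.congr fun t => ?_⟩
  simp [tsum_fintype]

/-- The integers dividing `n`, up to a factor two in cardinality. -/
def intDivisors (n : ℤ) : Finset ℤ :=
  n.natAbs.divisors.image (fun a : ℕ => (a : ℤ)) ∪ n.natAbs.divisors.image (fun a : ℕ => -(a : ℤ))

theorem card_intDivisors_le (n : ℤ) : (intDivisors n).card ≤ 2 * n.natAbs.divisors.card := by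
  rw [two_mul]
  exact (Finset.card_union_le _ _).trans (add_le_add Finset.card_image_le Finset.card_image_le)

theorem mem_intDivisors {n a : ℤ} (hn : n ≠ 0) (h : a ∣ n) : a ∈ intDivisors n := by
  have h1 : a.natAbs ∈ n.natAbs.divisors :=
    Nat.mem_divisors.2 ⟨Int.natAbs_dvd_natAbs.2 h, Int.natAbs_ne_zero.2 hn⟩
  rw [intDivisors, Finset.mem_union, Finset.mem_image, Finset.mem_image]
  rcases Int.natAbs_eq a with h2 | h2
  · exact Or.inl ⟨_, h1, h2.symm⟩
  · exact Or.inr ⟨_, h1, h2.symm⟩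

theorem abs_apply_le_norm {m : ℕ} (t : Fin m → ℤ) (i : Fin m) : |(t i : ℝ)| ≤ ‖t‖ :=
  norm_le_pi_norm t i

theorem norm_pos_of_ne_zero {m : ℕ} {t : Fin m → ℤ} (h : t ≠ 0) : 0 < ‖t‖ := norm_pos_iff.2 h

theorem natAbs_form_le (t : Fin 3 → ℤ) :
    ((t 0 * t 1 - t 2 ^ 2).natAbs : ℝ) ≤ 2 * ‖t‖ ^ 2 := by
  rw [Nat.cast_natAbs, Int.cast_abs]
  push_cast
  have h0 := abs_apply_le_norm t 0
  have h1 := abs_apply_le_norm t 1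
  have h2 := abs_apply_le_norm t 2
  calc |(t 0 : ℝ) * t 1 - t 2 ^ 2| ≤ |(t 0 : ℝ) * t 1| + |(t 2 : ℝ) ^ 2| := abs_sub _ _
    _ = |(t 0 : ℝ)| * |(t 1 : ℝ)| + |(t 2 : ℝ)| ^ 2 := by rw [abs_mul, abs_pow]
    _ ≤ ‖t‖ * ‖t‖ + ‖t‖ ^ 2 := by gcongr
    _ = _ := by ring

theorem summable_card_intDivisors :
    Summable fun t : Fin 3 → ℤ =>
      ((intDivisors (t 0 * t 1 - t 2 ^ 2)).card : ℝ) * ‖t‖ ^ (-4 : ℝ) := by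
  -- The divisor bound costs a factor ‖t‖^(1/2), and -4 + 1/2 = -7/2 is still below -3.
  refine Summable.of_nonneg_of_le (fun t => by positivity) (fun t => ?_)
    ((summable_norm_rpow_fin_three (r := -(7 / 2)) (by norm_num)).mul_left (2 * (41 ^ 4 * 2)))
  rcases eq_or_ne t 0 with rfl | ht
  · simp [intDivisors]
  have hpos := norm_pos_of_ne_zero ht
  have h1 : ((intDivisors (t 0 * t 1 - t 2 ^ 2)).card : ℝ) ≤
      2 * (41 ^ 4 * 2 * ‖t‖ ^ (1 / 2 : ℝ)) := by
    refine (Nat.cast_le.2 (card_intDivisors_le _)).trans ?_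
    push_cast
    exact mul_le_mul_of_nonneg_left
      (card_divisors_le_rpow (norm_nonneg t) (natAbs_form_le t)) (by norm_num)
  calc _ ≤ 2 * (41 ^ 4 * 2 * ‖t‖ ^ (1 / 2 : ℝ)) * ‖t‖ ^ (-4 : ℝ) := by gcongr
    _ = 2 * (41 ^ 4 * 2) * (‖t‖ ^ (1 / 2 : ℝ) * ‖t‖ ^ (-4 : ℝ)) := by ring
    _ = _ := by rw [← Real.rpow_add hpos]; norm_num

/-- The nonzero integral points of the quadric `x₀ x₁ = x₂ x₃ - x₄²`. -/
abbrev QuadricPoint : Type := {n : Fin 5 → ℤ // n ≠ 0 ∧ n 0 * n 1 = n 2 * n 3 - n 4 ^ 2}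

theorem norm_le_norm_of_forall_le {l m : ℕ} {t : Fin l → ℤ} {n : Fin m → ℤ}
    (h : ∀ i, |(t i : ℝ)| ≤ ‖n‖) : ‖t‖ ≤ ‖n‖ :=
  (pi_norm_le_iff_of_nonneg (norm_nonneg n)).2 h

/-- Such a point is determined by the triple (n₂, n₃, n₄) and the divisor n₀ of n₂ n₃ - n₄² ≠ 0. The
triple is nonzero and its norm is at most ‖n‖. -/
theorem summable_quadric_of_ne_zero :
    Summable fun n : {n : QuadricPoint | n.1 0 * n.1 1 ≠ 0} => ‖n.1.1‖ ^ (-4 : ℝ) := by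
  have key := summable_sigma_finset (fun t : Fin 3 → ℤ => intDivisors (t 0 * t 1 - t 2 ^ 2))
    (F := fun t => ‖t‖ ^ (-4 : ℝ)) (fun t => by positivity) summable_card_intDivisors
  let φ : {n : QuadricPoint | n.1 0 * n.1 1 ≠ 0} →
      Σ t : Fin 3 → ℤ, intDivisors (t 0 * t 1 - t 2 ^ 2) := fun n =>
    ⟨![n.1.1 2, n.1.1 3, n.1.1 4], n.1.1 0, by
      have h := n.1.2.2
      have h' : n.1.1 0 * n.1.1 1 ≠ 0 := n.2
      refine mem_intDivisors ?_ ⟨n.1.1 1, ?_⟩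
      · simpa [← h] using h'
      · simpa using h.symm⟩
  have hφ : Function.Injective φ := by
    rintro ⟨⟨n, hn⟩, hn'⟩ ⟨⟨m, hm⟩, hm'⟩ h
    have h1 : ![n 2, n 3, n 4] = ![m 2, m 3, m 4] := congrArg Sigma.fst h
    have h2 : n 0 = m 0 := congrArg (fun x => (x.2 : ℤ)) h
    have e2 : n 2 = m 2 := congrFun h1 0
    have e3 : n 3 = m 3 := congrFun h1 1
    have e4 : n 4 = m 4 := congrFun h1 2
    have h0 : n 0 ≠ 0 := left_ne_zero_of_mul (show n 0 * n 1 ≠ 0 from hn')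
    have e1 : n 1 = m 1 := by
      apply mul_left_cancel₀ h0
      rw [hn.2, e2, e3, e4, ← hm.2, h2]
    apply Subtype.ext
    apply Subtype.ext
    funext i
    fin_cases i <;> assumption
  refine Summable.of_nonneg_of_le (fun n => by positivity) (fun n => ?_) (key.comp_injective hφ)
  have ht : ![n.1.1 2, n.1.1 3, n.1.1 4] ≠ 0 := by
    intro h
    have e2 : n.1.1 2 = 0 := congrFun h 0
    have e4 : n.1.1 4 = 0 := congrFun h 2
    have h' : n.1.1 0 * n.1.1 1 ≠ 0 := n.2
    rw [n.1.2.2, e2, e4] at h'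
    simp at h'
  refine Real.rpow_le_rpow_of_nonpos (norm_pos_of_ne_zero ht) ?_ (by norm_num)
  refine norm_le_norm_of_forall_le fun i => ?_
  fin_cases i
  · exact abs_apply_le_norm _ 2
  · exact abs_apply_le_norm _ 3
  · exact abs_apply_le_norm _ 4

/-- Here n₄² = n₂ n₃, and n₀ or n₁ vanishes. So (n₀ + n₁, n₂, n₃) determines the point up to whether
n₀ = 0 and the sign of n₄, which are recorded by the labels 0 to 3. -/
theorem summable_quadric_of_eq_zero :
    Summable fun n : ({n : QuadricPoint | n.1 0 * n.1 1 ≠ 0}ᶜ : Set QuadricPoint) =>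
      ‖n.1.1‖ ^ (-4 : ℝ) := by
  have key := summable_sigma_finset (fun _ : Fin 3 → ℤ => ({0, 1, 2, 3} : Finset ℤ))
    (F := fun t => ‖t‖ ^ (-4 : ℝ)) (fun t => by positivity)
    ((summable_norm_rpow_fin_three (by norm_num)).mul_left _)
  have hz (n : ({n : QuadricPoint | n.1 0 * n.1 1 ≠ 0}ᶜ : Set QuadricPoint)) :
      n.1.1 0 = 0 ∨ n.1.1 1 = 0 := by
    have : ¬ (n.1.1 0 * n.1.1 1 ≠ 0) := n.2
    exact mul_eq_zero.1 (not_not.1 this)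
  have hq (n : ({n : QuadricPoint | n.1 0 * n.1 1 ≠ 0}ᶜ : Set QuadricPoint)) :
      n.1.1 4 ^ 2 = n.1.1 2 * n.1.1 3 := by
    have h1 := n.1.2.2
    rw [mul_eq_zero.2 (hz n)] at h1
    linarith
  let φ : ({n : QuadricPoint | n.1 0 * n.1 1 ≠ 0}ᶜ : Set QuadricPoint) →
      Σ _ : Fin 3 → ℤ, ({0, 1, 2, 3} : Finset ℤ) := fun n =>
    ⟨![n.1.1 0 + n.1.1 1, n.1.1 2, n.1.1 3],
      if n.1.1 0 = 0 then (if 0 ≤ n.1.1 4 then 0 else 1) else (if 0 ≤ n.1.1 4 then 2 else 3), by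
        split_ifs <;> simp⟩
  have hφ : Function.Injective φ := by
    intro n m h
    have h1 : ![n.1.1 0 + n.1.1 1, n.1.1 2, n.1.1 3] = ![m.1.1 0 + m.1.1 1, m.1.1 2, m.1.1 3] :=
      congrArg Sigma.fst h
    have h2 : (if n.1.1 0 = 0 then (if 0 ≤ n.1.1 4 then (0 : ℤ) else 1) else
        (if 0 ≤ n.1.1 4 then 2 else 3)) = (if m.1.1 0 = 0 then (if 0 ≤ m.1.1 4 then 0 else 1) else
        (if 0 ≤ m.1.1 4 then 2 else 3)) := congrArg (fun x => (x.2 : ℤ)) h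
    have e01 : n.1.1 0 + n.1.1 1 = m.1.1 0 + m.1.1 1 := congrFun h1 0
    have e2 : n.1.1 2 = m.1.1 2 := congrFun h1 1
    have e3 : n.1.1 3 = m.1.1 3 := congrFun h1 2
    have hs : n.1.1 4 ^ 2 = m.1.1 4 ^ 2 := by rw [hq, hq, e2, e3]
    have hzn := hz n
    have hzm := hz m
    have e0 : n.1.1 0 = m.1.1 0 := by split_ifs at h2 <;> omega
    have e1 : n.1.1 1 = m.1.1 1 := by omega
    have e4 : n.1.1 4 = m.1.1 4 := by
      rcases sq_eq_sq_iff_eq_or_eq_neg.1 hs with h | h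
      · exact h
      · split_ifs at h2 <;> omega
    apply Subtype.ext
    apply Subtype.ext
    funext i
    fin_cases i <;> assumption
  refine Summable.of_nonneg_of_le (fun n => by positivity) (fun n => ?_) (key.comp_injective hφ)
  have ht : ![n.1.1 0 + n.1.1 1, n.1.1 2, n.1.1 3] ≠ 0 := by
    intro h
    have e0 : n.1.1 0 + n.1.1 1 = 0 := congrFun h 0
    have e2 : n.1.1 2 = 0 := congrFun h 1
    have e3 : n.1.1 3 = 0 := congrFun h 2
    have e4 := hq n
    rw [e2, zero_mul, sq_eq_zero_iff] at e4
    have hzn := hz n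
    have e0' : n.1.1 0 = 0 := by omega
    have e1' : n.1.1 1 = 0 := by omega
    apply n.1.2.1
    funext i
    fin_cases i <;> assumption
  refine Real.rpow_le_rpow_of_nonpos (norm_pos_of_ne_zero ht) ?_ (by norm_num)
  refine norm_le_norm_of_forall_le fun i => ?_
  fin_cases i
  · change |((n.1.1 0 + n.1.1 1 : ℤ) : ℝ)| ≤ _
    rcases hz n with h | h
    · rw [h, zero_add]; exact abs_apply_le_norm _ 1
    · rw [h, add_zero]; exact abs_apply_le_norm _ 0
  · exact abs_apply_le_norm _ 2
  · exact abs_apply_le_norm _ 3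

theorem summable_quadric : Summable fun n : QuadricPoint => ‖n.1‖ ^ (-4 : ℝ) :=
  summable_subtype_and_compl.1 ⟨summable_quadric_of_ne_zero, summable_quadric_of_eq_zero⟩

end LatticeSums

/-! ### Maximal minors of the lower half as coordinates of a coset. -/

section Plucker

variable {R : Type} [CommRing R]

/-- The maximal minors of the lower half `(C D)`; the sixth one is minus the last. -/
def plucker (γ : Sp R) : Fin 5 → R :=
  ![blkC γ 0 0 * blkC γ 1 1 - blkC γ 0 1 * blkC γ 1 0,
    blkD γ 0 0 * blkD γ 1 1 - blkD γ 0 1 * blkD γ 1 0,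
    blkC γ 0 0 * blkD γ 1 1 - blkD γ 0 1 * blkC γ 1 0,
    blkD γ 0 0 * blkC γ 1 1 - blkC γ 0 1 * blkD γ 1 0,
    blkC γ 0 1 * blkD γ 1 1 - blkD γ 0 1 * blkC γ 1 1]

theorem isotropic_entries (γ : Sp R) : blkC γ 0 0 * blkD γ 1 0 + blkC γ 0 1 * blkD γ 1 1 =
    blkD γ 0 0 * blkC γ 1 0 + blkD γ 0 1 * blkC γ 1 1 := by
  have h := congrFun (congrFun (blkC_mul_transpose_blkD γ) 0) 1
  simpa only [Matrix.mul_apply, Fin.sum_univ_two, transpose_apply] using h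

theorem plucker_quadric (γ : Sp R) :
    plucker γ 0 * plucker γ 1 = plucker γ 2 * plucker γ 3 - plucker γ 4 ^ 2 := by
  have h := isotropic_entries γ
  simp only [plucker, cons_val_zero, cons_val_one, cons_val]
  linear_combination (blkC γ 0 1 * blkD γ 1 1 - blkD γ 0 1 * blkC γ 1 1) * h

/-- The minor of the lower half in the columns `j`, `k`. -/
def lowerMinor (γ : Sp R) (j k : Fin 2 ⊕ Fin 2) : R :=
  γ.1 (.inr 0) j * γ.1 (.inr 1) k - γ.1 (.inr 0) k * γ.1 (.inr 1) j

theorem lowerMinor_eq_of_plucker_eq {γ γ' : Sp R} (h : plucker γ' = plucker γ)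
    (j k : Fin 2 ⊕ Fin 2) : lowerMinor γ' j k = lowerMinor γ j k := by
  have h0 := congrFun h 0
  have h1 := congrFun h 1
  have h2 := congrFun h 2
  have h3 := congrFun h 3
  have h4 := congrFun h 4
  have i := isotropic_entries γ
  have i' := isotropic_entries γ'
  simp only [plucker, cons_val_zero, cons_val_one, cons_val, blkC, blkD, toBlocks₂₁, toBlocks₂₂,
    of_apply] at h0 h1 h2 h3 h4 i i'
  rcases j with j | j <;> rcases k with k | k <;> fin_cases j <;> fin_cases k <;>
    simp only [lowerMinor, Fin.zero_eta, Fin.mk_one]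
  · ring
  · linear_combination h0
  · linear_combination -h0
  · ring
  · linear_combination i' - i - h4
  · linear_combination h2
  · linear_combination -h3
  · linear_combination h4
  · linear_combination i - i' + h4
  · linear_combination h3
  · linear_combination -h2
  · linear_combination -h4
  · ring
  · linear_combination h1
  · linear_combination -h1
  · ring

/-- This is Cauchy–Binet for the lower half of γ' times the right half of γ⁻¹. Hence the determinant
depends on γ' only through its minors, and γ' = γ shows that the minors cannot all vanish. -/
theorem det_blkD_mul_inv (γ γ' : Sp R) : (blkD (γ' * γ⁻¹)).det =
    lowerMinor γ' (.inl 0) (.inl 1) * (blkB γ 0 0 * blkB γ 1 1 - blkB γ 1 0 * blkB γ 0 1) +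
    lowerMinor γ' (.inl 0) (.inr 0) * (blkB γ 1 0 * blkA γ 0 0 - blkB γ 0 0 * blkA γ 1 0) +
    lowerMinor γ' (.inl 0) (.inr 1) * (blkB γ 1 0 * blkA γ 0 1 - blkB γ 0 0 * blkA γ 1 1) +
    lowerMinor γ' (.inl 1) (.inr 0) * (blkB γ 1 1 * blkA γ 0 0 - blkB γ 0 1 * blkA γ 1 0) +
    lowerMinor γ' (.inl 1) (.inr 1) * (blkB γ 1 1 * blkA γ 0 1 - blkB γ 0 1 * blkA γ 1 1) +
    lowerMinor γ' (.inr 0) (.inr 1) * (blkA γ 0 0 * blkA γ 1 1 - blkA γ 1 0 * blkA γ 0 1) := by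
  rw [blkD_mul, blkB_inv, blkD_inv, det_fin_two]
  simp only [Matrix.add_apply, Matrix.mul_apply, Fin.sum_univ_two, transpose_apply,
    Matrix.neg_apply, lowerMinor, blkC, blkD, toBlocks₂₁, toBlocks₂₂, of_apply]
  ring

theorem plucker_ne_zero [Nontrivial R] (γ : Sp R) : plucker γ ≠ 0 := by
  intro h
  have h1 : (blkD (γ * γ⁻¹)).det = 1 := by rw [mul_inv_cancel, blkD_one, det_one]
  have i := isotropic_entries γ
  have h0 := congrFun h 0
  have h1' := congrFun h 1
  have h2 := congrFun h 2
  have h3 := congrFun h 3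
  have h4 := congrFun h 4
  simp only [plucker, cons_val_zero, cons_val_one, cons_val, blkC, blkD, toBlocks₂₁, toBlocks₂₂,
    of_apply, Pi.zero_apply] at h0 h1' h2 h3 h4 i
  rw [det_blkD_mul_inv] at h1
  have m1 : lowerMinor γ (.inl 0) (.inl 1) = 0 := by rw [lowerMinor]; linear_combination h0
  have m2 : lowerMinor γ (.inl 0) (.inr 0) = 0 := by rw [lowerMinor]; linear_combination i - h4
  have m3 : lowerMinor γ (.inl 0) (.inr 1) = 0 := by rw [lowerMinor]; linear_combination h2
  have m4 : lowerMinor γ (.inl 1) (.inr 0) = 0 := by rw [lowerMinor]; linear_combination -h3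
  have m5 : lowerMinor γ (.inl 1) (.inr 1) = 0 := by rw [lowerMinor]; linear_combination h4
  have m6 : lowerMinor γ (.inr 0) (.inr 1) = 0 := by rw [lowerMinor]; linear_combination h1'
  rw [m1, m2, m3, m4, m5, m6] at h1
  simp at h1

/-- Contracting the minors of γ' with the row j of γ gives ω₀ⱼ r₁ - ω₁ⱼ r₀, where r₀, r₁ are the
lower rows of γ'. The same contraction for γ vanishes by isotropy, and r₀, r₁ are independent, so ω
= 0. -/
theorem blkC_mul_inv_eq_zero_of_plucker_eq {γ γ' : Sp R} (h : plucker γ' = plucker γ) :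
    blkC (γ' * γ⁻¹) = 0 := by
  have hm := lowerMinor_eq_of_plucker_eq h
  -- `ω i j` pairs the rows of `γ'` and `γ`
  set ω := blkC (γ' * γ⁻¹) with hω
  have hωe (i j : Fin 2) : ω i j = γ'.1 (.inr i) (.inl 0) * γ.1 (.inr j) (.inr 0) +
      γ'.1 (.inr i) (.inl 1) * γ.1 (.inr j) (.inr 1) -
      (γ'.1 (.inr i) (.inr 0) * γ.1 (.inr j) (.inl 0) +
        γ'.1 (.inr i) (.inr 1) * γ.1 (.inr j) (.inl 1)) := by
    rw [hω, blkC_mul, blkA_inv, blkC_inv]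
    simp only [Matrix.add_apply, Matrix.mul_apply, Fin.sum_univ_two, transpose_apply,
      Matrix.neg_apply, blkC, blkD, toBlocks₂₁, toBlocks₂₂, of_apply]
    ring
  have iso (i j : Fin 2) : γ.1 (.inr i) (.inl 0) * γ.1 (.inr j) (.inr 0) +
      γ.1 (.inr i) (.inl 1) * γ.1 (.inr j) (.inr 1) -
      (γ.1 (.inr i) (.inr 0) * γ.1 (.inr j) (.inl 0) +
        γ.1 (.inr i) (.inr 1) * γ.1 (.inr j) (.inl 1)) = 0 := by
    have h1 := congrFun (congrFun (blkC_mul_transpose_blkD γ) i) j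
    simp only [Matrix.mul_apply, Fin.sum_univ_two, transpose_apply, blkC, blkD, toBlocks₂₁,
      toBlocks₂₂, of_apply] at h1
    linear_combination h1
  have hcon (j : Fin 2) (l : Fin 2 ⊕ Fin 2) :
      ω 0 j * γ'.1 (.inr 1) l - ω 1 j * γ'.1 (.inr 0) l = 0 := by
    have m1 := hm (.inl 0) l
    have m2 := hm (.inl 1) l
    have m3 := hm (.inr 0) l
    have m4 := hm (.inr 1) l
    simp only [lowerMinor] at m1 m2 m3 m4
    rw [hωe, hωe]
    linear_combination γ.1 (.inr j) (.inr 0) * m1 + γ.1 (.inr j) (.inr 1) * m2 -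
      γ.1 (.inr j) (.inl 0) * m3 - γ.1 (.inr j) (.inl 1) * m4 +
      γ.1 (.inr 1) l * iso 0 j - γ.1 (.inr 0) l * iso 1 j
  have hone (i k : Fin 2) : ∑ l, γ'.1 (.inr i) l * (γ'⁻¹).1 l (.inr k) =
      (1 : Matrix (Fin 2 ⊕ Fin 2) (Fin 2 ⊕ Fin 2) R) (.inr i) (.inr k) := by
    rw [← Matrix.mul_apply, ← Submonoid.coe_mul, mul_inv_cancel]; rfl
  have hsum (j k : Fin 2) : ω 0 j * (1 : Matrix (Fin 2 ⊕ Fin 2) (Fin 2 ⊕ Fin 2) R) (.inr 1) (.inr k)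
      - ω 1 j * (1 : Matrix (Fin 2 ⊕ Fin 2) (Fin 2 ⊕ Fin 2) R) (.inr 0) (.inr k) = 0 := by
    rw [← hone, ← hone, Finset.mul_sum, Finset.mul_sum, ← Finset.sum_sub_distrib]
    refine Finset.sum_eq_zero fun l _ => ?_
    linear_combination (γ'⁻¹).1 l (.inr k) * hcon j l
  ext i j
  fin_cases i
  · simpa using hsum j 1
  · simpa using hsum j 0

theorem mul_inv_mem_GammaInfPlus_of_plucker_eq {γ γ' : Sp ℤ} (h : plucker γ' = plucker γ) :
    γ' * γ⁻¹ ∈ GammaInfPlus := by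
  refine ⟨blkC_mul_inv_eq_zero_of_plucker_eq h, ?_⟩
  have h1 : (blkD (γ * γ⁻¹)).det = 1 := by rw [mul_inv_cancel, blkD_one, det_one]
  rw [det_blkD_mul_inv] at h1 ⊢
  simp only [lowerMinor_eq_of_plucker_eq h]
  exact h1

end Plucker

/-! ### A lower bound for the automorphy factor. -/

section LowerBound

/-- The linear form with `det (C τ + D) = plForm τ (plucker γ)`. -/
noncomputable def plForm (τ : Matrix (Fin 2) (Fin 2) ℂ) (m : Fin 5 → ℝ) : ℂ :=
  m 0 * (τ 0 0 * τ 1 1 - τ 0 1 ^ 2) + m 1 + m 2 * τ 0 0 + m 3 * τ 1 1 + 2 * m 4 * τ 0 1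

theorem det_autFactor {τ : Matrix (Fin 2) (Fin 2) ℂ} (hτ : τ.IsSymm) (γ : Sp ℝ) :
    (autFactor γ τ).det = plForm τ (plucker γ) := by
  have h10 : τ 1 0 = τ 0 1 := hτ.apply 0 1
  have i : (blkC γ 0 0 * blkD γ 1 0 + blkC γ 0 1 * blkD γ 1 1 : ℂ) =
      blkD γ 0 0 * blkC γ 1 0 + blkD γ 0 1 * blkC γ 1 1 := by
    exact_mod_cast congrArg (fun x : ℝ => (x : ℂ)) (isotropic_entries γ)
  rw [autFactor, det_fin_two, plForm]
  simp only [Matrix.add_apply, Matrix.mul_apply, Fin.sum_univ_two, map_apply, plucker,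
    cons_val_zero, cons_val_one, cons_val, h10]
  push_cast
  linear_combination -τ 0 1 * i

/-- Let Y be the positive definite matrix of the yᵢ. The determinant form on symmetric 2 × 2
matrices has signature (1, 2), so it is negative definite on the orthogonal complement of Y. The
matrix with entries u₁, u₂, u₃ lies there by `him`, yet has determinant a² det Y ≥ 0; hence it and a
vanish. -/
theorem eq_zero_of_quadric_of_form_eq_zero {a f g h b x1 x2 x3 y1 y2 y3 : ℝ} (hy1 : 0 < y1)
    (hy : 0 < y1 * y3 - y2 ^ 2) (hq : a * f = g * h - b ^ 2)
    (hre : a * (x1 * x3 - y1 * y3 - (x2 ^ 2 - y2 ^ 2)) + f + g * x1 + h * x3 + 2 * b * x2 = 0)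
    (him : a * (x1 * y3 + x3 * y1 - 2 * x2 * y2) + g * y1 + h * y3 + 2 * b * y2 = 0) :
    a = 0 ∧ f = 0 ∧ g = 0 ∧ h = 0 ∧ b = 0 := by
  have hy3 : 0 < y3 := by nlinarith [sq_nonneg y2]
  -- completing to a determinant
  obtain ⟨u1, hu1⟩ : ∃ u, u = a * x1 + h := ⟨_, rfl⟩
  obtain ⟨u3, hu3⟩ : ∃ u, u = a * x3 + g := ⟨_, rfl⟩
  obtain ⟨u2, hu2⟩ : ∃ u, u = a * x2 - b := ⟨_, rfl⟩
  have e1 : u1 * u3 - u2 ^ 2 = a ^ 2 * (y1 * y3 - y2 ^ 2) := by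
    rw [hu1, hu2, hu3]; linear_combination a * hre - hq
  have e2 : u1 * y3 + u3 * y1 = 2 * u2 * y2 := by
    rw [hu1, hu2, hu3]; linear_combination him
  have e3 : (u1 * y3 - u3 * y1) ^ 2 + 4 * (u1 * u3 - u2 ^ 2) * (y1 * y3) +
      4 * u2 ^ 2 * (y1 * y3 - y2 ^ 2) = 0 := by
    linear_combination (u1 * y3 + u3 * y1 + 2 * u2 * y2) * e2
  have hp : 0 < y1 * y3 := mul_pos hy1 hy3
  rw [e1] at e3
  have t1 : 0 ≤ 4 * (a ^ 2 * (y1 * y3 - y2 ^ 2)) * (y1 * y3) := by positivity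
  have t2 : 0 ≤ 4 * u2 ^ 2 * (y1 * y3 - y2 ^ 2) := by positivity
  have s1 : 4 * (a ^ 2 * (y1 * y3 - y2 ^ 2)) * (y1 * y3) = 0 := by
    linarith [sq_nonneg (u1 * y3 - u3 * y1)]
  have s2 : 4 * u2 ^ 2 * (y1 * y3 - y2 ^ 2) = 0 := by linarith [sq_nonneg (u1 * y3 - u3 * y1)]
  have s3 : (u1 * y3 - u3 * y1) ^ 2 = 0 := by linarith [sq_nonneg (u1 * y3 - u3 * y1)]
  have ha : a = 0 := by simpa [hy.ne', hp.ne', hy1.ne', hy3.ne'] using s1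
  have h2 : u2 = 0 := by simpa [hy.ne'] using s2
  have h3 : u1 * y3 - u3 * y1 = 0 := by simpa using s3
  rw [h2] at e2
  have h1 : u1 = 0 := by
    have : u1 * y3 = 0 := by linarith
    exact (mul_eq_zero.1 this).resolve_right hy3.ne'
  have h3' : u3 = 0 := by
    have : u3 * y1 = 0 := by linarith
    exact (mul_eq_zero.1 this).resolve_right hy1.ne'
  subst ha
  have hb : b = 0 := by linarith
  have hh : h = 0 := by linarith
  have hg : g = 0 := by linarith
  refine ⟨rfl, ?_, hg, hh, hb⟩
  subst hb hh hg
  linarith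

theorem plForm_ne_zero {τ : Matrix (Fin 2) (Fin 2) ℂ} (hτ : τ ∈ upperHalfSpace) {m : Fin 5 → ℝ}
    (hm : m ≠ 0) (hq : m 0 * m 1 = m 2 * m 3 - m 4 ^ 2) : plForm τ m ≠ 0 := by
  intro h
  obtain ⟨hs, hpos⟩ := hτ
  have h10 : τ 1 0 = τ 0 1 := hs.apply 0 1
  have hy1 : 0 < (τ 0 0).im := by simpa using hpos.diag_pos (i := 0)
  have hdet := hpos.det_pos
  rw [det_fin_two] at hdet
  simp only [map_apply, h10] at hdet
  have hre := congrArg Complex.re h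
  have him := congrArg Complex.im h
  simp only [plForm, Complex.add_re, Complex.mul_re, Complex.sub_re, Complex.ofReal_re,
    Complex.ofReal_im, Complex.add_im, Complex.mul_im, Complex.sub_im, sq, Complex.zero_re,
    Complex.zero_im, Complex.re_ofNat, Complex.im_ofNat] at hre him
  obtain ⟨h0, h1, h2, h3, h4⟩ := eq_zero_of_quadric_of_form_eq_zero (a := m 0) (f := m 1)
    (g := m 2) (h := m 3) (b := m 4) (x1 := (τ 0 0).re) (x2 := (τ 0 1).re) (x3 := (τ 1 1).re)
    (y1 := (τ 0 0).im) (y2 := (τ 0 1).im) (y3 := (τ 1 1).im) hy1 (by linarith) hq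
    (by linarith) (by linarith)
  apply hm
  funext i
  fin_cases i <;> assumption

theorem plForm_smul (τ : Matrix (Fin 2) (Fin 2) ℂ) (c : ℝ) (m : Fin 5 → ℝ) :
    plForm τ (c • m) = c * plForm τ m := by
  simp only [plForm, Pi.smul_apply, smul_eq_mul]
  push_cast; ring

/-- The form is homogeneous and nonzero on the intersection of the unit sphere with the quadric
cone, which is compact. -/
theorem exists_le_norm_plForm {τ : Matrix (Fin 2) (Fin 2) ℂ} (hτ : τ ∈ upperHalfSpace) :
    ∃ c : ℝ, 0 < c ∧ ∀ m : Fin 5 → ℝ, m 0 * m 1 = m 2 * m 3 - m 4 ^ 2 →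
      c * ‖m‖ ≤ ‖plForm τ m‖ := by
  have hK : IsCompact (Metric.sphere (0 : Fin 5 → ℝ) 1 ∩
      {m | m 0 * m 1 = m 2 * m 3 - m 4 ^ 2}) := by
    refine (isCompact_sphere _ _).inter_right (isClosed_eq ?_ ?_) <;> fun_prop
  have hcont : Continuous fun m : Fin 5 → ℝ => ‖plForm τ m‖ := by
    unfold plForm
    fun_prop
  obtain ⟨c, hc, hle⟩ := hK.exists_forall_le' hcont.continuousOn (a := 0) (by
    rintro m ⟨hm1, hm2⟩
    refine norm_pos_iff.2 (plForm_ne_zero hτ ?_ hm2)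
    rintro rfl
    simp at hm1)
  refine ⟨c, hc, fun m hm => ?_⟩
  rcases eq_or_ne m 0 with rfl | h0
  · simp
  have hpos : 0 < ‖m‖ := norm_pos_iff.2 h0
  have h1 := hle (‖m‖⁻¹ • m) ⟨by simp [norm_smul, hpos.ne'], by
    simp only [Set.mem_ofPred_eq, Pi.smul_apply, smul_eq_mul]
    linear_combination ‖m‖⁻¹ ^ 2 * hm⟩
  rw [plForm_smul, norm_mul, Complex.norm_real, norm_inv, norm_norm] at h1
  rwa [inv_mul_eq_div, le_div_iff₀ hpos] at h1

end LowerBound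

theorem det_autFactor_ne_zero {τ : Matrix (Fin 2) (Fin 2) ℂ} (hτ : τ ∈ upperHalfSpace)
    (γ : Sp ℝ) : (autFactor γ τ).det ≠ 0 := by
  rw [det_autFactor hτ.1]
  exact plForm_ne_zero hτ (plucker_ne_zero γ) (plucker_quadric γ)

theorem slash_eq (k : ℕ) (f : Matrix (Fin 2) (Fin 2) ℂ → ℂ) (γ : Sp ℝ)
    (τ : Matrix (Fin 2) (Fin 2) ℂ) :
    slash k f γ τ = (autFactor γ τ).det ^ (-(k : ℤ)) * f (act γ τ) := by
  rw [slash, SymplecticGroup.det_eq_one γ.2]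
  simp

theorem plucker_toReal (γ : Sp ℤ) : plucker (toReal γ) = fun i => ((plucker γ i : ℤ) : ℝ) := by
  funext i
  fin_cases i <;> simp [plucker, toReal, blkC, blkD, toBlocks₂₁, toBlocks₂₂]

theorem norm_charD_le {N : ℕ} (χ : DirichletCharacter ℂ N) (γ : Sp ℤ) : ‖charD χ γ‖ ≤ 1 :=
  DirichletCharacter.norm_le_one χ _

/-- Absolute convergence of the Eisenstein series. -/
theorem summable_eisensteinTerm {N k : ℕ} (hk : 4 ≤ k) (χ : DirichletCharacter ℂ N) (γ₀ : Sp ℤ)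
    {τ : Matrix (Fin 2) (Fin 2) ℂ} (hτ : τ ∈ upperHalfSpace) :
    Summable fun c : Quotient (orbitSetoid N γ₀) => eisensteinTerm k χ γ₀ τ c.out := by
  obtain ⟨c, hc, hle⟩ := exists_le_norm_plForm hτ
  let φ : Quotient (orbitSetoid N γ₀) → QuadricPoint := fun o =>
    ⟨plucker (γ₀ * (o.out : Sp ℤ)), plucker_ne_zero _, plucker_quadric _⟩
  have hφ : Function.Injective φ := by
    intro o o' h
    rw [← o.out_eq, ← o'.out_eq]
    refine Quotient.sound (QuotientGroup.rightRel_apply.2 ?_)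
    exact mul_inv_mem_GammaInfPlus_of_plucker_eq (congrArg Subtype.val h).symm
  refine Summable.of_norm_bounded ((summable_quadric.comp_injective hφ).mul_left (c ^ k)⁻¹)
    fun o => ?_
  -- A nonzero integral vector has norm at least 1, so exponent k may be lowered to 4.
  have hn : 1 ≤ ‖(φ o).1‖ := by
    obtain ⟨i, hi⟩ := Function.ne_iff.1 (φ o).2.1
    refine le_trans ?_ (abs_apply_le_norm _ i)
    have : 1 ≤ |(φ o).1 i| := Int.one_le_abs hi
    exact_mod_cast this
  have h1 := hle (plucker (toReal (γ₀ * (o.out : Sp ℤ)))) (plucker_quadric _)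
  have h2 : ‖plucker (toReal (γ₀ * (o.out : Sp ℤ)))‖ = ‖(φ o).1‖ := by
    rw [plucker_toReal]; rfl
  rw [h2, ← det_autFactor hτ.1] at h1
  rw [eisensteinTerm, slash_eq, mul_one, norm_mul, RCLike.norm_conj, norm_zpow, _root_.zpow_neg,
    zpow_natCast]
  have hpos : 0 < c * ‖(φ o).1‖ := by positivity
  calc ‖charD χ (o.out : Sp ℤ)‖ * (‖(autFactor (toReal (γ₀ * (o.out : Sp ℤ))) τ).det‖ ^ k)⁻¹ ≤
      1 * ((c * ‖(φ o).1‖) ^ k)⁻¹ := by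
        gcongr
        exact norm_charD_le _ _
    _ = (c ^ k)⁻¹ * (‖(φ o).1‖ ^ k)⁻¹ := by rw [one_mul, mul_pow, mul_inv]
    _ ≤ (c ^ k)⁻¹ * (‖(φ o).1‖ ^ 4)⁻¹ := by gcongr
    _ = _ := by
      simp only [Function.comp_apply]
      rw [Real.rpow_neg (norm_nonneg _)]
      norm_cast

/-! ### The Hecke relation as a permutation of the orbit. -/

section HeckeRelation

/-- `x δ γ` is the product of an upper triangular matrix and `y`, where `δ` is `heckeMat p`. -/
def HeckeRel (p : ℕ) (x γ y : Sp ℤ) : Prop :=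
  ∃ A B U : Matrix (Fin 2) (Fin 2) ℤ,
    x.1 * heckeMat p * γ.1 = fromBlocks A B 0 U * y.1 ∧ 0 < U.det

theorem fromBlocks_mul_coe_of_mem_GammaInfPlus {g : Sp ℤ} (hg : g ∈ GammaInfPlus)
    (A B U : Matrix (Fin 2) (Fin 2) ℤ) :
    fromBlocks A B 0 U * g.1 =
      fromBlocks (A * blkA g) (A * blkB g + B * blkD g) 0 (U * blkD g) := by
  rw [coe_eq_fromBlocks g, hg.1, fromBlocks_multiply]
  simp

theorem coe_mul_fromBlocks_of_mem_GammaInfPlus {g : Sp ℤ} (hg : g ∈ GammaInfPlus)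
    (A B U : Matrix (Fin 2) (Fin 2) ℤ) :
    g.1 * fromBlocks A B 0 U =
      fromBlocks (blkA g * A) (blkA g * B + blkB g * U) 0 (blkD g * U) := by
  rw [coe_eq_fromBlocks g, hg.1, fromBlocks_multiply]
  simp

theorem HeckeRel.congr_right {p : ℕ} {x γ y y' : Sp ℤ} (h : HeckeRel p x γ y)
    (hy : y * y'⁻¹ ∈ GammaInfPlus) : HeckeRel p x γ y' := by
  obtain ⟨A, B, U, h, hU⟩ := h
  have h1 : x.1 * heckeMat p * γ.1 = fromBlocks A B 0 U * (y * y'⁻¹).1 * y'.1 := by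
    rw [h, Matrix.mul_assoc, ← Submonoid.coe_mul, inv_mul_cancel_right]
  rw [fromBlocks_mul_coe_of_mem_GammaInfPlus hy] at h1
  exact ⟨_, _, _, h1, by rwa [det_mul, hy.2, mul_one]⟩

theorem HeckeRel.congr_left {p : ℕ} {x x' γ y : Sp ℤ} (h : HeckeRel p x γ y)
    (hx : x' * x⁻¹ ∈ GammaInfPlus) : HeckeRel p x' γ y := by
  obtain ⟨A, B, U, h, hU⟩ := h
  have h1 : x'.1 * heckeMat p * γ.1 = (x' * x⁻¹).1 * fromBlocks A B 0 U * y.1 := by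
    rw [Matrix.mul_assoc (x' * x⁻¹).1, ← h, ← Matrix.mul_assoc, ← Matrix.mul_assoc,
      ← Submonoid.coe_mul, inv_mul_cancel_right]
  rw [coe_mul_fromBlocks_of_mem_GammaInfPlus hx] at h1
  exact ⟨_, _, _, h1, by rwa [det_mul, hx.2, one_mul]⟩

theorem HeckeRel.right_unique {p : ℕ} {x γ y y' : Sp ℤ} (h : HeckeRel p x γ y)
    (h' : HeckeRel p x γ y') : y' * y⁻¹ ∈ GammaInfPlus := by
  obtain ⟨A, B, U, h, hU⟩ := h
  obtain ⟨A', B', U', h', hU'⟩ := h'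
  exact mul_inv_mem_GammaInfPlus_of_upper (h.symm.trans h') hU hU'

/-- The adjoint relation interchanges the roles of x and y, reducing this to uniqueness of the right
factor; det A · det U = p⁴ keeps the relevant determinant positive. -/
theorem HeckeRel.left_unique {p : ℕ} (hp : p ≠ 0) {x x' γ y : Sp ℤ} (h : HeckeRel p x γ y)
    (h' : HeckeRel p x' γ y) : x' * x⁻¹ ∈ GammaInfPlus := by
  obtain ⟨A, B, U, h, hU⟩ := h
  obtain ⟨A', B', U', h', hU'⟩ := h'
  have hc : (p : ℤ) ^ 2 ≠ 0 := by positivity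
  have key {A U : Matrix (Fin 2) (Fin 2) ℤ} (hAU : A * Uᵀ = ((p : ℤ) ^ 2) • 1) (hU : 0 < U.det) :
      0 < Aᵀ.det := by
    rw [det_transpose]
    refine pos_of_mul_pos_left ?_ hU.le
    rw [det_ne_zero_of_mul_transpose_eq hAU]
    positivity
  exact mul_inv_mem_GammaInfPlus_of_upper
    ((upper_inverse hc (heckeMat_blocks p) h).symm.trans
      (upper_inverse hc (heckeMat_blocks p) h'))
    (key (upper_similitude (heckeMat_blocks p) h).1 hU)
    (key (upper_similitude (heckeMat_blocks p) h').1 hU')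

variable {N₀ N₁ N₂ : ℕ} {d : Fin 2 → ℤ} {p : ℕ}

theorem exists_heckeRel_right (hd : IsCuspDiag N₀ N₁ N₂ d) (hN : Squarefree (N₀ * N₁ * N₂))
    (hp : p ≠ 0) (hpN : p.Coprime (N₀ * N₁ * N₂)) {h γ : Sp ℤ} (hh : h ∈ Gamma0 (N₀ * N₁ * N₂))
    (hγ : γ ∈ Gamma0 (N₀ * N₁ * N₂)) :
    ∃ h' ∈ Gamma0 (N₀ * N₁ * N₂), HeckeRel p (cuspRep d * h) γ (cuspRep d * h') := by
  obtain ⟨h', hh', A, B, U, hX, hU⟩ := exists_upper_mul_orbit hd hN (c := (p : ℤ) ^ 2)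
    (by positivity) (Nat.Coprime.isCoprime hpN).pow_left (heckeMat_blocks p) hh hγ
  exact ⟨h', hh', A, B, U, hX, hU⟩

/-- Factoring γ_ρ h' γ⁻¹ diag(p², p, 1, p), whose middle matrix is p² δ⁻¹, and passing to the
adjoint relation yields the required left factor. -/
theorem exists_heckeRel_left (hd : IsCuspDiag N₀ N₁ N₂ d) (hN : Squarefree (N₀ * N₁ * N₂))
    (hp : p ≠ 0) (hpN : p.Coprime (N₀ * N₁ * N₂)) {h' γ : Sp ℤ}
    (hh' : h' ∈ Gamma0 (N₀ * N₁ * N₂)) (hγ : γ ∈ Gamma0 (N₀ * N₁ * N₂)) :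
    ∃ h ∈ Gamma0 (N₀ * N₁ * N₂), HeckeRel p (cuspRep d * h) γ (cuspRep d * h') := by
  have hab : diagonal ![(p : ℤ) ^ 2, (p : ℤ)] * (diagonal ![1, (p : ℤ)])ᵀ =
      ((p : ℤ) ^ 2) • 1 := by
    ext i j
    fin_cases i <;> fin_cases j <;> simp [sq]
  have hc : (p : ℤ) ^ 2 ≠ 0 := by positivity
  obtain ⟨h, hh, A, B, U, hX, hU⟩ := exists_upper_mul_orbit hd hN (c := (p : ℤ) ^ 2)
    hc (Nat.Coprime.isCoprime hpN).pow_left hab (mul_mem hh' (inv_mem hγ)) (one_mem _)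
  refine ⟨h, hh, Uᵀ, -Bᵀ, Aᵀ, ?_, ?_⟩
  · have h1 := upper_inverse hc hab hX
    rw [inv_one, OneMemClass.coe_one, Matrix.mul_one, diagonal_transpose, diagonal_transpose] at h1
    rw [heckeMat, h1, Matrix.mul_assoc, ← Submonoid.coe_mul, mul_assoc, inv_mul_cancel_right]
  · rw [det_transpose]
    refine pos_of_mul_pos_left ?_ hU.le
    rw [det_ne_zero_of_mul_transpose_eq (upper_similitude hab hX).1]
    positivity

theorem quotient_orbit_eq_iff {N : ℕ} {γ₀ : Sp ℤ} (o o' : Quotient (orbitSetoid N γ₀)) :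
    o = o' ↔ (γ₀ * (o'.out : Sp ℤ)) * (γ₀ * (o.out : Sp ℤ))⁻¹ ∈ GammaInfPlus := by
  conv_lhs => rw [← o.out_eq, ← o'.out_eq]
  exact Quotient.eq.trans QuotientGroup.rightRel_apply

theorem mul_out_mk_mem {N : ℕ} {γ₀ : Sp ℤ} (h : Gamma0 N) :
    (γ₀ * (h : Sp ℤ)) * (γ₀ * ((Quotient.mk (orbitSetoid N γ₀) h).out : Sp ℤ))⁻¹ ∈
      GammaInfPlus :=
  QuotientGroup.rightRel_apply.1 (Quotient.mk_out (s := orbitSetoid N γ₀) h)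

/-- For each coset of the Hecke operator, `HeckeRel` is the graph of a permutation of the orbit. -/
theorem exists_heckeRel_equiv (hd : IsCuspDiag N₀ N₁ N₂ d) (hN : Squarefree (N₀ * N₁ * N₂))
    (hp : p ≠ 0) (hpN : p.Coprime (N₀ * N₁ * N₂)) {γ : Sp ℤ}
    (hγ : γ ∈ Gamma0 (N₀ * N₁ * N₂)) :
    ∃ e : Quotient (orbitSetoid (N₀ * N₁ * N₂) (cuspRep d)) ≃
      Quotient (orbitSetoid (N₀ * N₁ * N₂) (cuspRep d)),
      ∀ o, HeckeRel p (cuspRep d * (o.out : Sp ℤ)) γ (cuspRep d * ((e o).out : Sp ℤ)) := by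
  have h1 (o : Quotient (orbitSetoid (N₀ * N₁ * N₂) (cuspRep d))) :
      ∃ o' : Quotient (orbitSetoid (N₀ * N₁ * N₂) (cuspRep d)),
        HeckeRel p (cuspRep d * (o.out : Sp ℤ)) γ (cuspRep d * (o'.out : Sp ℤ)) := by
    obtain ⟨h', hh', h⟩ := exists_heckeRel_right hd hN hp hpN o.out.2 hγ
    exact ⟨Quotient.mk _ ⟨h', hh'⟩, h.congr_right (mul_out_mk_mem ⟨h', hh'⟩)⟩
  choose φ hφ using h1
  refine ⟨Equiv.ofBijective φ ⟨fun o o' h => ?_, fun o' => ?_⟩, hφ⟩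
  · have h2 := hφ o'
    rw [← h] at h2
    exact (quotient_orbit_eq_iff o o').2 ((hφ o).left_unique hp h2)
  · obtain ⟨h, hh, h2⟩ := exists_heckeRel_left hd hN hp hpN o'.out.2 hγ
    refine ⟨Quotient.mk _ ⟨h, hh⟩, ?_⟩
    have h3 := h2.congr_left (x' := cuspRep d * ((Quotient.mk (orbitSetoid _ (cuspRep d))
      ⟨h, hh⟩).out : Sp ℤ)) (by
        have := inv_mem (mul_out_mk_mem (γ₀ := cuspRep d) ⟨h, hh⟩)
        rwa [_root_.mul_inv_rev, inv_inv] at this)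
    exact (quotient_orbit_eq_iff _ _).2 ((hφ _).right_unique h3)

end HeckeRelation

/-! ### Total weight over the Hecke cosets. -/

section Weight

variable {p : ℕ} [hp : Fact p.Prime]

open Classical in
/-- The value at a primitive vector of a function of its position relative to the standard
Lagrangian. -/
noncomputable def vecWeight (g : ℕ → ℂ)
    (v : (ZMod (p ^ 2) × ZMod (p ^ 2)) × ZMod (p ^ 2) × ZMod (p ^ 2)) : ℂ :=
  if v.1 ∈ primPairs p then g 3 else if v.1.1 * v.2.1 + v.1.2 * v.2.2 = 0 then g 1 else g 2

/-- `det_upper_cases` is applied to an integral lift of f and z = γ y⁻¹. Since any base vector may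
be used and U does not depend on it, the weight is constant on the translate attached to a coset. -/
theorem exists_det_eq_and_vecWeight_eq (g : ℕ → ℂ) {x γ y : Sp ℤ}
    {A B U : Matrix (Fin 2) (Fin 2) ℤ}
    (h : x.1 * heckeMat p * γ.1 = fromBlocks A B 0 U * y.1) (hU : 0 < U.det)
    {f : (ZMod (p ^ 2) × ZMod (p ^ 2)) × ZMod (p ^ 2) × ZMod (p ^ 2)} (hf : f ∈ baseVecs p) :
    ∃ j ∈ Finset.Icc 1 3, U.det = (p : ℤ) ^ j ∧ vecWeight g (actVec f (γ * y⁻¹)) = g j := by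
  obtain ⟨F, hF⟩ : ∃ F : Fin 2 ⊕ Fin 2 → ℤ, ∀ j, (F j : ZMod (p ^ 2)) = vecOf f j :=
    ⟨fun j => (ZMod.intCast_surjective (vecOf f j)).choose,
      fun j => (ZMod.intCast_surjective (vecOf f j)).choose_spec⟩
  have hT : x.1 * heckeMat p * (γ * y⁻¹).1 = fromBlocks A B 0 U := by
    rw [Submonoid.coe_mul, ← Matrix.mul_assoc, h, Matrix.mul_assoc, coe_mul_coe_inv,
      Matrix.mul_one]
  obtain ⟨v, hv⟩ : ∃ v, v = F ᵥ* (γ * y⁻¹).1 := ⟨_, rfl⟩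
  have hvF (j) : (v j : ZMod (p ^ 2)) = vecOf (actVec f (γ * y⁻¹)) j := by
    rw [hv, vecOf_actVec, vecMul, vecMul, dotProduct, dotProduct]
    push_cast
    exact Finset.sum_congr rfl fun l _ => by rw [hF]; rfl
  rw [mem_baseVecs] at hf
  obtain ⟨f0, f1, f2, f3⟩ := hf
  have hcases := det_upper_cases hT hU (f := F) (v := v)
    (by rw [← prime_dvd_intCast_iff, hF]; exact f0) (by rw [← prime_dvd_intCast_iff, hF]; exact f1)
    (by rw [← intCast_sq_eq_zero_iff, hF]; exact f2)
    (by rw [← prime_dvd_intCast_iff, hF]; exact f3) hv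
  set w := actVec f (γ * y⁻¹) with hw
  have hprim : w.1 ∈ primPairs p ↔ ¬ ((p : ℤ) ∣ v (.inl 0) ∧ (p : ℤ) ∣ v (.inl 1)) := by
    rw [mem_primPairs, ← prime_dvd_intCast_iff, ← prime_dvd_intCast_iff, hvF, hvF]
    rfl
  have hzero : w.1.1 * w.2.1 + w.1.2 * w.2.2 = 0 ↔
      (p : ℤ) ^ 2 ∣ v (.inl 0) * v (.inr 0) + v (.inl 1) * v (.inr 1) := by
    rw [← intCast_sq_eq_zero_iff]
    push_cast
    rw [hvF, hvF, hvF, hvF]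
    rfl
  unfold vecWeight
  rcases hcases with ⟨h1, h2⟩ | ⟨h1, h3, h2⟩ | ⟨h1, h3, h2⟩
  · exact ⟨3, by simp, h2, by rw [if_pos (hprim.2 h1)]⟩
  · exact ⟨1, by simp, h2, by rw [if_neg (fun h => hprim.1 h h1), if_pos (hzero.2 h3)]⟩
  · exact ⟨2, by simp, h2, by
      rw [if_neg (fun h => hprim.1 h h1), if_neg (fun h => h3 (hzero.1 h))]⟩

variable (p) in
theorem one_zero_mem_baseVecs :
    (((1, 0), 0, 0) : (ZMod (p ^ 2) × ZMod (p ^ 2)) × ZMod (p ^ 2) × ZMod (p ^ 2)) ∈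
      baseVecs p := by
  rw [mem_baseVecs]
  refine ⟨fun h => ?_, dvd_zero _, rfl, dvd_zero _⟩
  have h1 := (prime_dvd_intCast_iff (p := p) 1).1 (by exact_mod_cast h)
  exact (Nat.prime_iff_prime_int.1 hp.out).not_dvd_one h1

theorem norm_vecWeight_le (g : ℕ → ℂ)
    (v : (ZMod (p ^ 2) × ZMod (p ^ 2)) × ZMod (p ^ 2) × ZMod (p ^ 2)) :
    ‖vecWeight g v‖ ≤ ‖g 1‖ + ‖g 2‖ + ‖g 3‖ := by
  have h1 := norm_nonneg (g 1)
  have h2 := norm_nonneg (g 2)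
  have h3 := norm_nonneg (g 3)
  unfold vecWeight
  split_ifs <;> linarith

/-- The sum over the Hecke cosets of the weights of the matrices carrying the orbit to `y`. -/
theorem sum_vecWeight {N : ℕ} [Fintype (HeckeCosets N p)] (hpN : p.Coprime N) (g : ℕ → ℂ)
    {y : Sp ℤ} (hy : ∀ c : HeckeCosets N p, ∃ x, HeckeRel p x c.out.1 y) :
    ∑ c : HeckeCosets N p, vecWeight (p := p) g (actVec ((1, 0), 0, 0) (c.out.1 * y⁻¹)) =
      (p + 1) * g 1 + (p ^ 2 - 1) * g 2 + (p ^ 4 + p ^ 3) * g 3 := by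
  have hp0 : (p : ℂ) ≠ 0 := by exact_mod_cast hp.out.ne_zero
  have hp1 : (p : ℂ) - 1 ≠ 0 := by
    rw [sub_ne_zero]
    exact_mod_cast hp.out.one_lt.ne'
  have hne : (p : ℂ) ^ 3 * (p - 1) ≠ 0 := mul_ne_zero (pow_ne_zero _ hp0) hp1
  -- The factor p³(p - 1) is the number of base vectors: multiplying by it replaces one vector per
  -- coset by the whole translate, and the translates exhaust the primitive vectors.
  apply mul_left_cancel₀ hne
  have h1 := sum_heckeCosets_baseVecs hpN y (vecWeight g)
  have h2 := sum_primVecs (p := p) (g 1) (g 2) (g 3)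
  rw [← h2]
  refine Eq.trans ?_ h1
  rw [Finset.mul_sum]
  refine Finset.sum_congr rfl fun c _ => ?_
  obtain ⟨x, A, B, U, hx, hU⟩ := hy c
  rw [← card_baseVecs, ← nsmul_eq_mul]
  refine (Finset.sum_eq_card_nsmul fun f hf => ?_).symm
  obtain ⟨j, -, hj, e⟩ := exists_det_eq_and_vecWeight_eq g hx hU hf
  obtain ⟨j', -, hj', e'⟩ := exists_det_eq_and_vecWeight_eq g hx hU (one_zero_mem_baseVecs p)
  rw [hj] at hj'
  rw [e, e', Int.pow_right_injective (by simpa using hp.out.one_lt) hj']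

end Weight

/-! ### The automorphy factor along the Hecke relation. -/

section Automorphy

theorem autFactor_mul {τ : Matrix (Fin 2) (Fin 2) ℂ} (γ g : Sp ℝ)
    (h : (autFactor g τ).det ≠ 0) :
    autFactor (γ * g) τ = autFactor γ (act g τ) * autFactor g τ := by
  have h1 : act g τ * autFactor g τ =
      (blkA g).map Complex.ofReal * τ + (blkB g).map Complex.ofReal := by
    rw [act, Matrix.mul_assoc, nonsing_inv_mul _ (isUnit_iff_ne_zero.2 h), Matrix.mul_one]
  have hm (X Y : Matrix (Fin 2) (Fin 2) ℝ) : (X * Y).map Complex.ofReal =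
      X.map Complex.ofReal * Y.map Complex.ofReal := Matrix.map_mul (f := Complex.ofRealHom)
  have ha (X Y : Matrix (Fin 2) (Fin 2) ℝ) : (X + Y).map Complex.ofReal =
      X.map Complex.ofReal + Y.map Complex.ofReal :=
    Matrix.map_add _ (fun a b => Complex.ofReal_add a b) X Y
  rw [autFactor.eq_1 γ, Matrix.add_mul, Matrix.mul_assoc, h1, autFactor, autFactor, blkC_mul,
    blkD_mul, ha, ha, hm, hm, hm, hm]
  simp only [Matrix.add_mul, Matrix.mul_add, Matrix.mul_assoc]
  abel

/-- The scalar c is needed because the integral relation involves p δ₁⁻¹ instead of δ₁⁻¹; in degree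
two it contributes c². -/
theorem det_autFactor_of_upper {τ : Matrix (Fin 2) (Fin 2) ℂ} {c : ℝ} {g y : Sp ℝ}
    {A B U : Matrix (Fin 2) (Fin 2) ℝ} (h : c • g.1 = fromBlocks A B 0 U * y.1) :
    (c : ℂ) ^ 2 * (autFactor g τ).det = U.det * (autFactor y τ).det := by
  have hC : c • blkC g = U * blkC y := by
    have := congrArg toBlocks₂₁ h
    rwa [toBlocks₂₁_mul_coe, toBlocks_fromBlocks₂₁, toBlocks_fromBlocks₂₂, Matrix.zero_mul,
      zero_add] at this
  have hD : c • blkD g = U * blkD y := by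
    have := congrArg toBlocks₂₂ h
    rwa [toBlocks₂₂_mul_coe, toBlocks_fromBlocks₂₁, toBlocks_fromBlocks₂₂, Matrix.zero_mul,
      zero_add] at this
  have hm (X Y : Matrix (Fin 2) (Fin 2) ℝ) : (X * Y).map Complex.ofReal =
      X.map Complex.ofReal * Y.map Complex.ofReal := Matrix.map_mul (f := Complex.ofRealHom)
  have hs (X : Matrix (Fin 2) (Fin 2) ℝ) : (c • X).map Complex.ofReal =
      (c : ℂ) • X.map Complex.ofReal := by
    ext i j; simp
  have h1 : (c : ℂ) • autFactor g τ = U.map Complex.ofReal * autFactor y τ := by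
    rw [autFactor, smul_add, ← Matrix.smul_mul, ← hs, ← hs, hC, hD, hm, hm, autFactor,
      Matrix.mul_add, Matrix.mul_assoc]
  have h2 := congrArg det h1
  rw [det_smul, det_mul, Fintype.card_fin] at h2
  rw [h2]
  congr 1
  exact (RingHom.map_det Complex.ofRealHom U).symm

theorem coe_delta1_inv_smul (p : ℕ) [NeZero p] :
    (p : ℝ) • ((delta1 p)⁻¹).1 = (heckeMat p).map (Int.castRingHom ℝ) := by
  have hp : (p : ℝ) ≠ 0 := NeZero.ne _
  rw [coe_inv_eq, heckeMat]
  ext i j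
  rcases i with i | i <;> rcases j with j | j <;> fin_cases i <;> fin_cases j <;>
    simp [blkA, blkB, blkC, blkD, delta1, hp, sq]

theorem det_autFactor_hecke {p : ℕ} [NeZero p] {x γ y : Sp ℤ}
    {A B U : Matrix (Fin 2) (Fin 2) ℤ} (h : x.1 * heckeMat p * γ.1 = fromBlocks A B 0 U * y.1)
    (τ : Matrix (Fin 2) (Fin 2) ℂ) :
    (p : ℂ) ^ 2 * (autFactor (toReal x * ((delta1 p)⁻¹ * toReal γ)) τ).det =
      U.det * (autFactor (toReal y) τ).det := by
  have h1 := congrArg (fun X => X.map (Int.castRingHom ℝ)) h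
  simp only [Matrix.map_mul, fromBlocks_map, map_zero, Matrix.map_zero] at h1
  rw [← coe_delta1_inv_smul, Matrix.mul_smul, Matrix.smul_mul, Matrix.mul_assoc] at h1
  have h2 := det_autFactor_of_upper (τ := τ) (c := p)
    (g := toReal x * ((delta1 p)⁻¹ * toReal γ)) (y := toReal y) h1
  have h3 : ((U.map (Int.castRingHom ℝ)).det : ℂ) = U.det := by
    have := (RingHom.map_det (Int.castRingHom ℝ) U).symm
    rw [RingHom.mapMatrix_apply] at this
    rw [this]
    simp
  rw [h3] at h2
  simpa using h2

end Automorphy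

/-! ### The eigenvalue equation. -/

section Main

variable {N₀ N₁ N₂ : ℕ}

/-- The factor by which a term of the Eisenstein series is multiplied by a coset of the Hecke
operator whose upper triangular part has lower right determinant `p ^ j`. -/
noncomputable def heckeWeight (k p : ℕ) (χ₀ : DirichletCharacter ℂ N₀)
    (χ₁ : DirichletCharacter ℂ N₁) (χ₂ : DirichletCharacter ℂ N₂) (j : ℕ) : ℂ :=
  χ₀ p ^ (3 - j) * χ₁ p ^ (3 - j) * χ₂ p ^ (j - 1) * ((p : ℂ) ^ j / p ^ 2) ^ (-(k : ℤ))

variable {d : Fin 2 → ℤ} {χ : DirichletCharacter ℂ (N₀ * N₁ * N₂)}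
  {χ₀ : DirichletCharacter ℂ N₀} {χ₁ : DirichletCharacter ℂ N₁} {χ₂ : DirichletCharacter ℂ N₂}
  {k p : ℕ} [hp : Fact p.Prime] {τ : Matrix (Fin 2) (Fin 2) ℂ}

/-- The cocycle relation merges the two automorphy factors into det U / p² = p^j / p² times the
factor of the term h'; the three character values merge by `conj_charD_mul_conj_charD`. The
constants form the weight of index j, which the vector recovers without reference to U. -/
theorem hecke_eisensteinTerm (hd : IsCuspDiag N₀ N₁ N₂ d) (hN : Squarefree (N₀ * N₁ * N₂))
    (hχ : ∀ a : ℤ, χ (a : ZMod (N₀ * N₁ * N₂)) =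
      χ₀ (a : ZMod N₀) * χ₁ (a : ZMod N₁) * χ₂ (a : ZMod N₂))
    (hχ₁ : χ₁ ^ 2 = 1) (hpN : p.Coprime (N₀ * N₁ * N₂)) (hτ : τ ∈ upperHalfSpace)
    {h γ h' : Gamma0 (N₀ * N₁ * N₂)}
    (hrel : HeckeRel p (cuspRep d * (h : Sp ℤ)) γ (cuspRep d * (h' : Sp ℤ))) :
    starRingEnd ℂ (charD χ γ) * (autFactor ((delta1 p)⁻¹ * toReal γ) τ).det ^ (-(k : ℤ)) *
        eisensteinTerm k χ (cuspRep d) (act ((delta1 p)⁻¹ * toReal γ) τ) h =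
      vecWeight (p := p) (heckeWeight k p χ₀ χ₁ χ₂)
        (actVec ((1, 0), 0, 0) ((γ : Sp ℤ) * (cuspRep d * (h' : Sp ℤ))⁻¹)) *
        eisensteinTerm k χ (cuspRep d) τ h' := by
  obtain ⟨A, B, U, hX, hU⟩ := hrel
  obtain ⟨j, hj, hUj, e⟩ := exists_det_eq_and_vecWeight_eq (heckeWeight k p χ₀ χ₁ χ₂) hX hU
    (one_zero_mem_baseVecs p)
  have hp0 : (p : ℂ) ≠ 0 := by exact_mod_cast hp.out.ne_zero
  have hchar := conj_charD_mul_conj_charD hd hN hχ hχ₁ hpN (heckeMat_blocks p)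
    (by rw [det_diagonal, Fin.prod_univ_two]; simp; ring) h.2 γ.2 h'.2 hX hj hUj
  have haut := det_autFactor_hecke hX τ
  rw [autFactor_mul _ _ (det_autFactor_ne_zero hτ _), det_mul, hUj] at haut
  have haut' : (autFactor (toReal (cuspRep d * (h : Sp ℤ)))
        (act ((delta1 p)⁻¹ * toReal γ) τ)).det *
        (autFactor ((delta1 p)⁻¹ * toReal γ) τ).det =
      ((p : ℂ) ^ j / p ^ 2) * (autFactor (toReal (cuspRep d * (h' : Sp ℤ))) τ).det := by
    push_cast at haut
    field_simp
    linear_combination haut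
  rw [e, heckeWeight, eisensteinTerm, eisensteinTerm, slash_eq, slash_eq]
  have hpow := congrArg (· ^ (-(k : ℤ))) haut'
  simp only [mul_zpow] at hpow
  calc _ = (starRingEnd ℂ (charD χ h) * starRingEnd ℂ (charD χ γ)) *
        ((autFactor (toReal (cuspRep d * (h : Sp ℤ)))
          (act ((delta1 p)⁻¹ * toReal γ) τ)).det ^ (-(k : ℤ)) *
        (autFactor ((delta1 p)⁻¹ * toReal γ) τ).det ^ (-(k : ℤ))) := by ring
    _ = _ := by rw [hchar, hpow]; ring

/-- The three counts are p + 1 times 1, p - 1 and p³, while the weights carry p^k, 1 and p^{-k}.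
After multiplication by p^{k-3} the powers become p^{2k-3}, p^{k-3}(p - 1) and 1. -/
theorem hecke_eigenvalue (k p : ℕ) [hp : Fact p.Prime] (χ₀ : DirichletCharacter ℂ N₀)
    (χ₁ : DirichletCharacter ℂ N₁) (χ₂ : DirichletCharacter ℂ N₂) (h₁ : χ₁ p ^ 2 = 1) :
    (p : ℂ) ^ ((k : ℤ) - 3) * ((p + 1) * heckeWeight k p χ₀ χ₁ χ₂ 1 +
        (p ^ 2 - 1) * heckeWeight k p χ₀ χ₁ χ₂ 2 + (p ^ 4 + p ^ 3) * heckeWeight k p χ₀ χ₁ χ₂ 3) =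
      ((p : ℂ) + 1) * (χ₀ ((p ^ 2 : ℕ) : ZMod N₀) * (p : ℂ) ^ (2 * (k : ℤ) - 3)
        + χ₀ p * χ₁ p * χ₂ p * (p : ℂ) ^ ((k : ℤ) - 3) * ((p : ℂ) - 1)
        + χ₂ ((p ^ 2 : ℕ) : ZMod N₂)) := by
  have hp0 : (p : ℂ) ≠ 0 := by exact_mod_cast hp.out.ne_zero
  have e1 : ((p : ℂ) ^ 1 / p ^ 2) ^ (-(k : ℤ)) = (p : ℂ) ^ k := by
    rw [pow_one, sq, div_mul_cancel_left₀ hp0, _root_.inv_zpow', neg_neg, zpow_natCast]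
  have e2 : ((p : ℂ) ^ 2 / p ^ 2) ^ (-(k : ℤ)) = 1 := by
    rw [div_self (pow_ne_zero _ hp0), _root_.one_zpow]
  have e3 : ((p : ℂ) ^ 3 / p ^ 2) ^ (-(k : ℤ)) = ((p : ℂ) ^ k)⁻¹ := by
    rw [pow_succ (p : ℂ) 2, mul_div_cancel_left₀ _ (pow_ne_zero _ hp0), _root_.zpow_neg,
      zpow_natCast]
  have e4 : (p : ℂ) ^ ((k : ℤ) - 3) = p ^ k / p ^ 3 := by
    rw [zpow_sub₀ hp0]; norm_cast
  have e5 : (p : ℂ) ^ (2 * (k : ℤ) - 3) = (p ^ k) ^ 2 / p ^ 3 := by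
    rw [zpow_sub₀ hp0, ← pow_mul, mul_comm k 2]; norm_cast
  have hpk : (p : ℂ) ^ k ≠ 0 := pow_ne_zero _ hp0
  simp only [heckeWeight, e1, e2, e3]
  rw [e4, e5]
  push_cast
  rw [map_pow, map_pow]
  norm_num
  rw [h₁]
  field_simp
  ring

/-- The Siegel Eisenstein series is an eigenfunction of `T₁(p²)`. -/
theorem heckeT1_eisenstein (hk : 4 ≤ k) (hd : IsCuspDiag N₀ N₁ N₂ d)
    (hN : Squarefree (N₀ * N₁ * N₂))
    (hχ : ∀ a : ℤ, χ (a : ZMod (N₀ * N₁ * N₂)) =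
      χ₀ (a : ZMod N₀) * χ₁ (a : ZMod N₁) * χ₂ (a : ZMod N₂))
    (hχ₁ : χ₁ ^ 2 = 1) (hpN : p.Coprime (N₀ * N₁ * N₂)) (hτ : τ ∈ upperHalfSpace) :
    heckeT1 k χ p (eisenstein k χ (cuspRep d)) τ = (p : ℂ) ^ ((k : ℤ) - 3) *
      ((p + 1) * heckeWeight k p χ₀ χ₁ χ₂ 1 + (p ^ 2 - 1) * heckeWeight k p χ₀ χ₁ χ₂ 2 +
        (p ^ 4 + p ^ 3) * heckeWeight k p χ₀ χ₁ χ₂ 3) * eisenstein k χ (cuspRep d) τ := by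
  have : NeZero (N₀ * N₁ * N₂) := ⟨hN.ne_zero⟩
  have := finite_heckeCosets (N₀ * N₁ * N₂) p
  have := Fintype.ofFinite (HeckeCosets (N₀ * N₁ * N₂) p)
  have hequiv (c : HeckeCosets (N₀ * N₁ * N₂) p) :=
    exists_heckeRel_equiv hd hN hp.out.ne_zero hpN c.out.2
  choose e he using hequiv
  set w : HeckeCosets (N₀ * N₁ * N₂) p → Quotient (orbitSetoid (N₀ * N₁ * N₂) (cuspRep d)) → ℂ :=
    fun c o => vecWeight (p := p) (heckeWeight k p χ₀ χ₁ χ₂)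
      (actVec ((1, 0), 0, 0) ((c.out : Sp ℤ) * (cuspRep d * (o.out : Sp ℤ))⁻¹)) with hw
  have hsum := summable_eisensteinTerm hk χ (cuspRep d) hτ
  have hsumw (c) : Summable fun o => w c o * eisensteinTerm k χ (cuspRep d) τ o.out :=
    Summable.of_norm_bounded (hsum.norm.mul_left _) fun o => by
      rw [norm_mul]
      exact mul_le_mul_of_nonneg_right (norm_vecWeight_le _ _) (norm_nonneg _)
  have hterm (c : HeckeCosets (N₀ * N₁ * N₂) p) :
      starRingEnd ℂ (charD χ (c.out : Gamma0 (N₀ * N₁ * N₂))) *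
        slash k (eisenstein k χ (cuspRep d))
          ((delta1 p)⁻¹ * toReal ((c.out : Gamma0 (N₀ * N₁ * N₂)) : Sp ℤ)) τ =
      (1 / 2) * ∑' o, w c o * eisensteinTerm k χ (cuspRep d) τ o.out := by
    -- Each Hecke coset only permutes the orbit, so the series is reindexed by the target coset h'.
    rw [slash_eq, eisenstein, ← (e c).tsum_eq (fun o => w c o * _)]
    rw [mul_left_comm _ (1 / 2 : ℂ), mul_left_comm _ (1 / 2 : ℂ), ← mul_assoc _ _ (tsum _),
      ← tsum_mul_left]
    congr 1
    exact tsum_congr fun o => hecke_eisensteinTerm hd hN hχ hχ₁ hpN hτ (he c o)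
  rw [heckeT1, finsum_eq_sum_of_fintype, Finset.sum_congr rfl fun c _ => hterm c,
    ← Finset.mul_sum, ← Summable.tsum_finsetSum fun c _ => hsumw c]
  have hw' (o : Quotient (orbitSetoid (N₀ * N₁ * N₂) (cuspRep d))) :
      ∑ c, w c o * eisensteinTerm k χ (cuspRep d) τ o.out =
      ((p + 1) * heckeWeight k p χ₀ χ₁ χ₂ 1 + (p ^ 2 - 1) * heckeWeight k p χ₀ χ₁ χ₂ 2 +
        (p ^ 4 + p ^ 3) * heckeWeight k p χ₀ χ₁ χ₂ 3) *
        eisensteinTerm k χ (cuspRep d) τ o.out := by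
    -- For every coset c, the preimage of o under the permutation e c supplies the x required by the
    -- count.
    rw [← Finset.sum_mul, sum_vecWeight hpN _ fun c => ⟨_, by
      simpa using he c ((e c).symm o)⟩]
  rw [tsum_congr hw', tsum_mul_left, eisenstein]
  ring

end Main

end SiegelDegTwo

theorem proposition3p4
    (k : ℕ) (hk : 4 ≤ k)
    (N N₀ N₁ N₂ : ℕ) (hN : Squarefree N) (hρ : N₀ * N₁ * N₂ = N)
    (χ : DirichletCharacter ℂ N)
    (χ₀ : DirichletCharacter ℂ N₀) (χ₁ : DirichletCharacter ℂ N₁) (χ₂ : DirichletCharacter ℂ N₂)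
    (hχ : ∀ a : ℤ, χ (a : ZMod N) = χ₀ (a : ZMod N₀) * χ₁ (a : ZMod N₁) * χ₂ (a : ZMod N₂))
    (hχ₁ : χ₁ ^ 2 = 1)
    (d : Fin 2 → ℤ) (hd : SiegelDegTwo.IsCuspDiag N₀ N₁ N₂ d)
    (p : ℕ) [Fact p.Prime] (hp : ¬ p ∣ N)
    (τ : Matrix (Fin 2) (Fin 2) ℂ) (hτ : τ ∈ SiegelDegTwo.upperHalfSpace) :
    Summable (fun c : Quotient (SiegelDegTwo.orbitSetoid N (SiegelDegTwo.cuspRep d)) =>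
      SiegelDegTwo.eisensteinTerm k χ (SiegelDegTwo.cuspRep d) τ c.out) ∧
    SiegelDegTwo.heckeT1 k χ p (SiegelDegTwo.eisenstein k χ (SiegelDegTwo.cuspRep d)) τ =
      ((p : ℂ) + 1) *
        (χ₀ ((p ^ 2 : ℕ) : ZMod N₀) * (p : ℂ) ^ (2 * (k : ℤ) - 3)
          + χ (p : ZMod N) * (p : ℂ) ^ ((k : ℤ) - 3) * ((p : ℂ) - 1)
          + χ₂ ((p ^ 2 : ℕ) : ZMod N₂)) *
        SiegelDegTwo.eisenstein k χ (SiegelDegTwo.cuspRep d) τ := by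
  subst hρ
  have hpN : p.Coprime (N₀ * N₁ * N₂) := (Fact.out : p.Prime).coprime_iff_not_dvd.2 hp
  have hpN₁ : p.Coprime N₁ := (hpN.coprime_mul_right_right).coprime_mul_left_right
  have h₁ : χ₁ p ^ 2 = 1 := by
    rw [← ZMod.coe_unitOfCoprime p hpN₁, ← MulChar.pow_apply_coe, hχ₁]
    exact MulChar.one_apply_coe _
  have hχp : χ (p : ZMod (N₀ * N₁ * N₂)) = χ₀ p * χ₁ p * χ₂ p := by
    simpa using hχ p
  refine ⟨SiegelDegTwo.summable_eisensteinTerm hk χ _ hτ, ?_⟩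
  rw [SiegelDegTwo.heckeT1_eisenstein hk hd hN hχ hχ₁ hpN hτ,
    SiegelDegTwo.hecke_eigenvalue k p χ₀ χ₁ χ₂ h₁, hχp]
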